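/- **Setting.** Let $\mathcal X$ be a finite non-empty data universe, $n\ge 1$; a dataset is $D\in\mathcal X^n$, and $D\sim D'$ (adjacent) means that they differ in at most one row. A randomized algorithm $M$ on datasets is $(\varepsilon,\delta)$-differentially private if $\Pr[M(D)\in A]\le e^{\varepsilon}\Pr[M(D')\in A]+\delta$ for all $D\sim D'$ and all measurable $A$. We identify $D$ with its histogram $D(x)=\frac1n\#\{i: D_i=x\}$. Let $\Theta\subseteq\mathbb R^d$ be convex and let $\mathcal L$ be a (measurably indexed) family of functions $\ell:\Theta\times\mathcal X\to\mathbb R$ such that each $\ell_x=\ell(\cdot;x)$ is convex and differentiable on $\Theta$. For a probability vector $p$ on $\mathcal X$ write $\ell(\theta;p)=\sum_x p(x)\ell(\theta;x)$; assume that $\operatorname{argmin}_{\theta\in\Theta}\ell(\theta;p)$ is never empty and fix a measurable rule that selects a point of it. Put $\mathrm{err}_\ell(D,p)=\ell(\operatorname{argmin}_{\theta\in\Theta}\ell(\theta;p);D)-\min_{\theta\in\Theta}\ell(\theta;D)$. Let $S>0$ be such that $|\langle\theta-\theta',\nabla\ell_x(\theta)\rangle|\le S$ for all $\ell\in\mathcal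 L$, $x\in\mathcal X$, $\theta,\theta'\in\Theta$. Let $\alpha>0$, $0<\varepsilon\le1$, $\delta>0$, $k\in\mathbb N$, and $$T=\left\lceil \frac{64S^2\log|\mathcal X|}{\alpha^2}\right\rceil,\quad \eta=\sqrt{\frac{\log|\mathcal X|}{T}},\quad \varepsilon_0=\frac{\varepsilon}{\sqrt{8T\log(4/\delta)}},\quad \delta_0=\frac{\delta}{4T}.$$ **Ingredients.** $\mathcal A'$ is a single-query oracle: a randomized algorithm that maps a dataset $D$ and a loss $\ell\in\mathcal L$ to a point of $\Theta$ (measurably in $\ell$). $\mathcal{SV}$ is a stateful randomized online algorithm that holds $D$ and answers adaptively chosen queries $q:\mathcal X^n\to\mathbb R$ by $\top$ or $\bot$ until it halts. **The algorithm.** Start with the uniform histogram $\hat D$ on $\mathcal X$. In each of the rounds $j=1,\dots,k$: receive $\ell=\ell^j\in\mathcal L$ from the analyst, who may be randomized and may choose $\ell^j$ depending on all previous losses and answers. Give the query $q^j(\cdot)=\mathrm{err}_\ell(\cdot,\hat D)$ to $\mathcal{SV}$; if $\mathcal{SV}$ has halted, halt. If $\mathcal{SV}$ answers $\bot$, output $\hat\theta^j=\operatorname{argmin}_{\theta\in\Theta}\ell(\theta;\hat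 D)$. If it answers $\top$, draw $\theta\leftarrow\mathcal A'(D,\ell)$ with fresh randomness, output $\hat\theta^j=\theta$, and with $\hat\theta=\operatorname{argmin}_{\theta'\in\Theta}\ell(\theta';\hat D)$ and $u(x)=\langle\theta-\hat\theta,\nabla\ell_x(\hat\theta)\rangle$ replace $\hat D$ by the histogram proportional to $e^{\eta u(x)}\hat D(x)$. The output of the algorithm is the analyst's view, that is, the sequence of the losses and the answers (including whether and when the algorithm halted). **Theorem.** Suppose that $\mathcal A'(\cdot,\ell)$ is $(\varepsilon_0,\delta_0)$-differentially private for every $\ell\in\mathcal L$. Then, for every analyst, the algorithm is $(\varepsilon,\delta)$-differentially private, in both of the following cases. 1. $\mathcal{SV}$ is any online sparse vector algorithm with parameters $(T,k,\varepsilon/2,\delta/2)$ for $(3S/n)$-sensitive queries. This means: against every adversary that adaptively asks $k$ queries $q$ with $|q(D)-q(D')|\le 3S/n$ for all $D\sim D'$, the sequence of its answers is $(\varepsilon/2,\delta/2)$-differentially private, and almost surely it answers at most $T$ queries with $\top$ before it halts. 2. $\mathcal{SV}$ is the textbook sparse vector algorithm. With $\sigma=\frac{3S}{n}\cdot\frac{\sqrt{32\,T\log(2/\delta)}}{\varepsilon/2}$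 it draws a noisy threshold $\tau=\frac34\alpha+\mathrm{Lap}(\sigma)$, answers a query $q$ by $\top$ if $q(D)+\mathrm{Lap}(2\sigma)\ge\tau$ and by $\bot$ otherwise, draws a fresh $\tau$ after each answer $\top$, and halts after $T$ answers $\top$. (All noises are independent; $\mathrm{Lap}(b)$ has density $\frac1{2b}e^{-|z|/b}$, and $\mathrm{Lap}(0)=0$. Square roots of negative numbers and quotients by $0$ are read as $0$; they occur only if $|\mathcal X|=1$ or $\delta\ge1$, where privacy is trivial.) -/

import Mathlib

open MeasureTheory ProbabilityTheory
open scoped ENNReal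

universe u v w

noncomputable section

namespace PMW

/-! ### Datasets and differential privacy -/

/-- Two datasets with `n` rows are adjacent if they differ on at most one row. -/
def Adjacent {X : Type u} {n : ℕ} (D D' : Fin n → X) : Prop :=
  ∃ i, ∀ j, j ≠ i → D j = D' j

/-- A randomized algorithm, given by its output law `M D` on every dataset `D`, is
`(ε, δ)`-differentially private. That `M D` is a probability law is part of the notion. -/
def IsDP {X : Type u} {n : ℕ} {R : Type v} [MeasurableSpace R]
    (M : (Fin n → X) → Measure R) (ε δ : ℝ) : Prop :=
  (∀ D, IsProbabilityMeasure (M D)) ∧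
    ∀ D D', Adjacent D D' → ∀ A : Set R, MeasurableSet A →
      M D A ≤ ENNReal.ofReal (Real.exp ε) * M D' A + ENNReal.ofReal δ

/-- The histogram of a dataset: `hist D x` is the fraction of the rows of `D` equal to `x`. -/
def hist {X : Type u} [DecidableEq X] {n : ℕ} (D : Fin n → X) : X → ℝ :=
  fun x => ((Finset.univ.filter fun i => D i = x).card : ℝ) / n

/-- A real-valued query on datasets changes by at most `Δ` between adjacent datasets. -/
def IsSensitive {X : Type u} {n : ℕ} (Δ : ℝ) (q : (Fin n → X) → ℝ) : Prop :=
  ∀ D D', Adjacent D D' → |q D - q D'| ≤ Δ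

/-! ### Convex minimization queries -/

/-- The loss `ℓ(θ; p) = ∑ x, p(x) ℓ(θ; x)` of the point `θ` on the histogram `p`. -/
def avgLoss {X : Type u} [Fintype X] {d : ℕ} (ℓ : X → EuclideanSpace ℝ (Fin d) → ℝ)
    (p : X → ℝ) (θ : EuclideanSpace ℝ (Fin d)) : ℝ :=
  ∑ x, p x * ℓ x θ

/-- The error of the answer `θ` for the loss `ℓ` with respect to the histogram `p`:
`ℓ(θ; p) - min_{θ' ∈ Θ} ℓ(θ'; p)`. -/
def err {X : Type u} [Fintype X] {d : ℕ} (Θ : Set (EuclideanSpace ℝ (Fin d)))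
    (ℓ : X → EuclideanSpace ℝ (Fin d) → ℝ) (p : X → ℝ) (θ : EuclideanSpace ℝ (Fin d)) : ℝ :=
  avgLoss ℓ p θ - ⨅ θ' : Θ, avgLoss ℓ p θ'

/-- `amin` is a rule which picks, for every loss of the family and every histogram, a point of
`argmin_{θ ∈ Θ} ℓ(θ; p)`. -/
def IsArgmin {X : Type u} [Fintype X] {d : ℕ} {ι : Type v}
    (Θ : Set (EuclideanSpace ℝ (Fin d))) (loss : ι → X → EuclideanSpace ℝ (Fin d) → ℝ)
    (amin : ι → (X → ℝ) → Θ) : Prop :=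
  ∀ i, ∀ p ∈ stdSimplex ℝ X, ∀ θ : Θ,
    avgLoss (loss i) p (amin i p) ≤ avgLoss (loss i) p θ

/-! ### Online threshold ("sparse vector") algorithms and the threshold game -/

/-- A stateful randomized online algorithm which holds a dataset and answers real-valued queries
about it with a bit (`true` for `⊤`, `false` for `⊥`) until it halts. `init D` is the law of the
initial state, `step D s q` the joint law of the answer to the query `q` in state `s` and of the
next state, and `halted` the set of the states in which the algorithm has halted. -/
structure SVAlg (n : ℕ) (X : Type u) where
  State : Type w
  mState : MeasurableSpace State
  init : (Fin n → X) → Measure State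
  halted : Set State
  step : (Fin n → X) → State → ((Fin n → X) → ℝ) → Measure (Bool × State)

attribute [instance] SVAlg.mState

/-- The laws are probability laws that depend measurably on the state and on the query. -/
structure SVAlg.IsValid {n : ℕ} {X : Type u} (SV : SVAlg.{u, w} n X) : Prop where
  init_prob : ∀ D, IsProbabilityMeasure (SV.init D)
  halted_meas : MeasurableSet SV.halted
  step_prob : ∀ D s q, IsProbabilityMeasure (SV.step D s q)
  step_meas : ∀ D, Measurable fun z : SV.State × ((Fin n → X) → ℝ) => SV.step D z.1 z.2

open Classical in
/-- One round: a halted algorithm returns `Sum.inr ()` ("halted") and keeps its state, any other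
one returns `Sum.inl a` for the bit `a`. -/
def SVAlg.round {n : ℕ} {X : Type u} (SV : SVAlg.{u, w} n X) (D : Fin n → X) (s : SV.State)
    (q : (Fin n → X) → ℝ) : Measure ((Bool ⊕ Unit) × SV.State) :=
  if s ∈ SV.halted then Measure.dirac (Sum.inr (), s)
  else (SV.step D s q).map fun z => (Sum.inl z.1, z.2)

/-- The threshold game against an adversary `B`, whose `j`-th query may depend on the earlier
answers (hence also on its own earlier queries): the joint law of the first `j` answers and of the
state after them. -/
def SVAlg.game {n : ℕ} {X : Type u} (SV : SVAlg.{u, w} n X)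
    (B : (j : ℕ) → (Fin j → Bool ⊕ Unit) → (Fin n → X) → ℝ) (D : Fin n → X) :
    (j : ℕ) → Measure ((Fin j → Bool ⊕ Unit) × SV.State)
  | 0 => (SV.init D).map fun s => (Fin.elim0, s)
  | j + 1 => (SV.game B D j).bind fun ω =>
      (SV.round D ω.2 (B j ω.1)).map fun z =>
        (Fin.snoc (α := fun _ => Bool ⊕ Unit) ω.1 z.1, z.2)

/-- `(ε, δ)`-differential privacy of the `k` answers, for every adversary that asks `Δ`-sensitive
queries. -/
def SVAlg.IsPrivate {n : ℕ} {X : Type u} (SV : SVAlg.{u, w} n X) (k : ℕ) (Δ ε δ : ℝ) : Prop :=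
  ∀ B : (j : ℕ) → (Fin j → Bool ⊕ Unit) → (Fin n → X) → ℝ,
    (∀ j h, IsSensitive Δ (B j h)) →
      IsDP (fun D => (SV.game B D k).map Prod.fst) ε δ

/-- Among `k` answers, almost surely at most `T` are `⊤`: the algorithm halts once `T` queries
were answered with `⊤`. -/
def SVAlg.HaltsAfter {n : ℕ} {X : Type u} (SV : SVAlg.{u, w} n X) (k : ℕ) (Δ : ℝ) (T : ℕ) :
    Prop :=
  ∀ B : (j : ℕ) → (Fin j → Bool ⊕ Unit) → (Fin n → X) → ℝ,
    (∀ j h, IsSensitive Δ (B j h)) →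
      ∀ D, ∀ᵐ a ∂((SV.game B D k).map Prod.fst),
        (Finset.univ.filter fun j => a j = Sum.inl true).card ≤ T

/-- The centred Laplace law with scale `b`; the point mass at `0` if `b ≤ 0`. -/
def laplace (b : ℝ) : Measure ℝ :=
  if 0 < b then volume.withDensity fun z => ENNReal.ofReal (Real.exp (-|z| / b) / (2 * b))
  else Measure.dirac 0

/-- The noise scale `σ = Δ √(32 T log(1/δ)) / ε` of the sparse vector algorithm. -/
def noiseScale (T : ℕ) (Δ ε δ : ℝ) : ℝ := Δ * √(32 * T * Real.log (1 / δ)) / ε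

/-- The textbook sparse vector algorithm for `Δ`-sensitive queries with cutoff `T`, threshold
`3α/4` and privacy parameters `ε, δ`. The state is the number of `⊤` answers so far together with
the current noisy threshold `3α/4 + Lap(σ)`; the query `q` is answered with `⊤` iff
`q(D) + Lap(2σ)` reaches the noisy threshold, which is then drawn afresh; the algorithm halts after
`T` answers `⊤`. -/
abbrev sparseVector (n : ℕ) (X : Type u) (T : ℕ) (Δ α ε δ : ℝ) : SVAlg.{u, 0} n X where
  State := ℕ × ℝ
  mState := inferInstance
  init := fun _ => (laplace (noiseScale T Δ ε δ)).map fun z => (0, 3 * α / 4 + z)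
  halted := {s | T ≤ s.1}
  step := fun D s q => (laplace (2 * noiseScale T Δ ε δ)).bind fun y =>
    if s.2 ≤ q D + y then
      (laplace (noiseScale T Δ ε δ)).map fun z => (true, (s.1 + 1, 3 * α / 4 + z))
    else Measure.dirac (false, s)

/-! ### Online private multiplicative weights for convex minimization queries -/

/-- The bound `T = 64 S² log |X| / α²` on the number of updates, rounded up to an integer. -/
def numUpdates (X : Type u) [Fintype X] (S α : ℝ) : ℕ :=
  ⌈64 * S ^ 2 * Real.log (Fintype.card X) / α ^ 2⌉₊

/-- The learning rate `η = √(log |X| / T)`. -/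
def learningRate (X : Type u) [Fintype X] (T : ℕ) : ℝ :=
  √(Real.log (Fintype.card X) / T)

/-- `ε₀ = ε / √(8 T log(4/δ))`. -/
def oracleEps (T : ℕ) (ε δ : ℝ) : ℝ := ε / √(8 * T * Real.log (4 / δ))

/-- `δ₀ = δ / (4T)`. -/
def oracleDelta (T : ℕ) (δ : ℝ) : ℝ := δ / (4 * T)

/-- The update direction `u(x) = ⟨θ - θ̂, ∇ℓ_x(θ̂)⟩`; the gradient is taken within `Θ`. -/
def updateDir {X : Type u} {d : ℕ} (Θ : Set (EuclideanSpace ℝ (Fin d)))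
    (ℓ : X → EuclideanSpace ℝ (Fin d) → ℝ) (θ θhat : EuclideanSpace ℝ (Fin d)) : X → ℝ :=
  fun x => inner ℝ (θ - θhat) (gradientWithin (ℓ x) Θ θhat)

/-- The multiplicative weights update `p'(x) ∝ exp(η u(x)) p(x)`. -/
def mwUpdate {X : Type u} [Fintype X] (η : ℝ) (u p : X → ℝ) : X → ℝ :=
  fun x => Real.exp (η * u x) * p x / ∑ y, Real.exp (η * u y) * p y

/-- One round of the online algorithm on the dataset `D`: the loss `i` is received while the
threshold algorithm is in state `s` and the current histogram is `p`. The result is the joint law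
of the answer (`Sum.inr ()` if the algorithm has halted), the new state and the new histogram. -/
def round {X : Type u} [Fintype X] [DecidableEq X] {n d : ℕ} {ι : Type v} [MeasurableSpace ι]
    (Θ : Set (EuclideanSpace ℝ (Fin d))) (loss : ι → X → EuclideanSpace ℝ (Fin d) → ℝ)
    (amin : ι → (X → ℝ) → Θ) (oracle : (Fin n → X) → Kernel ι Θ) (SV : SVAlg.{u, w} n X) (η : ℝ)
    (D : Fin n → X) (i : ι) (s : SV.State) (p : X → ℝ) :
    Measure ((Θ ⊕ Unit) × SV.State × (X → ℝ)) :=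
  (SV.round D s fun D' => err Θ (loss i) (hist D') (amin i p)).bind fun z =>
    match z.1 with
    | Sum.inr _ => Measure.dirac (Sum.inr (), z.2, p)
    | Sum.inl false => Measure.dirac (Sum.inl (amin i p), z.2, p)
    | Sum.inl true => (oracle D i).map fun θ =>
        (Sum.inl θ, z.2, mwUpdate η (updateDir Θ (loss i) θ (amin i p)) p)

/-- The interaction of the online algorithm on the dataset `D` with a randomized analyst, who draws
the next loss from a law that depends on the earlier losses and answers: the joint law of the first
`j` pairs (loss, answer), of the state of the threshold algorithm and of the current histogram,
which starts out uniform. -/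
def run {X : Type u} [Fintype X] [DecidableEq X] {n d : ℕ} {ι : Type v} [MeasurableSpace ι]
    (Θ : Set (EuclideanSpace ℝ (Fin d))) (loss : ι → X → EuclideanSpace ℝ (Fin d) → ℝ)
    (amin : ι → (X → ℝ) → Θ) (oracle : (Fin n → X) → Kernel ι Θ) (SV : SVAlg.{u, w} n X) (η : ℝ)
    (analyst : (j : ℕ) → Kernel (Fin j → ι × (Θ ⊕ Unit)) ι) (D : Fin n → X) :
    (j : ℕ) → Measure ((Fin j → ι × (Θ ⊕ Unit)) × SV.State × (X → ℝ))
  | 0 => (SV.init D).map fun s => (Fin.elim0, s, fun _ => 1 / (Fintype.card X : ℝ))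
  | j + 1 => (run Θ loss amin oracle SV η analyst D j).bind fun ω =>
      (analyst j ω.1).bind fun i =>
        (round Θ loss amin oracle SV η D i ω.2.1 ω.2.2).map fun z =>
          (Fin.snoc (α := fun _ => ι × (Θ ⊕ Unit)) ω.1 (i, z.1), z.2)

/-- The law of the analyst's view (all losses and answers) after `k` rounds of the online private
multiplicative weights algorithm. -/
def onlinePMW {X : Type u} [Fintype X] [DecidableEq X] {n d : ℕ} {ι : Type v} [MeasurableSpace ι]
    (Θ : Set (EuclideanSpace ℝ (Fin d))) (loss : ι → X → EuclideanSpace ℝ (Fin d) → ℝ)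
    (amin : ι → (X → ℝ) → Θ) (oracle : (Fin n → X) → Kernel ι Θ) (SV : SVAlg.{u, w} n X) (η : ℝ)
    (analyst : (j : ℕ) → Kernel (Fin j → ι × (Θ ⊕ Unit)) ι) (k : ℕ) (D : Fin n → X) :
    Measure (Fin k → ι × (Θ ⊕ Unit)) :=
  (run Θ loss amin oracle SV η analyst D k).map Prod.fst

end PMW

end

noncomputable section

namespace PMW

/-! ### Measurability of parametrized laws -/

/-! Fix adjacent datasets `D`, `D'`. The online algorithm and the analyst together act as a
randomized adversary of the threshold algorithm, except that their memory is updated by oracle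
calls, which read the dataset too. `Adversary.law` therefore has two separate inputs: the dataset of
the threshold algorithm and, through `pmwPost`, that of the oracle. The proof is a hybrid argument
that exchanges `D` for `D'` first in the threshold algorithm and then in the oracle.

First exchange. The privacy of the threshold algorithm speaks only of deterministic adversaries and
of the answers. `SVAlg.potential` is the best value of `∑ (P - c P')⁺` over all deterministic
continuations. It dominates every randomized adversary (`Adversary.lintegral_law_le`), since
averaging over random choices cannot beat a supremum. Initially it is at most `δ`
(`SVAlg.IsValid.sum_potential_le`), since finitely many suprema, one per answer string, merge into
the supremum over one strategy. No measurable selection is needed.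

Second exchange. At most `T` rounds call the oracle, so this is advanced composition. It is carried
out on test functions: a bound `f ≤ c + k g^β` with `β = 1 - 1/α` is pulled back through the rounds.
Steps that do not depend on the dataset preserve it by Jensen. An oracle call costs `δ₀` and a
factor `stepFactor α ε₀` (`lintegral_le_of_indist`): two indistinguishable laws are, up to mass
`δ₀`, mixtures of the two outcomes of randomized response (`exists_decomposition`), for which Hölder
and `cosh x ≤ exp (x² / 2)` give the factor. After `T` calls, weighted AM-GM turns the power bound
into an `(ε/2)`-bound with a small additive tail (`stepFactor_pow_mul_rpow_le`). The error `T δ₀ +`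
tail gets multiplied by the `e^(ε/2)` of the first exchange and still fits into `δ/2`
(`oracle_failure_le`).

For the textbook sparse vector algorithm the same power bound composes epochs, the stretches between
two answers `⊤`. In an epoch the noisy threshold is shifted by `Δ`: answers `⊥` are then free, and
the shift and the final `⊤` cost `e^(Δ/σ)` each, whatever the length of the epoch. So `T` epochs
compose as `T` steps with parameter `2Δ/σ` (`lintegral_game_sparseVector_le`). -/

theorem measurable_bind_param {α β γ : Type*} [MeasurableSpace α] [MeasurableSpace β]
    [MeasurableSpace γ] {κ : α → Measure β} (hκ : Measurable κ)
    [∀ x, IsProbabilityMeasure (κ x)] {F : α → β → Measure γ}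
    (hF : Measurable (Function.uncurry F)) : Measurable fun x => (κ x).bind (F x) := by
  let k : Kernel α β := ⟨κ, hκ⟩
  have : IsMarkovKernel k := ⟨fun x => inferInstanceAs (IsProbabilityMeasure (κ x))⟩
  refine Measure.measurable_of_measurable_coe _ fun s hs => ?_
  have h : (fun x => (κ x).bind (F x) s) = fun x => ∫⁻ y, F x y s ∂(k x) := by
    funext x
    exact Measure.bind_apply hs (hF.comp measurable_prodMk_left).aemeasurable
  rw [h]
  exact Measurable.lintegral_kernel_prod_right (κ := k) (f := fun x y => F x y s)
    ((Measure.measurable_coe hs).comp hF)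

theorem measurable_map_param {α β γ : Type*} [MeasurableSpace α] [MeasurableSpace β]
    [MeasurableSpace γ] {κ : α → Measure β} (hκ : Measurable κ)
    [∀ x, IsProbabilityMeasure (κ x)] {F : α → β → γ}
    (hF : Measurable (Function.uncurry F)) : Measurable fun x => (κ x).map (F x) := by
  have h : (fun x => (κ x).map (F x)) = fun x => (κ x).bind fun y => Measure.dirac (F x y) := by
    funext x
    exact (Measure.bind_dirac_eq_map _ (hF.comp measurable_prodMk_left)).symm
  rw [h]
  exact measurable_bind_param hκ (F := fun x y => Measure.dirac (F x y))
    (Measure.measurable_dirac.comp hF)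

theorem isProbabilityMeasure_bind' {α β : Type*} [MeasurableSpace α] [MeasurableSpace β]
    {μ : Measure α} [IsProbabilityMeasure μ] {F : α → Measure β} (hF : Measurable F)
    (h : ∀ x, IsProbabilityMeasure (F x)) : IsProbabilityMeasure (μ.bind F) := by
  constructor
  rw [Measure.bind_apply MeasurableSet.univ hF.aemeasurable]
  simp

theorem lintegral_le_one {α : Type*} [MeasurableSpace α] {μ : Measure α} [IsProbabilityMeasure μ]
    {f : α → ℝ≥0∞} (hf : ∀ x, f x ≤ 1) : ∫⁻ x, f x ∂μ ≤ 1 :=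
  (lintegral_mono hf).trans (by simp)

/-! ### Hölder's inequality for indistinguishable laws -/

theorem lintegral_rpow_le {Ω : Type*} [MeasurableSpace Ω] (μ : Measure Ω) {g : Ω → ℝ≥0∞}
    (hg : Measurable g) {β : ℝ} (h0 : 0 < β) (h1 : β < 1) :
    ∫⁻ x, g x ^ β ∂μ ≤ (∫⁻ x, g x ∂μ) ^ β * μ Set.univ ^ (1 - β) := by
  have hc : (1 / β).HolderConjugate (1 / (1 - β)) := by
    rw [Real.holderConjugate_iff]
    constructor
    · rw [lt_div_iff₀ h0]; linarith
    · simp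
  have h := ENNReal.lintegral_mul_le_Lp_mul_Lq μ hc (hg.pow_const β).aemeasurable
    (aemeasurable_const (b := (1 : ℝ≥0∞)))
  simp only [Pi.mul_apply, mul_one, one_div, inv_inv, ENNReal.one_rpow, lintegral_const,
    one_mul] at h
  refine h.trans_eq ?_
  congr 2
  refine lintegral_congr fun x => ?_
  rw [← ENNReal.rpow_mul, mul_inv_cancel₀ h0.ne', ENNReal.rpow_one]

theorem lintegral_rpow_le_rpow {Ω : Type*} [MeasurableSpace Ω] (μ : Measure Ω)
    [IsProbabilityMeasure μ] {g : Ω → ℝ≥0∞}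
    (hg : Measurable g) {β : ℝ} (h0 : 0 < β) (h1 : β < 1) :
    ∫⁻ x, g x ^ β ∂μ ≤ (∫⁻ x, g x ∂μ) ^ β := by
  simpa using lintegral_rpow_le μ hg h0 h1

/-- Hölder for two summands. It recombines the two halves of the randomized response after Hölder
was applied to each. -/
theorem add_rpow_mul_le (x₁ x₂ y₁ y₂ : ℝ≥0∞) {β : ℝ} (h0 : 0 < β) (h1 : β < 1) :
    x₁ ^ (1 - β) * y₁ ^ β + x₂ ^ (1 - β) * y₂ ^ β ≤ (x₁ + x₂) ^ (1 - β) * (y₁ + y₂) ^ β := by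
  have hc : (1 / (1 - β)).HolderConjugate (1 / β) := by
    rw [Real.holderConjugate_iff]
    constructor
    · rw [lt_div_iff₀ (by linarith)]; linarith
    · simp
  have h := ENNReal.inner_le_Lp_mul_Lq Finset.univ ![x₁ ^ (1 - β), x₂ ^ (1 - β)]
    ![y₁ ^ β, y₂ ^ β] hc
  have hb : (1 - β) ≠ 0 := by linarith
  simpa [Fin.sum_univ_two, ← ENNReal.rpow_mul, mul_inv_cancel₀ h0.ne', mul_inv_cancel₀ hb] using h

/-- The left side is symmetric under `α ↦ 1 - α`, so centring at `1/2` produces a `cosh`. Up to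
normalization it is the moment of order `α` of the likelihood ratio of randomized response. -/
theorem exp_add_exp_le {ε α : ℝ} :
    Real.exp (α * ε) + Real.exp ((1 - α) * ε) ≤
      (1 + Real.exp ε) * Real.exp ((α - 1 / 2) ^ 2 * ε ^ 2 / 2) := by
  have h1 : Real.exp (α * ε) + Real.exp ((1 - α) * ε) =
      Real.exp (ε / 2) * (2 * Real.cosh ((α - 1 / 2) * ε)) := by
    rw [Real.cosh_eq, mul_div_cancel₀ _ two_ne_zero, mul_add, ← Real.exp_add, ← Real.exp_add]
    congr 2 <;> ring
  have h2 : 2 * Real.exp (ε / 2) ≤ 1 + Real.exp ε := by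
    have : Real.exp ε = Real.exp (ε / 2) ^ 2 := by rw [← Real.exp_nat_mul]; congr 1; push_cast; ring
    nlinarith [sq_nonneg (Real.exp (ε / 2) - 1)]
  have h3 := Real.cosh_le_exp_half_sq ((α - 1 / 2) * ε)
  rw [mul_pow] at h3
  rw [h1]
  calc _ = (2 * Real.exp (ε / 2)) * Real.cosh ((α - 1 / 2) * ε) := by ring
    _ ≤ _ := mul_le_mul h2 h3 (Real.cosh_pos _).le (by positivity)

/-- The positive part of `Q - c P` has mass at most `δ`. -/
theorem lintegral_sub_min_le {Ω : Type*} [MeasurableSpace Ω] {μ : Measure Ω} {p q : Ω → ℝ}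
    (hp : Measurable p) (hq : Measurable q) (hp0 : ∀ x, 0 ≤ p x) {c : ℝ} (hc : 0 ≤ c) {δ : ℝ≥0∞}
    (hfin : ∫⁻ x, ENNReal.ofReal (p x) ∂μ ≠ ∞)
    (h : ∀ A, MeasurableSet A → ∫⁻ x in A, ENNReal.ofReal (q x) ∂μ ≤
      ENNReal.ofReal c * ∫⁻ x in A, ENNReal.ofReal (p x) ∂μ + δ) :
    ∫⁻ x, ENNReal.ofReal (q x - min (q x) (c * p x)) ∂μ ≤ δ := by
  -- The set on which the excess of `q` over `c p` is positive: testing the hypothesis there is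
  -- optimal.
  set A : Set Ω := {x | c * p x < q x} with hA
  have hAm : MeasurableSet A := measurableSet_lt (hp.const_mul c) hq
  have e1 : ∫⁻ x, ENNReal.ofReal (q x - min (q x) (c * p x)) ∂μ =
      ∫⁻ x in A, ENNReal.ofReal (q x - c * p x) ∂μ := by
    rw [← lintegral_indicator hAm]
    refine lintegral_congr fun x => ?_
    by_cases hx : x ∈ A
    · rw [Set.indicator_of_mem hx, min_eq_right (le_of_lt hx)]
    · rw [Set.indicator_of_notMem hx, min_eq_left (not_lt.1 hx)]; simp
  have e2 : ∫⁻ x in A, ENNReal.ofReal (q x) ∂μ = ∫⁻ x in A, ENNReal.ofReal (q x - c * p x) ∂μ +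
      ENNReal.ofReal c * ∫⁻ x in A, ENNReal.ofReal (p x) ∂μ := by
    rw [← lintegral_const_mul _ hp.ennreal_ofReal, ← lintegral_add_left
      (by fun_prop : Measurable fun x => ENNReal.ofReal (q x - c * p x))]
    refine setLIntegral_congr_fun hAm fun x hx => ?_
    have hx' : c * p x < q x := hx
    rw [← ENNReal.ofReal_mul hc, ← ENNReal.ofReal_add (by linarith)
      (mul_nonneg hc (hp0 x))]
    congr 1; ring
  have hne : ENNReal.ofReal c * ∫⁻ x in A, ENNReal.ofReal (p x) ∂μ ≠ ∞ :=
    ENNReal.mul_ne_top ENNReal.ofReal_ne_top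
      (ne_top_of_le_ne_top hfin (setLIntegral_le_lintegral _ _))
  have h' := h A hAm
  rw [e2, add_comm] at h'
  rw [e1]
  exact (ENNReal.add_le_add_iff_left hne).1 h'

/-- Truncating each density at `c` times the other gives `p'`, `q'` with pointwise ratios in `[1/c,
c]`. If their masses differ, the heavier one, `p'`, is thinned towards `q' / c`, which keeps the
ratios. A pair with such ratios is a nonnegative combination of `(c, 1)` and `(1, c)`, and equal
masses of the pair force equal masses of the two coefficients. -/
theorem exists_decomposition_of_densities {Ω : Type*} [MeasurableSpace Ω] {μ : Measure Ω}
    {p q : Ω → ℝ} (hp : Measurable p) (hq : Measurable q) (hp0 : ∀ x, 0 ≤ p x)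
    (hq0 : ∀ x, 0 ≤ q x) (hpi : Integrable p μ) (hqi : Integrable q μ)
    (hp1 : ∫ x, p x ∂μ = 1) (hq1 : ∫ x, q x ∂μ = 1) {c : ℝ} (hc : 1 < c) {δ : ℝ≥0∞}
    (hle : ∫ x, min (q x) (c * p x) ∂μ ≤ ∫ x, min (p x) (c * q x) ∂μ)
    (h : ∫⁻ x, ENNReal.ofReal (q x - min (q x) (c * p x)) ∂μ ≤ δ) :
    ∃ a b r s : Ω → ℝ, (Measurable a ∧ Measurable b ∧ Measurable r ∧ Measurable s) ∧
      (∀ x, 0 ≤ a x ∧ 0 ≤ b x ∧ 0 ≤ r x ∧ 0 ≤ s x) ∧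
      (∀ x, p x = c * a x + b x + r x) ∧ (∀ x, q x = a x + c * b x + s x) ∧
      ∫⁻ x, ENNReal.ofReal (a x) ∂μ = ∫⁻ x, ENNReal.ofReal (b x) ∂μ ∧
      ∫⁻ x, ENNReal.ofReal (r x) ∂μ ≤ δ ∧ ∫⁻ x, ENNReal.ofReal (s x) ∂μ ≤ δ := by
  set p' : Ω → ℝ := fun x => min (p x) (c * q x) with hp'
  set q' : Ω → ℝ := fun x => min (q x) (c * p x) with hq'
  have c0 : 0 < c := by linarith
  have mp' : Measurable p' := hp.min (hq.const_mul c)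
  have mq' : Measurable q' := hq.min (hp.const_mul c)
  have ip' : Integrable p' μ := hpi.inf (hqi.const_mul c)
  have iq' : Integrable q' μ := hqi.inf (hpi.const_mul c)
  have hp'0 : ∀ x, 0 ≤ p' x := fun x => le_min (hp0 x) (mul_nonneg c0.le (hq0 x))
  have hq'0 : ∀ x, 0 ≤ q' x := fun x => le_min (hq0 x) (mul_nonneg c0.le (hp0 x))
  have hpq : ∀ x, p' x ≤ c * q' x := fun x => by
    simp only [hp', hq']
    rcases le_total (q x) (c * p x) with h1 | h1
    · rw [min_eq_left h1]; exact min_le_right _ _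
    · rw [min_eq_right h1]
      refine (min_le_left _ _).trans ?_
      nlinarith [hp0 x, mul_nonneg c0.le (hp0 x)]
  have hqp : ∀ x, q' x ≤ c * p' x := fun x => by
    simp only [hp', hq']
    rcases le_total (p x) (c * q x) with h1 | h1
    · rw [min_eq_left h1]; exact min_le_right _ _
    · rw [min_eq_right h1]
      refine (min_le_left _ _).trans ?_
      nlinarith [hq0 x, mul_nonneg c0.le (hq0 x)]
  set A := ∫ x, p' x ∂μ with hA
  set B := ∫ x, q' x ∂μ with hB
  have hB0 : 0 ≤ B := integral_nonneg hq'0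
  -- The thinning parameter exists since `B / c ≤ B ≤ A`; if the outer terms agree, nothing has to
  -- be thinned.
  obtain ⟨t, t0, t1, ht⟩ : ∃ t : ℝ, 0 ≤ t ∧ t ≤ 1 ∧ (1 - t) * A + t * (B / c) = B := by
    have hBc : B / c ≤ B := div_le_self hB0 hc.le
    rcases eq_or_lt_of_le (hBc.trans hle) with he | hlt
    · exact ⟨0, le_rfl, zero_le_one, by linarith⟩
    · refine ⟨(A - B) / (A - B / c), div_nonneg (by linarith) (by linarith),
        (div_le_one (by linarith)).2 (by linarith), ?_⟩
      have : A - B / c ≠ 0 := by linarith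
      have h2 : (A - B) / (A - B / c) * (A - B / c) = A - B := div_mul_cancel₀ _ this
      linarith
  set p'' : Ω → ℝ := fun x => (1 - t) * p' x + t * (q' x / c) with hp''
  have mp'' : Measurable p'' := (mp'.const_mul _).add ((mq'.div_const _).const_mul _)
  have ip'' : Integrable p'' μ := (ip'.const_mul _).add ((iq'.div_const _).const_mul _)
  have Ip'' : ∫ x, p'' x ∂μ = B := by
    rw [integral_add (ip'.const_mul _) ((iq'.div_const _).const_mul _), integral_const_mul,
      integral_const_mul, integral_div]
    exact ht
  have hd : 0 < c ^ 2 - 1 := by nlinarith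
  have hqc : ∀ x, q' x / c ≤ p' x := fun x => by
    rw [div_le_iff₀ c0]; linarith [hqp x]
  have g1 : ∀ x, p'' x ≤ p' x := fun x => by
    simp only [hp'']; nlinarith [hqc x]
  have g2 : ∀ x, q' x / c ≤ p'' x := fun x => by
    simp only [hp'']; nlinarith [hqc x]
  have g3 : ∀ x, q' x ≤ c * p'' x := fun x => by
    have := g2 x
    rw [div_le_iff₀ c0] at this; linarith
  have ia : Integrable (fun x => (c * p'' x - q' x) / (c ^ 2 - 1)) μ :=
    ((ip''.const_mul c).sub iq').div_const _
  have ib : Integrable (fun x => (c * q' x - p'' x) / (c ^ 2 - 1)) μ :=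
    ((iq'.const_mul c).sub ip'').div_const _
  have na : ∀ x, 0 ≤ (c * p'' x - q' x) / (c ^ 2 - 1) := fun x =>
    div_nonneg (by linarith [g3 x]) hd.le
  have nb : ∀ x, 0 ≤ (c * q' x - p'' x) / (c ^ 2 - 1) := fun x =>
    div_nonneg (by linarith [g1 x, hpq x]) hd.le
  -- The first two functions solve `c a + b = p''`, `a + c b = q'`.
  refine ⟨fun x => (c * p'' x - q' x) / (c ^ 2 - 1), fun x => (c * q' x - p'' x) / (c ^ 2 - 1),
    fun x => p x - p'' x, fun x => q x - q' x,
    ⟨((mp''.const_mul c).sub mq').div_const _, ((mq'.const_mul c).sub mp'').div_const _,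
      hp.sub mp'', hq.sub mq'⟩, fun x => ⟨na x, nb x, ?_, ?_⟩, fun x => ?_, fun x => ?_,
      ?_, ?_, h⟩
  · have : p' x ≤ p x := min_le_left _ _
    linarith [g1 x]
  · have : q' x ≤ q x := min_le_left _ _
    linarith
  · field_simp; ring
  · field_simp; ring
  · rw [← ofReal_integral_eq_lintegral_ofReal ia (.of_forall na),
      ← ofReal_integral_eq_lintegral_ofReal ib (.of_forall nb)]
    congr 1
    rw [integral_div, integral_div, integral_sub (ip''.const_mul c) iq',
      integral_sub (iq'.const_mul c) ip'', integral_const_mul, integral_const_mul, Ip'']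
  -- Both `p''` and `q'` have mass `B`, so `p` loses exactly as much mass as `q`, and the bound for
  -- `q` serves for both.
  · refine le_trans (le_of_eq ?_) h
    have np : ∀ x, 0 ≤ p x - p'' x := fun x => by
      have : p' x ≤ p x := min_le_left _ _
      linarith [g1 x]
    have nq : ∀ x, 0 ≤ q x - q' x := fun x => by
      have : q' x ≤ q x := min_le_left _ _
      linarith
    have l1 := ofReal_integral_eq_lintegral_ofReal (hpi.sub ip'') (.of_forall np)
    have l2 := ofReal_integral_eq_lintegral_ofReal (hqi.sub iq') (.of_forall nq)
    refine l1.symm.trans (Eq.trans ?_ l2)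
    congr 1
    rw [integral_sub' hpi ip'', integral_sub' hqi iq', hp1, hq1, Ip'']

theorem exists_density {Ω : Type*} [MeasurableSpace Ω] {P μ : Measure Ω} [IsProbabilityMeasure P]
    [IsFiniteMeasure μ] (h : P ≪ μ) :
    ∃ p : Ω → ℝ, Measurable p ∧ (∀ x, 0 ≤ p x) ∧ Integrable p μ ∧ ∫ x, p x ∂μ = 1 ∧
      P = μ.withDensity fun x => ENNReal.ofReal (p x) := by
  have hP : P = μ.withDensity fun x => ENNReal.ofReal (P.rnDeriv μ x).toReal := by
    conv_lhs => rw [← Measure.withDensity_rnDeriv_eq P μ h]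
    refine withDensity_congr_ae ?_
    filter_upwards [Measure.rnDeriv_lt_top P μ] with x hx
    rw [ENNReal.ofReal_toReal hx.ne]
  refine ⟨fun x => (P.rnDeriv μ x).toReal, (Measure.measurable_rnDeriv P μ).ennreal_toReal,
    fun x => ENNReal.toReal_nonneg, Measure.integrable_toReal_rnDeriv, ?_, hP⟩
  rw [Measure.integral_toReal_rnDeriv h]
  simp

/-- Indistinguishable laws are, up to mass `δ`, obtained from randomized response. -/
theorem exists_decomposition {Ω : Type*} [MeasurableSpace Ω] {P Q : Measure Ω}
    [IsProbabilityMeasure P] [IsProbabilityMeasure Q] {c : ℝ} (hc : 1 < c) {δ : ℝ≥0∞}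
    (hPQ : ∀ A, MeasurableSet A → P A ≤ ENNReal.ofReal c * Q A + δ)
    (hQP : ∀ A, MeasurableSet A → Q A ≤ ENNReal.ofReal c * P A + δ) :
    ∃ U W B B' : Measure Ω, U Set.univ = W Set.univ ∧
      P = ENNReal.ofReal c • U + W + B ∧ Q = U + ENNReal.ofReal c • W + B' ∧
      B Set.univ ≤ δ ∧ B' Set.univ ≤ δ := by
  have hP : P ≪ P + Q := Measure.absolutelyContinuous_of_le (Measure.le_add_right le_rfl)
  have hQ : Q ≪ P + Q := Measure.absolutelyContinuous_of_le (Measure.le_add_left le_rfl)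
  obtain ⟨p, mp, p0, ip, p1, eP⟩ := exists_density hP
  obtain ⟨q, mq, q0, iq, q1, eQ⟩ := exists_density hQ
  generalize P + Q = μ at *
  have fin : ∀ {f : Ω → ℝ}, Integrable f μ → (∀ x, 0 ≤ f x) →
      ∫⁻ x, ENNReal.ofReal (f x) ∂μ ≠ ∞ := fun hf h0 => by
    rw [← ofReal_integral_eq_lintegral_ofReal hf (.of_forall h0)]
    exact ENNReal.ofReal_ne_top
  have k1 := lintegral_sub_min_le (δ := δ) mp mq p0 (by linarith : 0 ≤ c) (fin ip p0) fun A hA => by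
    have := hQP A hA
    rwa [eP, eQ, withDensity_apply _ hA, withDensity_apply _ hA] at this
  have k2 := lintegral_sub_min_le (δ := δ) mq mp q0 (by linarith : 0 ≤ c) (fin iq q0) fun A hA => by
    have := hPQ A hA
    rwa [eP, eQ, withDensity_apply _ hA, withDensity_apply _ hA] at this
  have key : ∃ a b r s : Ω → ℝ, (Measurable a ∧ Measurable b ∧ Measurable r ∧ Measurable s) ∧
      (∀ x, 0 ≤ a x ∧ 0 ≤ b x ∧ 0 ≤ r x ∧ 0 ≤ s x) ∧
      (∀ x, p x = c * a x + b x + r x) ∧ (∀ x, q x = a x + c * b x + s x) ∧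
      ∫⁻ x, ENNReal.ofReal (a x) ∂μ = ∫⁻ x, ENNReal.ofReal (b x) ∂μ ∧
      ∫⁻ x, ENNReal.ofReal (r x) ∂μ ≤ δ ∧ ∫⁻ x, ENNReal.ofReal (s x) ∂μ ≤ δ := by
    -- The decomposition is symmetric under exchanging `p` with `q` and `a` with `b`, so the heavier
    -- truncated density may play the role of `p`.
    rcases le_total (∫ x, min (q x) (c * p x) ∂μ) (∫ x, min (p x) (c * q x) ∂μ) with hle | hle
    · exact exists_decomposition_of_densities mp mq p0 q0 ip iq p1 q1 hc hle k1
    · obtain ⟨a, b, r, s, ⟨ma, mb, mr, ms⟩, h0, h1, h2, h3, h4, h5⟩ :=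
        exists_decomposition_of_densities mq mp q0 p0 iq ip q1 p1 hc hle k2
      exact ⟨b, a, s, r, ⟨mb, ma, ms, mr⟩,
        fun x => ⟨(h0 x).2.1, (h0 x).1, (h0 x).2.2.2, (h0 x).2.2.1⟩,
        fun x => by rw [h2 x]; ring, fun x => by rw [h1 x]; ring, h3.symm, h5, h4⟩
  obtain ⟨a, b, r, s, ⟨ma, mb, mr, ms⟩, h0, h1, h2, h3, h4, h5⟩ := key
  have cc : 0 ≤ c := by linarith
  refine ⟨μ.withDensity fun x => ENNReal.ofReal (a x), μ.withDensity fun x => ENNReal.ofReal (b x),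
    μ.withDensity fun x => ENNReal.ofReal (r x), μ.withDensity fun x => ENNReal.ofReal (s x),
    by simpa using h3, ?_, ?_, by simpa using h4, by simpa using h5⟩
  · rw [eP, ← withDensity_smul _ ma.ennreal_ofReal,
      ← withDensity_add_right _ mb.ennreal_ofReal, ← withDensity_add_right _ mr.ennreal_ofReal]
    congr 1; funext x
    obtain ⟨n1, n2, n3, n4⟩ := h0 x
    simp only [Pi.add_apply, Pi.smul_apply, smul_eq_mul]
    rw [h1 x, ENNReal.ofReal_add (by positivity) n3, ENNReal.ofReal_add (by positivity) n2,
      ENNReal.ofReal_mul cc]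
  · rw [eQ, ← withDensity_smul _ mb.ennreal_ofReal,
      ← withDensity_add_left ma.ennreal_ofReal, ← withDensity_add_right _ ms.ennreal_ofReal]
    congr 1; funext x
    obtain ⟨n1, n2, n3, n4⟩ := h0 x
    simp only [Pi.add_apply, Pi.smul_apply, smul_eq_mul]
    rw [h2 x, ENNReal.ofReal_add (by positivity) n4, ENNReal.ofReal_add n1 (by positivity),
      ENNReal.ofReal_mul cc]

/-- The growth factor of `q ↦ q ^ β` under one `ε`-indistinguishable step, `α = 1 / (1 - β)`. -/
def stepFactor (α ε : ℝ) : ℝ := Real.exp ((α - 1 / 2) ^ 2 * ε ^ 2 / 2 / α)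

/-- One step of adaptive composition in terms of test functions. -/
theorem lintegral_le_of_indist {Ω : Type*} [MeasurableSpace Ω] {P Q : Measure Ω}
    [IsProbabilityMeasure P] [IsProbabilityMeasure Q] {ε : ℝ} (hε : 0 < ε) {δ : ℝ≥0∞}
    (hPQ : ∀ A, MeasurableSet A → P A ≤ ENNReal.ofReal (Real.exp ε) * Q A + δ)
    (hQP : ∀ A, MeasurableSet A → Q A ≤ ENNReal.ofReal (Real.exp ε) * P A + δ)
    {α : ℝ} (hα : 1 < α) {f g : Ω → ℝ≥0∞} (hf : ∀ x, f x ≤ 1) (hg : Measurable g)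
    {c k : ℝ≥0∞} (h : ∀ x, f x ≤ c + k * g x ^ (1 - 1 / α)) :
    ∫⁻ x, f x ∂P ≤
      δ + c + k * (ENNReal.ofReal (stepFactor α ε) * (∫⁻ x, g x ∂Q) ^ (1 - 1 / α)) := by
  obtain ⟨U, W, B, B', hUW, hP, hQ, hB, -⟩ :=
    exists_decomposition (Real.one_lt_exp_iff.2 hε) hPQ hQP
  set e := ENNReal.ofReal (Real.exp ε) with he
  have α0 : 0 < α := by linarith
  set β := 1 - 1 / α with hβ
  have hβ1 : β < 1 := by rw [hβ]; have : 0 < 1 / α := by positivity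
                         linarith
  have hβ0 : 0 < β := by rw [hβ]; have : 1 / α < 1 := (div_lt_one α0).2 hα
                         linarith
  have hβα : 1 - β = 1 / α := by rw [hβ]; ring
  have hmass : e * U Set.univ + W Set.univ ≤ 1 := by
    calc e * U Set.univ + W Set.univ ≤ P Set.univ := by
          rw [hP]; simp
      _ = 1 := measure_univ
  set M := W Set.univ with hM
  -- Equality of the two masses enters here: it normalizes the randomized response.
  have hMe : (e + 1) * M ≤ 1 := by rw [hUW] at hmass; rw [add_mul, one_mul]; exact hmass
  have hgQ : ∫⁻ x, g x ∂U + e * ∫⁻ x, g x ∂W ≤ ∫⁻ x, g x ∂Q := by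
    rw [hQ, lintegral_add_measure, lintegral_add_measure, lintegral_smul_measure]
    exact le_self_add
  have i1 : ∀ V : Measure Ω, ∫⁻ x, f x ∂V ≤ c * V Set.univ + k * ∫⁻ x, g x ^ β ∂V := fun V => by
    refine (lintegral_mono h).trans_eq ?_
    rw [lintegral_add_left measurable_const, lintegral_const,
      lintegral_const_mul _ (hg.pow_const β)]
  have i2 : ∫⁻ x, f x ∂B ≤ δ := (lintegral_mono hf).trans (by simpa using hB)
  have e0 : e ≠ 0 := by simp [he, Real.exp_pos]
  have et : e ≠ ∞ := ENNReal.ofReal_ne_top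
  have i3 : e * ∫⁻ x, g x ^ β ∂U + ∫⁻ x, g x ^ β ∂W ≤
      ENNReal.ofReal (stepFactor α ε) * (∫⁻ x, g x ∂Q) ^ β := by
    have j1 := lintegral_rpow_le U hg hβ0 hβ1
    have j2 := lintegral_rpow_le W hg hβ0 hβ1
    rw [hUW] at j1
    set x := ∫⁻ x, g x ∂U
    set y := ∫⁻ x, g x ∂W
    -- The weights are chosen so that, as `1 - β = 1 / α`, the powers of `e` on the left become
    -- those of `P`, while on the right `x + e y` is the part of `∫ g` under `Q`.
    have j3 := add_rpow_mul_le (e ^ α * M) (e ^ (1 - α) * M) x (e * y) hβ0 hβ1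
    have k1 : (e ^ α * M) ^ (1 - β) = e * M ^ (1 - β) := by
      rw [ENNReal.mul_rpow_of_nonneg _ _ (by linarith), ← ENNReal.rpow_mul, hβα,
        mul_one_div_cancel α0.ne', ENNReal.rpow_one]
    have k2 : (e ^ (1 - α) * M) ^ (1 - β) * (e * y) ^ β = M ^ (1 - β) * y ^ β := by
      rw [ENNReal.mul_rpow_of_nonneg _ _ (by linarith), ← ENNReal.rpow_mul,
        ENNReal.mul_rpow_of_nonneg _ _ hβ0.le]
      have : e ^ ((1 - α) * (1 - β)) * e ^ β = 1 := by
        rw [← ENNReal.rpow_add _ _ e0 et, hβα, hβ]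
        have : (1 - α) * (1 / α) + (1 - 1 / α) = 0 := by field_simp; ring
        rw [this, ENNReal.rpow_zero]
      calc _ = (e ^ ((1 - α) * (1 - β)) * e ^ β) * (M ^ (1 - β) * y ^ β) := by ring
        _ = _ := by rw [this, one_mul]
    rw [k1, k2] at j3
    have k3 : (e ^ α * M + e ^ (1 - α) * M) ^ (1 - β) ≤ ENNReal.ofReal (stepFactor α ε) := by
      have l1 : e ^ α * M + e ^ (1 - α) * M ≤
          ENNReal.ofReal (Real.exp ((α - 1 / 2) ^ 2 * ε ^ 2 / 2)) := by
        have l2 : e ^ α + e ^ (1 - α) ≤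
            (e + 1) * ENNReal.ofReal (Real.exp ((α - 1 / 2) ^ 2 * ε ^ 2 / 2)) := by
          rw [he, ENNReal.ofReal_rpow_of_pos (Real.exp_pos _),
            ENNReal.ofReal_rpow_of_pos (Real.exp_pos _), ← Real.exp_mul, ← Real.exp_mul,
            ← ENNReal.ofReal_one, ← ENNReal.ofReal_add (Real.exp_pos _).le zero_le_one,
            ← ENNReal.ofReal_add (Real.exp_pos _).le (Real.exp_pos _).le,
            ← ENNReal.ofReal_mul (by positivity)]
          refine ENNReal.ofReal_le_ofReal ?_
          have := exp_add_exp_le (ε := ε) (α := α)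
          rw [mul_comm ε, mul_comm ε, add_comm (Real.exp ε)]
          exact this
        calc _ = (e ^ α + e ^ (1 - α)) * M := by ring
          _ ≤ (e + 1) * ENNReal.ofReal (Real.exp ((α - 1 / 2) ^ 2 * ε ^ 2 / 2)) * M := by gcongr
          _ = ((e + 1) * M) * ENNReal.ofReal (Real.exp ((α - 1 / 2) ^ 2 * ε ^ 2 / 2)) := by ring
          _ ≤ 1 * _ := by gcongr
          _ = _ := one_mul _
      refine (ENNReal.rpow_le_rpow l1 (by linarith)).trans_eq ?_
      rw [ENNReal.ofReal_rpow_of_pos (Real.exp_pos _), ← Real.exp_mul, hβα, stepFactor]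
      congr 2; ring
    calc _ ≤ e * (x ^ β * M ^ (1 - β)) + y ^ β * M ^ (1 - β) := by gcongr
      _ = e * M ^ (1 - β) * x ^ β + M ^ (1 - β) * y ^ β := by ring
      _ ≤ _ := j3
      _ ≤ _ := by gcongr
  calc ∫⁻ x, f x ∂P = e * ∫⁻ x, f x ∂U + ∫⁻ x, f x ∂W + ∫⁻ x, f x ∂B := by
        conv_lhs => rw [hP, lintegral_add_measure, lintegral_add_measure, lintegral_smul_measure]
        rfl
    _ ≤ e * (c * M + k * ∫⁻ x, g x ^ β ∂U) + (c * M + k * ∫⁻ x, g x ^ β ∂W) + δ := by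
        have := i1 U
        rw [hUW] at this
        gcongr
        exact i1 W
    _ = δ + c * ((e + 1) * M) + k * (e * ∫⁻ x, g x ^ β ∂U + ∫⁻ x, g x ^ β ∂W) := by ring
    _ ≤ δ + c * 1 + k * (ENNReal.ofReal (stepFactor α ε) * (∫⁻ x, g x ∂Q) ^ β) := by gcongr
    _ = _ := by rw [mul_one]

/-- The power bound of the composition implies approximate indistinguishability. -/
theorem exp_mul_rpow_le {α s η q : ℝ} (hα : 2 ≤ α) (hq : 0 ≤ q) :
    Real.exp (s / α) * q ^ (1 - 1 / α) ≤
      Real.exp η * q + Real.exp (s - (α - 1) * η) / (2 * α) := by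
  have α0 : 0 < α := by linarith
  set β := 1 - 1 / α with hβ
  have h1 : 1 / α ≤ 1 / 2 := one_div_le_one_div_of_le two_pos hα
  have hβ0 : 0 < β := by rw [hβ]; linarith
  -- Bernoulli: `β⁻¹ = 1 + 1 / (α - 1)`, whose power `α - 1` is at least `2`.
  have hb : β ^ (α - 1) ≤ 1 / 2 := by
    have hB := one_add_mul_self_le_rpow_one_add (s := 1 / (α - 1)) (p := α - 1)
      (by have : 0 ≤ 1 / (α - 1) := by apply div_nonneg <;> linarith
          linarith) (by linarith)
    have ha : α - 1 ≠ 0 := by linarith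
    rw [mul_one_div_cancel ha] at hB
    have e : β = (1 + 1 / (α - 1))⁻¹ := by
      have : 1 + 1 / (α - 1) = α / (α - 1) := by field_simp; ring
      rw [hβ, this, inv_div]; field_simp
    have h2 : 0 ≤ 1 + 1 / (α - 1) := by
      have : 0 ≤ 1 / (α - 1) := by apply div_nonneg <;> linarith
      linarith
    rw [e, Real.inv_rpow h2, show (1 : ℝ) / 2 = 2⁻¹ by norm_num]
    exact inv_anti₀ two_pos (by linarith)
  -- In the AM-GM with weights `β` and `1 / α`, the first point is chosen to contribute exactly `e^η
  -- q`; then `Y` is forced by the geometric mean on the left.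
  set Y := Real.exp (s - (α - 1) * η) * β ^ (α - 1) with hY
  have hY0 : 0 ≤ Y := by positivity
  have hag := Real.geom_mean_le_arith_mean2_weighted hβ0.le (by positivity : 0 ≤ 1 / α)
    (by positivity : 0 ≤ Real.exp η * q / β) hY0 (by rw [hβ]; ring)
  have e1 : (Real.exp η * q / β) ^ β * Y ^ (1 / α) = Real.exp (s / α) * q ^ β := by
    rw [hY, Real.div_rpow (by positivity) hβ0.le, Real.mul_rpow (Real.exp_pos _).le hq,
      Real.mul_rpow (Real.exp_pos _).le (by positivity), ← Real.exp_mul, ← Real.exp_mul,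
      ← Real.rpow_mul hβ0.le]
    have e2 : (α - 1) * (1 / α) = β := by rw [hβ]; field_simp
    have e3 : Real.exp (s / α) = Real.exp (η * β) * Real.exp ((s - (α - 1) * η) * (1 / α)) := by
      rw [← Real.exp_add, ← e2]; congr 1; ring
    have : β ^ β ≠ 0 := (Real.rpow_pos_of_pos hβ0 _).ne'
    rw [e2, e3]
    field_simp
  rw [e1, mul_div_cancel₀ _ hβ0.ne'] at hag
  refine hag.trans ?_
  have : 1 / α * Y ≤ Real.exp (s - (α - 1) * η) / (2 * α) := by
    rw [hY]
    calc _ ≤ 1 / α * (Real.exp (s - (α - 1) * η) * (1 / 2)) := by gcongr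
      _ = _ := by field_simp
  linarith

/-- Advanced composition: `T` steps turn into an approximate indistinguishability. -/
theorem stepFactor_pow_mul_rpow_le {T : ℕ} {α ε η : ℝ} (hα : 2 ≤ α) {q : ℝ≥0∞} (hq : q ≤ 1) :
    ENNReal.ofReal (stepFactor α ε) ^ T * q ^ (1 - 1 / α) ≤
      ENNReal.ofReal (Real.exp η) * q + ENNReal.ofReal
        (Real.exp ((α - 1 / 2) ^ 2 * (T * ε ^ 2) / 2 - (α - 1) * η) / (2 * α)) := by
  have hqt : q ≠ ∞ := ne_top_of_le_ne_top ENNReal.one_ne_top hq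
  have hβ : 0 ≤ 1 - 1 / α := by
    have : 1 / α ≤ 1 / 2 := one_div_le_one_div_of_le two_pos hα
    linarith
  have := exp_mul_rpow_le (s := (α - 1 / 2) ^ 2 * (T * ε ^ 2) / 2) (η := η) hα
    (q := q.toReal) ENNReal.toReal_nonneg
  conv_lhs => rw [← ENNReal.ofReal_toReal hqt]
  conv_rhs => rw [← ENNReal.ofReal_toReal hqt]
  rw [ENNReal.ofReal_rpow_of_nonneg ENNReal.toReal_nonneg hβ,
    ← ENNReal.ofReal_pow (by unfold stepFactor; positivity),
    ← ENNReal.ofReal_mul (by unfold stepFactor; positivity),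
    ← ENNReal.ofReal_mul (Real.exp_pos _).le, ← ENNReal.ofReal_add (by positivity) (by positivity)]
  refine ENNReal.ofReal_le_ofReal ?_
  refine le_trans (le_of_eq ?_) this
  rw [stepFactor, ← Real.exp_nat_mul]
  congr 2; ring

/-! ### Threshold algorithms as kernels -/

instance : DiscreteMeasurableSpace (Bool ⊕ Unit) where
  forall_measurableSet _ := measurableSet_sum_iff.2 ⟨.of_discrete, .of_discrete⟩

theorem measurable_snoc {α : Type*} [MeasurableSpace α] (j : ℕ) :
    Measurable fun p : (Fin j → α) × α => Fin.snoc (α := fun _ => α) p.1 p.2 := by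
  refine measurable_pi_iff.2 fun i => ?_
  induction i using Fin.lastCases with
  | last => simpa using measurable_snd
  | cast i =>
    simp only [Fin.snoc_castSucc]
    exact (measurable_pi_apply i).comp measurable_fst

theorem lintegral_bind' {α β : Type*} [MeasurableSpace α] [MeasurableSpace β] {μ : Measure α}
    {F : α → Measure β} (hF : Measurable F) {f : β → ℝ≥0∞} (hf : Measurable f) :
    ∫⁻ y, f y ∂(μ.bind F) = ∫⁻ x, ∫⁻ y, f y ∂(F x) ∂μ :=
  Measure.lintegral_bind hF.aemeasurable hf.aemeasurable

theorem measurable_lintegral_param {α β : Type*} [MeasurableSpace α]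
    [MeasurableSpace β] {κ : α → Measure β} (hκ : Measurable κ)
    [∀ x, IsProbabilityMeasure (κ x)] {F : α → β → ℝ≥0∞}
    (hF : Measurable (Function.uncurry F)) : Measurable fun x => ∫⁻ y, F x y ∂(κ x) := by
  let k : Kernel α β := ⟨κ, hκ⟩
  have : IsMarkovKernel k := ⟨fun x => inferInstanceAs (IsProbabilityMeasure (κ x))⟩
  exact Measurable.lintegral_kernel_prod_right (κ := k) hF

section SV

variable {n : ℕ} {X : Type u} {SV : SVAlg.{u, w} n X}

theorem SVAlg.IsValid.measurable_round (h : SV.IsValid) (D : Fin n → X) :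
    Measurable fun z : SV.State × ((Fin n → X) → ℝ) => SV.round D z.1 z.2 := by
  unfold SVAlg.round
  refine Measurable.ite (measurable_fst h.halted_meas) ?_ ?_
  · exact Measure.measurable_dirac.comp (measurable_const.prodMk measurable_fst)
  · exact (Measure.measurable_map _ (by fun_prop)).comp (h.step_meas D)

theorem SVAlg.IsValid.isProbabilityMeasure_round (h : SV.IsValid) (D : Fin n → X) (s : SV.State)
    (q : (Fin n → X) → ℝ) : IsProbabilityMeasure (SV.round D s q) := by
  unfold SVAlg.round
  split_ifs
  · infer_instance
  · have := h.step_prob D s q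
    exact Measure.isProbabilityMeasure_map (by fun_prop)

theorem SVAlg.IsValid.measurable_round_left (h : SV.IsValid) (D : Fin n → X)
    (q : (Fin n → X) → ℝ) : Measurable fun s => SV.round D s q :=
  (h.measurable_round D).comp (measurable_id.prodMk measurable_const)

variable (SV) in
/-- The law of the state after the query `q` on the event that the answer is `a`. -/
def SVAlg.evolve (D : Fin n → X) (μ : Measure SV.State) (q : (Fin n → X) → ℝ)
    (a : Bool ⊕ Unit) : Measure SV.State :=
  ((μ.bind fun s => SV.round D s q).restrict (Prod.fst ⁻¹' {a})).map Prod.snd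

theorem SVAlg.IsValid.evolve_apply (h : SV.IsValid) (D : Fin n → X) (μ : Measure SV.State)
    (q : (Fin n → X) → ℝ) (a : Bool ⊕ Unit) {U : Set SV.State} (hU : MeasurableSet U) :
    SV.evolve D μ q a U = ∫⁻ s, SV.round D s q ({a} ×ˢ U) ∂μ := by
  have hm : MeasurableSet (({a} : Set (Bool ⊕ Unit)) ×ˢ U) := (MeasurableSet.singleton a).prod hU
  rw [SVAlg.evolve, Measure.map_apply measurable_snd hU,
    Measure.restrict_apply (measurable_snd hU),
    ← Measure.bind_apply hm (h.measurable_round_left D q).aemeasurable]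
  congr 1
  ext ⟨x, y⟩
  simp [and_comm]

theorem SVAlg.IsValid.isFiniteMeasure_evolve (h : SV.IsValid) (D : Fin n → X)
    (μ : Measure SV.State) [IsFiniteMeasure μ]
    (q : (Fin n → X) → ℝ) (a : Bool ⊕ Unit) : IsFiniteMeasure (SV.evolve D μ q a) := by
  constructor
  rw [h.evolve_apply D μ q a MeasurableSet.univ]
  refine lt_of_le_of_lt (lintegral_mono (g := fun _ => 1) fun s => ?_) (by simp)
  have := h.isProbabilityMeasure_round D s q
  exact prob_le_one

/-- There are only finitely many answers, so a round is a finite sum over unnormalized state laws,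
and no conditional distribution has to be chosen. -/
theorem SVAlg.IsValid.lintegral_round (h : SV.IsValid) (D : Fin n → X) (μ : Measure SV.State)
    (q : (Fin n → X) → ℝ) {F : (Bool ⊕ Unit) × SV.State → ℝ≥0∞} (hF : Measurable F) :
    ∫⁻ s, ∫⁻ r, F r ∂(SV.round D s q) ∂μ =
      ∑ a, ∫⁻ s, F (a, s) ∂(SV.evolve D μ q a) := by
  rw [← lintegral_bind' (h.measurable_round_left D q) hF]
  set ν := μ.bind fun s => SV.round D s q with hν
  have hm : ∀ a : Bool ⊕ Unit, MeasurableSet (Prod.fst ⁻¹' {a} : Set ((Bool ⊕ Unit) × SV.State)) :=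
    fun a => measurable_fst (MeasurableSet.singleton a)
  have h1 : ∀ r, F r = ∑ a, (Prod.fst ⁻¹' {a}).indicator F r := fun r => by
    rw [Finset.sum_eq_single r.1]
    · simp
    · intro b _ hb
      exact Set.indicator_of_notMem (by simpa using hb.symm) _
    · simp
  rw [lintegral_congr h1, lintegral_finsetSum _ fun a _ => hF.indicator (hm a)]
  refine Finset.sum_congr rfl fun a _ => ?_
  rw [lintegral_indicator (hm a), SVAlg.evolve, lintegral_map (f := fun s => F (a, s))
    (hF.comp measurable_prodMk_left) measurable_snd, ← hν]
  refine setLIntegral_congr_fun (hm a) fun r hr => ?_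
  have : r.1 = a := hr
  simp [← this]

/-! ### Interaction with a randomized adversary -/

/-- A randomized adversary: in round `j` it extends its memory at random and asks a query. The
way in which the answer enters the memory is a separate datum. -/
structure Adversary (n : ℕ) (X : Type u) where
  Mem : ℕ → Type v
  Ext : ℕ → Type v
  mMem : ∀ j, MeasurableSpace (Mem j)
  mExt : ∀ j, MeasurableSpace (Ext j)
  start : Mem 0
  draw : ∀ j, Mem j → Measure (Ext j)
  query : ∀ j, Ext j → (Fin n → X) → ℝ

attribute [instance] Adversary.mMem Adversary.mExt

structure Adversary.IsValid (𝒜 : Adversary.{u, v} n X) (Δ : ℝ) : Prop where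
  draw_prob : ∀ j y, IsProbabilityMeasure (𝒜.draw j y)
  draw_meas : ∀ j, Measurable (𝒜.draw j)
  query_meas : ∀ j, Measurable (𝒜.query j)
  query_sens : ∀ j z, IsSensitive Δ (𝒜.query j z)

/-- The laws of the next memory content given the answer. -/
structure Adversary.IsUpdate (𝒜 : Adversary.{u, v} n X)
    (post : ∀ j, 𝒜.Ext j × (Bool ⊕ Unit) → Measure (𝒜.Mem (j + 1))) : Prop where
  prob : ∀ j z, IsProbabilityMeasure (post j z)
  meas : ∀ j, Measurable (post j)

variable (SV) in
/-- One round of the interaction. -/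
def Adversary.step (𝒜 : Adversary.{u, v} n X)
    (post : ∀ j, 𝒜.Ext j × (Bool ⊕ Unit) → Measure (𝒜.Mem (j + 1))) (D : Fin n → X) (j : ℕ)
    (ω : (Fin j → Bool ⊕ Unit) × 𝒜.Mem j × SV.State) :
    Measure ((Fin (j + 1) → Bool ⊕ Unit) × 𝒜.Mem (j + 1) × SV.State) :=
  (𝒜.draw j ω.2.1).bind fun z => (SV.round D ω.2.2 (𝒜.query j z)).bind fun r =>
    (post j (z, r.1)).map fun y =>
      (Fin.snoc (α := fun _ => Bool ⊕ Unit) ω.1 r.1, y, r.2)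

variable (SV) in
/-- The joint law of the answers, the memory and the state of the threshold algorithm. -/
def Adversary.law (𝒜 : Adversary.{u, v} n X)
    (post : ∀ j, 𝒜.Ext j × (Bool ⊕ Unit) → Measure (𝒜.Mem (j + 1))) (D : Fin n → X) :
    (j : ℕ) → Measure ((Fin j → Bool ⊕ Unit) × 𝒜.Mem j × SV.State)
  | 0 => (SV.init D).map fun s => (Fin.elim0, 𝒜.start, s)
  | j + 1 => (𝒜.law post D j).bind (𝒜.step SV post D j)

variable {𝒜 : Adversary.{u, v} n X} {Δ : ℝ}
  {post : ∀ j, 𝒜.Ext j × (Bool ⊕ Unit) → Measure (𝒜.Mem (j + 1))}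

theorem Adversary.measurable_step_map (hp : 𝒜.IsUpdate post) (j : ℕ) :
    Measurable (Function.uncurry fun (x : ((Fin j → Bool ⊕ Unit) × 𝒜.Mem j × SV.State) × 𝒜.Ext j)
      (r : (Bool ⊕ Unit) × SV.State) => (post j (x.2, r.1)).map fun y =>
        (Fin.snoc (α := fun _ => Bool ⊕ Unit) x.1.1 r.1, y, r.2)) := by
  have := hp.prob j
  refine measurable_map_param (κ := fun x : (((Fin j → Bool ⊕ Unit) × 𝒜.Mem j × SV.State) ×
    𝒜.Ext j) × ((Bool ⊕ Unit) × SV.State) => post j (x.1.2, x.2.1))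
    ((hp.meas j).comp (by fun_prop)) (F := fun x y =>
      (Fin.snoc (α := fun _ => Bool ⊕ Unit) x.1.1.1 x.2.1, y, x.2.2)) ?_
  refine Measurable.prodMk ?_ (by fun_prop)
  exact (measurable_snoc j).comp (by fun_prop :
    Measurable fun x : ((((Fin j → Bool ⊕ Unit) × 𝒜.Mem j × SV.State) ×
    𝒜.Ext j) × ((Bool ⊕ Unit) × SV.State)) × 𝒜.Mem (j + 1) => (x.1.1.1.1, x.1.2.1))

theorem Adversary.measurable_step_bind (hSV : SV.IsValid) (h𝒜 : 𝒜.IsValid Δ)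
    (hp : 𝒜.IsUpdate post) (D : Fin n → X) (j : ℕ) :
    Measurable (Function.uncurry fun (ω : (Fin j → Bool ⊕ Unit) × 𝒜.Mem j × SV.State)
      (z : 𝒜.Ext j) => (SV.round D ω.2.2 (𝒜.query j z)).bind fun r =>
        (post j (z, r.1)).map fun y =>
          (Fin.snoc (α := fun _ => Bool ⊕ Unit) ω.1 r.1, y, r.2)) := by
  have := hSV.isProbabilityMeasure_round D
  exact measurable_bind_param (κ := fun x : ((Fin j → Bool ⊕ Unit) × 𝒜.Mem j × SV.State) ×
    𝒜.Ext j => SV.round D x.1.2.2 (𝒜.query j x.2))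
    ((hSV.measurable_round D).comp (Measurable.prodMk (by fun_prop)
      ((h𝒜.query_meas j).comp measurable_snd))) (measurable_step_map hp j)

theorem Adversary.measurable_step (hSV : SV.IsValid) (h𝒜 : 𝒜.IsValid Δ)
    (hp : 𝒜.IsUpdate post) (D : Fin n → X) (j : ℕ) : Measurable (𝒜.step SV post D j) := by
  have := h𝒜.draw_prob j
  exact measurable_bind_param (κ := fun ω : (Fin j → Bool ⊕ Unit) × 𝒜.Mem j × SV.State =>
    𝒜.draw j ω.2.1) ((h𝒜.draw_meas j).comp (by fun_prop)) (measurable_step_bind hSV h𝒜 hp D j)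

theorem Adversary.measurable_lintegral_post (hp : 𝒜.IsUpdate post) {j : ℕ}
    {f : (Fin (j + 1) → Bool ⊕ Unit) × 𝒜.Mem (j + 1) × SV.State → ℝ≥0∞} (hf : Measurable f)
    (b : Fin j → Bool ⊕ Unit) :
    Measurable fun x : 𝒜.Ext j × ((Bool ⊕ Unit) × SV.State) =>
      ∫⁻ y, f (Fin.snoc (α := fun _ => Bool ⊕ Unit) b x.2.1, y, x.2.2) ∂(post j (x.1, x.2.1)) := by
  have := hp.prob j
  refine measurable_lintegral_param (κ := fun x : 𝒜.Ext j × ((Bool ⊕ Unit) × SV.State) =>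
    post j (x.1, x.2.1)) ((hp.meas j).comp (by fun_prop)) (F := fun x y =>
    f (Fin.snoc (α := fun _ => Bool ⊕ Unit) b x.2.1, y, x.2.2)) (hf.comp ?_)
  refine Measurable.prodMk ?_ (by fun_prop)
  exact (measurable_snoc j).comp (by fun_prop :
    Measurable fun x : (𝒜.Ext j × ((Bool ⊕ Unit) × SV.State)) × 𝒜.Mem (j + 1) => (b, x.1.2.1))

theorem Adversary.lintegral_step (hSV : SV.IsValid) (h𝒜 : 𝒜.IsValid Δ)
    (hp : 𝒜.IsUpdate post) (D : Fin n → X) (j : ℕ)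
    (ω : (Fin j → Bool ⊕ Unit) × 𝒜.Mem j × SV.State)
    {f : (Fin (j + 1) → Bool ⊕ Unit) × 𝒜.Mem (j + 1) × SV.State → ℝ≥0∞} (hf : Measurable f) :
    ∫⁻ x, f x ∂(𝒜.step SV post D j ω) =
      ∫⁻ z, ∫⁻ r, ∫⁻ y, f (Fin.snoc (α := fun _ => Bool ⊕ Unit) ω.1 r.1, y, r.2)
        ∂(post j (z, r.1)) ∂(SV.round D ω.2.2 (𝒜.query j z)) ∂(𝒜.draw j ω.2.1) := by
  refine (lintegral_bind' ((measurable_step_bind hSV h𝒜 hp D j).comp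
    (measurable_prodMk_left (x := ω))) hf).trans ?_
  refine lintegral_congr fun z => ?_
  refine (lintegral_bind' ((measurable_step_map hp j).comp
    (measurable_prodMk_left (x := (ω, z)))) hf).trans ?_
  exact lintegral_congr fun r => lintegral_map hf (by fun_prop)

theorem Adversary.isProbabilityMeasure_step (hSV : SV.IsValid) (h𝒜 : 𝒜.IsValid Δ)
    (hp : 𝒜.IsUpdate post) (D : Fin n → X) (j : ℕ)
    (ω : (Fin j → Bool ⊕ Unit) × 𝒜.Mem j × SV.State) :
    IsProbabilityMeasure (𝒜.step SV post D j ω) := by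
  have h1 := h𝒜.draw_prob j ω.2.1
  have h2 := hSV.isProbabilityMeasure_round D
  have h3 := hp.prob j
  constructor
  have := lintegral_step hSV h𝒜 hp D j ω (f := fun _ => 1) measurable_const
  simpa using this

theorem Adversary.isProbabilityMeasure_law (hSV : SV.IsValid) (h𝒜 : 𝒜.IsValid Δ)
    (hp : 𝒜.IsUpdate post) (D : Fin n → X) (j : ℕ) :
    IsProbabilityMeasure (𝒜.law SV post D j) := by
  induction j with
  | zero =>
    have := hSV.init_prob D
    exact Measure.isProbabilityMeasure_map (by fun_prop)
  | succ j ih =>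
    exact isProbabilityMeasure_bind' (measurable_step hSV h𝒜 hp D j)
      (isProbabilityMeasure_step hSV h𝒜 hp D j)

theorem Adversary.lintegral_law_succ (hSV : SV.IsValid) (h𝒜 : 𝒜.IsValid Δ)
    (hp : 𝒜.IsUpdate post) (D : Fin n → X) (j : ℕ)
    {f : (Fin (j + 1) → Bool ⊕ Unit) × 𝒜.Mem (j + 1) × SV.State → ℝ≥0∞} (hf : Measurable f) :
    ∫⁻ x, f x ∂(𝒜.law SV post D (j + 1)) =
      ∫⁻ ω, ∫⁻ x, f x ∂(𝒜.step SV post D j ω) ∂(𝒜.law SV post D j) :=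
  lintegral_bind' (measurable_step hSV h𝒜 hp D j) hf

theorem Adversary.measurable_lintegral_step (hSV : SV.IsValid) (h𝒜 : 𝒜.IsValid Δ)
    (hp : 𝒜.IsUpdate post) (D : Fin n → X) (j : ℕ)
    {f : (Fin (j + 1) → Bool ⊕ Unit) × 𝒜.Mem (j + 1) × SV.State → ℝ≥0∞} (hf : Measurable f) :
    Measurable fun ω => ∫⁻ x, f x ∂(𝒜.step SV post D j ω) :=
  (Measure.measurable_lintegral hf).comp (measurable_step hSV h𝒜 hp D j)

/-! ### From deterministic to randomized adversaries -/

open Classical in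
/-- The largest possible value of `∑ (P - c P')⁺` over deterministic continuations, where the sum
runs over the answer sequences in `G`, and `P`, `P'` are their masses if the states are distributed
according to `μ`, `μ'`. -/
def SVAlg.potential (SV : SVAlg.{u, w} n X) (D D' : Fin n → X) (Δ : ℝ) (c : ℝ≥0∞)
    (G : ∀ j, Set (Fin j → Bool ⊕ Unit)) : (m j : ℕ) → (Fin j → Bool ⊕ Unit) →
      Measure SV.State → Measure SV.State → ℝ≥0∞
  | 0, j, b, μ, μ' => if b ∈ G j then μ Set.univ - c * μ' Set.univ else 0
  | m + 1, j, b, μ, μ' => ⨆ q : {q : (Fin n → X) → ℝ // IsSensitive Δ q}, ∑ a,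
      SV.potential D D' Δ c G m (j + 1) (Fin.snoc (α := fun _ => Bool ⊕ Unit) b a)
        (SV.evolve D μ q.1 a) (SV.evolve D' μ' q.1 a)

/-- Given the query and the answer, the memory is updated without looking at the state. By Tonelli
the state can thus be integrated out innermost, with the memory fixed. -/
theorem Adversary.lintegral_lintegral_step (hSV : SV.IsValid) (h𝒜 : 𝒜.IsValid Δ)
    (hp : 𝒜.IsUpdate post) (D : Fin n → X) (j : ℕ) (b : Fin j → Bool ⊕ Unit) (y : 𝒜.Mem j)
    (μ : Measure SV.State) [IsFiniteMeasure μ]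
    {f : (Fin (j + 1) → Bool ⊕ Unit) × 𝒜.Mem (j + 1) × SV.State → ℝ≥0∞} (hf : Measurable f) :
    ∫⁻ s, ∫⁻ x, f x ∂(𝒜.step SV post D j (b, y, s)) ∂μ =
      ∫⁻ z, ∑ a, ∫⁻ y', ∫⁻ s, f (Fin.snoc (α := fun _ => Bool ⊕ Unit) b a, y', s)
        ∂(SV.evolve D μ (𝒜.query j z) a) ∂(post j (z, a)) ∂(𝒜.draw j y) := by
  have h1 := h𝒜.draw_prob j
  have h2 := hSV.isProbabilityMeasure_round D
  have h3 := hp.prob j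
  have hG := measurable_lintegral_post (SV := SV) hp hf b
  simp_rw [lintegral_step hSV h𝒜 hp D j _ hf]
  rw [lintegral_lintegral_swap]
  · refine lintegral_congr fun z => ?_
    rw [hSV.lintegral_round D μ (𝒜.query j z) (F := fun r =>
      ∫⁻ y, f (Fin.snoc (α := fun _ => Bool ⊕ Unit) b r.1, y, r.2) ∂(post j (z, r.1)))
      (hG.comp measurable_prodMk_left)]
    refine Finset.sum_congr rfl fun a _ => ?_
    have := hSV.isFiniteMeasure_evolve D μ (𝒜.query j z) a
    rw [lintegral_lintegral_swap]
    exact (hf.comp (by fun_prop)).aemeasurable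
  · refine Measurable.aemeasurable ?_
    exact measurable_lintegral_param (κ := fun x : SV.State × 𝒜.Ext j =>
      SV.round D x.1 (𝒜.query j x.2)) ((hSV.measurable_round D).comp
        (measurable_fst.prodMk ((h𝒜.query_meas j).comp measurable_snd)))
      (F := fun x r => ∫⁻ y, f (Fin.snoc (α := fun _ => Bool ⊕ Unit) b r.1, y, r.2)
        ∂(post j (x.2, r.1)))
      (hG.comp (by fun_prop : Measurable fun x : (SV.State × 𝒜.Ext j) ×
        ((Bool ⊕ Unit) × SV.State) => (x.1.2, x.2)))

/-- Backward induction: the test functions are pulled back through the last round while the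
potential gains one remaining round. The hypothesis ranges over all pairs of finite state measures,
because the laws met at a given answer string and memory are unnormalized and differ for the two
datasets. -/
theorem Adversary.lintegral_law_le (hSV : SV.IsValid) (h𝒜 : 𝒜.IsValid Δ)
    (hp : 𝒜.IsUpdate post) (D D' : Fin n → X) {c : ℝ≥0∞} (hc : c ≠ ∞)
    (G : ∀ j, Set (Fin j → Bool ⊕ Unit)) (j m : ℕ)
    {f f' : (Fin j → Bool ⊕ Unit) × 𝒜.Mem j × SV.State → ℝ≥0∞} (hf : Measurable f)
    (hf' : Measurable f')
    (h : ∀ b y (μ μ' : Measure SV.State), IsFiniteMeasure μ → IsFiniteMeasure μ' →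
      ∫⁻ s, f (b, y, s) ∂μ ≤ c * ∫⁻ s, f' (b, y, s) ∂μ' + SV.potential D D' Δ c G m j b μ μ') :
    ∫⁻ ω, f ω ∂(𝒜.law SV post D j) ≤ c * ∫⁻ ω, f' ω ∂(𝒜.law SV post D' j) +
      SV.potential D D' Δ c G (m + j) 0 Fin.elim0 (SV.init D) (SV.init D') := by
  induction j generalizing m with
  | zero =>
    have h1 := hSV.init_prob D
    have h2 := hSV.init_prob D'
    simp only [Adversary.law]
    rw [lintegral_map hf (by fun_prop), lintegral_map hf' (by fun_prop)]
    exact h _ _ _ _ inferInstance inferInstance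
  | succ j ih =>
    rw [lintegral_law_succ hSV h𝒜 hp D j hf, lintegral_law_succ hSV h𝒜 hp D' j hf',
      show m + (j + 1) = (m + 1) + j by ring]
    refine ih (m + 1) (measurable_lintegral_step hSV h𝒜 hp D j hf)
      (measurable_lintegral_step hSV h𝒜 hp D' j hf') fun b y μ μ' hμ hμ' => ?_
    rw [lintegral_lintegral_step hSV h𝒜 hp D j b y μ hf,
      lintegral_lintegral_step hSV h𝒜 hp D' j b y μ' hf']
    have h1 := h𝒜.draw_prob j
    have h3 := hp.prob j
    have hpot : ∀ z, ∑ a, SV.potential D D' Δ c G m (j + 1)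
        (Fin.snoc (α := fun _ => Bool ⊕ Unit) b a) (SV.evolve D μ (𝒜.query j z) a)
        (SV.evolve D' μ' (𝒜.query j z) a) ≤ SV.potential D D' Δ c G (m + 1) j b μ μ' := fun z =>
      le_iSup (fun q : {q : (Fin n → X) → ℝ // IsSensitive Δ q} => ∑ a,
        SV.potential D D' Δ c G m (j + 1) (Fin.snoc (α := fun _ => Bool ⊕ Unit) b a)
        (SV.evolve D μ q.1 a) (SV.evolve D' μ' q.1 a)) ⟨𝒜.query j z, h𝒜.query_sens j z⟩
    set V := SV.potential D D' Δ c G (m + 1) j b μ μ'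
    have key : ∀ z, ∑ a, ∫⁻ y', ∫⁻ s, f (Fin.snoc (α := fun _ => Bool ⊕ Unit) b a, y', s)
        ∂(SV.evolve D μ (𝒜.query j z) a) ∂(post j (z, a)) ≤
        c * ∑ a, ∫⁻ y', ∫⁻ s, f' (Fin.snoc (α := fun _ => Bool ⊕ Unit) b a, y', s)
        ∂(SV.evolve D' μ' (𝒜.query j z) a) ∂(post j (z, a)) + V := fun z => by
      refine le_trans ?_ (add_le_add_right (hpot z) _)
      rw [Finset.mul_sum, ← Finset.sum_add_distrib]
      refine Finset.sum_le_sum fun a _ => ?_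
      have e1 := hSV.isFiniteMeasure_evolve D μ (𝒜.query j z) a
      have e2 := hSV.isFiniteMeasure_evolve D' μ' (𝒜.query j z) a
      -- The potential does not depend on the new memory and `post` has mass one, so the additive
      -- term is not multiplied.
      refine (lintegral_mono fun y' => h _ y' _ _ e1 e2).trans ?_
      rw [lintegral_add_right _ measurable_const, lintegral_const, measure_univ, mul_one]
      refine add_le_add_left ?_ _
      rw [lintegral_const_mul]
      exact Measurable.lintegral_prod_right' (f := fun x : 𝒜.Mem (j + 1) × SV.State =>
        f' (Fin.snoc (α := fun _ => Bool ⊕ Unit) b a, x.1, x.2)) (hf'.comp (by fun_prop))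
    refine (lintegral_mono key).trans ?_
    rw [lintegral_add_right _ measurable_const, lintegral_const, measure_univ, mul_one]
    refine add_le_add_left ?_ _
    rw [lintegral_const_mul' _ _ hc]

end SV

section Game

variable {n : ℕ} {X : Type u} {SV : SVAlg.{u, w} n X}

theorem SVAlg.IsValid.measurable_game_step (h : SV.IsValid)
    (B : (j : ℕ) → (Fin j → Bool ⊕ Unit) → (Fin n → X) → ℝ) (D : Fin n → X) (j : ℕ) :
    Measurable fun ω : (Fin j → Bool ⊕ Unit) × SV.State =>
      (SV.round D ω.2 (B j ω.1)).map fun z =>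
        (Fin.snoc (α := fun _ => Bool ⊕ Unit) ω.1 z.1, z.2) := by
  have := h.isProbabilityMeasure_round D
  refine measurable_map_param (κ := fun ω : (Fin j → Bool ⊕ Unit) × SV.State =>
    SV.round D ω.2 (B j ω.1)) ((h.measurable_round D).comp (Measurable.prodMk (by fun_prop)
      (Measurable.of_discrete.comp measurable_fst))) (F := fun ω z =>
        (Fin.snoc (α := fun _ => Bool ⊕ Unit) ω.1 z.1, z.2)) ?_
  refine Measurable.prodMk ?_ (by fun_prop)
  exact (measurable_snoc j).comp (by fun_prop :
    Measurable fun x : ((Fin j → Bool ⊕ Unit) × SV.State) × ((Bool ⊕ Unit) × SV.State) =>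
      (x.1.1, x.2.1))

theorem SVAlg.IsValid.lintegral_game_succ (h : SV.IsValid)
    (B : (j : ℕ) → (Fin j → Bool ⊕ Unit) → (Fin n → X) → ℝ) (D : Fin n → X) (j : ℕ)
    {f : (Fin (j + 1) → Bool ⊕ Unit) × SV.State → ℝ≥0∞} (hf : Measurable f) :
    ∫⁻ x, f x ∂(SV.game B D (j + 1)) = ∫⁻ ω, ∫⁻ z,
      f (Fin.snoc (α := fun _ => Bool ⊕ Unit) ω.1 z.1, z.2) ∂(SV.round D ω.2 (B j ω.1))
        ∂(SV.game B D j) := by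
  refine (lintegral_bind' (h.measurable_game_step B D j) hf).trans ?_
  refine lintegral_congr fun ω => lintegral_map hf ?_
  exact ((measurable_snoc j).comp (measurable_const.prodMk measurable_fst)).prodMk measurable_snd

theorem SVAlg.IsValid.isProbabilityMeasure_game (h : SV.IsValid)
    (B : (j : ℕ) → (Fin j → Bool ⊕ Unit) → (Fin n → X) → ℝ) (D : Fin n → X) (j : ℕ) :
    IsProbabilityMeasure (SV.game B D j) := by
  induction j with
  | zero =>
    have := h.init_prob D
    exact Measure.isProbabilityMeasure_map (by fun_prop)
  | succ j ih =>
    have := h.isProbabilityMeasure_round D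
    constructor
    simpa using h.lintegral_game_succ B D j (f := fun _ => 1) measurable_const

theorem SVAlg.game_congr {B B' : (j : ℕ) → (Fin j → Bool ⊕ Unit) → (Fin n → X) → ℝ}
    (D : Fin n → X) {j : ℕ} (h : ∀ i < j, B i = B' i) : SV.game B D j = SV.game B' D j := by
  induction j with
  | zero => rfl
  | succ j ih =>
    simp only [SVAlg.game]
    rw [ih fun i hi => h i (hi.trans j.lt_succ_self), h j j.lt_succ_self]

variable (SV) in
/-- The law of the state in the threshold game on the event that the answers are `b`. -/
def SVAlg.gameState (B : (j : ℕ) → (Fin j → Bool ⊕ Unit) → (Fin n → X) → ℝ) (D : Fin n → X)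
    (j : ℕ) (b : Fin j → Bool ⊕ Unit) : Measure SV.State :=
  ((SV.game B D j).restrict (Prod.fst ⁻¹' {b})).map Prod.snd

theorem SVAlg.gameState_zero (B : (j : ℕ) → (Fin j → Bool ⊕ Unit) → (Fin n → X) → ℝ)
    (D : Fin n → X) (b : Fin 0 → Bool ⊕ Unit) : SV.gameState B D 0 b = SV.init D := by
  have : (Prod.fst ⁻¹' {b} : Set ((Fin 0 → Bool ⊕ Unit) × SV.State)) = Set.univ := by
    ext x; simp [Subsingleton.elim x.1 b]
  rw [SVAlg.gameState, this, Measure.restrict_univ]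
  simp only [SVAlg.game]
  rw [Measure.map_map measurable_snd (by fun_prop)]
  exact Measure.map_id

theorem SVAlg.gameState_univ (B : (j : ℕ) → (Fin j → Bool ⊕ Unit) → (Fin n → X) → ℝ)
    (D : Fin n → X) (j : ℕ) (b : Fin j → Bool ⊕ Unit) :
    SV.gameState B D j b Set.univ = (SV.game B D j).map Prod.fst {b} := by
  rw [SVAlg.gameState, Measure.map_apply measurable_snd MeasurableSet.univ,
    Measure.map_apply measurable_fst (MeasurableSet.singleton b)]
  simp

/-- This matches the recursion of the potential with the deterministic game. -/
theorem SVAlg.IsValid.gameState_succ (h : SV.IsValid)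
    (B : (j : ℕ) → (Fin j → Bool ⊕ Unit) → (Fin n → X) → ℝ)
    (D : Fin n → X) (j : ℕ) (b : Fin j → Bool ⊕ Unit) (a : Bool ⊕ Unit) :
    SV.gameState B D (j + 1) (Fin.snoc (α := fun _ => Bool ⊕ Unit) b a) =
      SV.evolve D (SV.gameState B D j b) (B j b) a := by
  ext U hU
  have hms : MeasurableSet (({a} : Set (Bool ⊕ Unit)) ×ˢ U) := (MeasurableSet.singleton a).prod hU
  have hmb : MeasurableSet (Prod.fst ⁻¹' {b} : Set ((Fin j → Bool ⊕ Unit) × SV.State)) :=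
    measurable_fst (MeasurableSet.singleton b)
  set c : Fin (j + 1) → Bool ⊕ Unit := Fin.snoc (α := fun _ => Bool ⊕ Unit) b a with hc
  have hmc : MeasurableSet (({c} : Set (Fin (j + 1) → Bool ⊕ Unit)) ×ˢ U) :=
    (MeasurableSet.singleton c).prod hU
  have e0 : SV.gameState B D (j + 1) c U = SV.game B D (j + 1) ({c} ×ˢ U) := by
    rw [SVAlg.gameState, Measure.map_apply measurable_snd hU,
      Measure.restrict_apply (measurable_snd hU)]
    congr 1
    ext ⟨x, y⟩
    simp [and_comm]
  rw [e0, h.evolve_apply D _ _ _ hU, ← lintegral_indicator_one hmc,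
    h.lintegral_game_succ B D j (measurable_one.indicator hmc), SVAlg.gameState,
    lintegral_map (f := fun s => SV.round D s (B j b) ({a} ×ˢ U)) ((Measure.measurable_coe hms).comp (h.measurable_round_left D _)) measurable_snd,
    ← lintegral_indicator hmb]
  refine lintegral_congr fun ω => ?_
  by_cases hω : ω.1 = b
  · rw [Set.indicator_of_mem (by simpa using hω), ← lintegral_indicator_one hms, hω]
    refine lintegral_congr fun z => ?_
    by_cases hz : z ∈ ({a} : Set (Bool ⊕ Unit)) ×ˢ U
    · rw [Set.indicator_of_mem hz, Set.indicator_of_mem]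
      · rfl
      · simp only [Set.mem_prod, Set.mem_singleton_iff] at hz ⊢
        rw [hc, hz.1]; exact ⟨rfl, hz.2⟩
    · rw [Set.indicator_of_notMem hz, Set.indicator_of_notMem]
      simp only [Set.mem_prod, Set.mem_singleton_iff] at hz ⊢
      rw [hc, Fin.snoc_inj]
      tauto
  · rw [Set.indicator_of_notMem (by simpa using hω)]
    refine (lintegral_congr fun z => ?_).trans lintegral_zero
    refine Set.indicator_of_notMem ?_ _
    simp only [Set.mem_prod, Set.mem_singleton_iff]
    rw [hc, Fin.snoc_inj]
    tauto

/-- The choices at different indices are independent, so any two choice functions can be merged into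
one that is better at every index. Below, the index is the answer string and the choice is the next
query. -/
theorem sum_iSup_le {ι Q : Type*} [Fintype ι] [Nonempty Q] (F : ι → Q → ℝ≥0∞) :
    ∑ i, ⨆ q, F i q ≤ ⨆ τ : ι → Q, ∑ i, F i (τ i) := by
  classical
  rw [← ENNReal.finsetSum_iSup (s := Finset.univ) (f := fun i (τ : ι → Q) => F i (τ i))]
  · refine Finset.sum_le_sum fun i _ => iSup_le fun q => ?_
    exact le_iSup (fun τ : ι → Q => F i (τ i)) fun _ => q
  · intro τ τ'
    refine ⟨fun i => if F i (τ i) ≤ F i (τ' i) then τ' i else τ i, fun i => ?_⟩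
    dsimp only
    split_ifs with h
    · exact ⟨h, le_rfl⟩
    · exact ⟨le_rfl, (not_le.1 h).le⟩

theorem sum_snoc {α M : Type*} [Fintype α] [AddCommMonoid M] (j : ℕ) (F : (Fin (j + 1) → α) → M) :
    ∑ c, F c = ∑ b : Fin j → α, ∑ a, F (Fin.snoc (α := fun _ => α) b a) := by
  rw [← (Fin.snocEquiv fun _ => α).sum_comp F, Fintype.sum_prod_type_right]
  rfl

/-- The potential of the initial states is bounded by the privacy parameter `δ`. -/
theorem SVAlg.IsValid.sum_potential_le (h : SV.IsValid) {k : ℕ} {Δ : ℝ} (hΔ : 0 ≤ Δ)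
    {c δ : ℝ≥0∞} (hc : c ≠ ∞) {G : ∀ j, Set (Fin j → Bool ⊕ Unit)} {D D' : Fin n → X}
    (hG : ∀ B : (j : ℕ) → (Fin j → Bool ⊕ Unit) → (Fin n → X) → ℝ,
      (∀ j h, IsSensitive Δ (B j h)) → ∀ A ⊆ G k,
        (SV.game B D k).map Prod.fst A ≤ c * (SV.game B D' k).map Prod.fst A + δ)
    (m j : ℕ) (hmj : m + j = k) (B : (j : ℕ) → (Fin j → Bool ⊕ Unit) → (Fin n → X) → ℝ)
    (hB : ∀ j h, IsSensitive Δ (B j h)) :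
    ∑ b, SV.potential D D' Δ c G m j b (SV.gameState B D j b) (SV.gameState B D' j b) ≤ δ := by
  classical
  induction m generalizing j B with
  | zero =>
    obtain rfl : j = k := by omega
    have : ∀ E, IsProbabilityMeasure (SV.game B E j) := fun E => h.isProbabilityMeasure_game B E j
    have : ∀ E, IsProbabilityMeasure ((SV.game B E j).map Prod.fst) := fun E =>
      Measure.isProbabilityMeasure_map (by fun_prop)
    set P := (SV.game B D j).map Prod.fst
    set P' := (SV.game B D' j).map Prod.fst
    -- On this set the truncated differences are true differences, so their sum is the privacy
    -- defect of a single event.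
    set A : Finset (Fin j → Bool ⊕ Unit) :=
      Finset.univ.filter fun b => b ∈ G j ∧ c * P' {b} ≤ P {b} with hA
    have hle : ∑ b ∈ A, P {b} ≤ c * ∑ b ∈ A, P' {b} + δ := by
      rw [sum_measure_singleton, sum_measure_singleton]
      exact hG B hB A fun b hb => (Finset.mem_filter.1 (Finset.mem_coe.1 hb)).2.1
    have hfin : c * ∑ b ∈ A, P' {b} ≠ ∞ :=
      ENNReal.mul_ne_top hc (by rw [sum_measure_singleton]; exact measure_ne_top _ _)
    have hsum : ∑ b, SV.potential D D' Δ c G 0 j b (SV.gameState B D j b)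
        (SV.gameState B D' j b) = ∑ b ∈ A, (P {b} - c * P' {b}) := by
      rw [hA, Finset.sum_filter]
      refine Finset.sum_congr rfl fun b _ => ?_
      rw [SVAlg.potential, SVAlg.gameState_univ, SVAlg.gameState_univ]
      split_ifs with h1 h2 h2
      · rfl
      · exact tsub_eq_zero_of_le (le_of_not_ge fun h3 => h2 ⟨h1, h3⟩)
      · tauto
      · rfl
    rw [hsum]
    refine (ENNReal.add_le_add_iff_left hfin).1 ?_
    rw [Finset.mul_sum, ← Finset.sum_add_distrib, ← Finset.mul_sum]
    refine le_trans (Finset.sum_le_sum fun b hb => ?_) hle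
    rw [add_tsub_cancel_of_le (Finset.mem_filter.1 hb).2.2]
  | succ m ih =>
    have hne : Nonempty {q : (Fin n → X) → ℝ // IsSensitive Δ q} :=
      ⟨⟨fun _ => 0, fun _ _ _ => by simpa using hΔ⟩⟩
    simp only [SVAlg.potential]
    refine (sum_iSup_le fun b (q : {q : (Fin n → X) → ℝ // IsSensitive Δ q}) => ∑ a,
      SV.potential D D' Δ c G m (j + 1) (Fin.snoc (α := fun _ => Bool ⊕ Unit) b a)
        (SV.evolve D (SV.gameState B D j b) q.1 a)
        (SV.evolve D' (SV.gameState B D' j b) q.1 a)).trans (iSup_le fun τ => ?_)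
    -- The chosen continuations form round `j` of one deterministic adversary; the state laws before
    -- round `j` are unaffected.
    set B' := Function.update B j fun b => (τ b).1 with hB'
    have hB's : ∀ i b, IsSensitive Δ (B' i b) := fun i b => by
      by_cases hi : i = j
      · subst hi; rw [hB', Function.update_self]; exact (τ b).2
      · rw [hB', Function.update_of_ne hi]; exact hB i b
    have hlt : ∀ i < j, B i = B' i := fun i hi => by
      rw [hB', Function.update_of_ne hi.ne]
    have hst : ∀ E b, SV.gameState B E j b = SV.gameState B' E j b := fun E b => by
      rw [SVAlg.gameState, SVAlg.gameState, SVAlg.game_congr E hlt]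
    have hτ : ∀ b, (τ b).1 = B' j b := fun b => by rw [hB', Function.update_self]
    refine le_trans (le_of_eq ?_) (ih (j + 1) (by omega) B' hB's)
    rw [sum_snoc]
    refine Finset.sum_congr rfl fun b _ => Finset.sum_congr rfl fun a _ => ?_
    rw [h.gameState_succ, h.gameState_succ, hst, hst, hτ]

variable {𝒜 : Adversary.{u, v} n X} {Δ : ℝ}
  {post : ∀ j, 𝒜.Ext j × (Bool ⊕ Unit) → Measure (𝒜.Mem (j + 1))}

/-- A bound for all deterministic adversaries extends to randomized ones. -/
theorem Adversary.law_le_of_game_le (hSV : SV.IsValid) (h𝒜 : 𝒜.IsValid Δ)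
    (hp : 𝒜.IsUpdate post) {k : ℕ} (hΔ : 0 ≤ Δ)
    {c δ : ℝ≥0∞} (hc : c ≠ ∞) {G : Set (Fin k → Bool ⊕ Unit)} {D D' : Fin n → X}
    (hG : ∀ B : (j : ℕ) → (Fin j → Bool ⊕ Unit) → (Fin n → X) → ℝ,
      (∀ j h, IsSensitive Δ (B j h)) → ∀ A ⊆ G,
        (SV.game B D k).map Prod.fst A ≤ c * (SV.game B D' k).map Prod.fst A + δ)
    {E : Set ((Fin k → Bool ⊕ Unit) × 𝒜.Mem k)} (hE : MeasurableSet E) (hEG : ∀ x ∈ E, x.1 ∈ G) :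
    𝒜.law SV post D k ((fun ω => (ω.1, ω.2.1)) ⁻¹' E) ≤
      c * 𝒜.law SV post D' k ((fun ω => (ω.1, ω.2.1)) ⁻¹' E) + δ := by
  classical
  -- The potential wants a set for every length, but only the one of length `k` is ever consulted.
  obtain ⟨G', rfl⟩ : ∃ G' : ∀ j, Set (Fin j → Bool ⊕ Unit), G' k = G :=
    ⟨Function.update (fun _ => Set.univ) k G, by simp⟩
  have hm : MeasurableSet ((fun ω : (Fin k → Bool ⊕ Unit) × 𝒜.Mem k × SV.State =>
    (ω.1, ω.2.1)) ⁻¹' E) := (by fun_prop : Measurable _) hE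
  have key := lintegral_law_le hSV h𝒜 hp D D' hc G' k 0
    (measurable_const.indicator hm : Measurable (Set.indicator _ fun _ => (1 : ℝ≥0∞)))
    (measurable_const.indicator hm : Measurable (Set.indicator _ fun _ => (1 : ℝ≥0∞))) fun b y μ μ' hμ hμ' => by
      by_cases hb : (b, y) ∈ E
      · have hbG := hEG _ hb
        have : ∀ s : SV.State, ((fun ω : (Fin k → Bool ⊕ Unit) × 𝒜.Mem k × SV.State =>
          (ω.1, ω.2.1)) ⁻¹' E).indicator (fun _ => (1 : ℝ≥0∞)) (b, y, s) = 1 := fun s =>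
            Set.indicator_of_mem (by exact hb) _
        simp only [this, lintegral_one, SVAlg.potential]
        rw [if_pos hbG]
        exact le_add_tsub
      · have : ∀ s : SV.State, ((fun ω : (Fin k → Bool ⊕ Unit) × 𝒜.Mem k × SV.State =>
          (ω.1, ω.2.1)) ⁻¹' E).indicator (fun _ => (1 : ℝ≥0∞)) (b, y, s) = 0 := fun s =>
            Set.indicator_of_notMem (by exact hb) _
        simp [this]
  rw [lintegral_indicator_const hm, lintegral_indicator_const hm, one_mul, one_mul,
    zero_add] at key
  refine key.trans (add_le_add_right ?_ _)
  have hpot := hSV.sum_potential_le hΔ hc hG k 0 (by omega) (fun _ _ _ => 0)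
    fun _ _ _ _ _ => by simpa using hΔ
  rw [Fintype.sum_unique, SVAlg.gameState_zero, SVAlg.gameState_zero] at hpot
  exact hpot

/-! ### Changing the oracle -/

/-- The number of `⊤` answers. -/
def topCount {j : ℕ} (b : Fin j → Bool ⊕ Unit) : ℕ :=
  (Finset.univ.filter fun i => b i = Sum.inl true).card

theorem topCount_snoc {j : ℕ} (b : Fin j → Bool ⊕ Unit) (a : Bool ⊕ Unit) :
    topCount (Fin.snoc (α := fun _ => Bool ⊕ Unit) b a) =
      topCount b + if a = Sum.inl true then 1 else 0 := by
  simp only [topCount, Finset.card_filter]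
  rw [Fin.sum_univ_castSucc]
  simp

/-- Jensen's inequality for the bounds of adaptive composition. -/
theorem lintegral_le_of_le_rpow {Ω : Type*} [MeasurableSpace Ω] (μ : Measure Ω)
    [IsProbabilityMeasure μ] {β : ℝ} (hβ0 : 0 < β) (hβ1 : β < 1) {F H : Ω → ℝ≥0∞} {c k : ℝ≥0∞}
    (hH : Measurable H) (hFH : ∀ x, F x ≤ c + k * H x ^ β) :
    ∫⁻ x, F x ∂μ ≤ c + k * (∫⁻ x, H x ∂μ) ^ β := by
  refine (lintegral_mono hFH).trans ?_
  rw [lintegral_add_left measurable_const, lintegral_const, measure_univ, mul_one,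
    lintegral_const_mul _ (hH.pow_const _)]
  gcongr
  exact lintegral_rpow_le_rpow μ hH hβ0 hβ1

/-- Adaptive composition of the oracle calls, while the threshold algorithm is left unchanged. -/
theorem Adversary.lintegral_law_le_rpow (hSV : SV.IsValid) (h𝒜 : 𝒜.IsValid Δ)
    {post' : ∀ j, 𝒜.Ext j × (Bool ⊕ Unit) → Measure (𝒜.Mem (j + 1))}
    (hp : 𝒜.IsUpdate post) (hp' : 𝒜.IsUpdate post') (D : Fin n → X) {ε : ℝ} (hε : 0 < ε)
    {δ : ℝ≥0∞} {α : ℝ} (hα : 1 < α) {T : ℕ}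
    (heq : ∀ j z a, a ≠ Sum.inl true → post j (z, a) = post' j (z, a))
    (hle : ∀ j z A, MeasurableSet A → post j (z, Sum.inl true) A ≤
      ENNReal.ofReal (Real.exp ε) * post' j (z, Sum.inl true) A + δ)
    (hge : ∀ j z A, MeasurableSet A → post' j (z, Sum.inl true) A ≤
      ENNReal.ofReal (Real.exp ε) * post j (z, Sum.inl true) A + δ) (j : ℕ)
    {f g : (Fin j → Bool ⊕ Unit) × 𝒜.Mem j × SV.State → ℝ≥0∞} (hf : Measurable f)
    (hg : Measurable g) (hf1 : ∀ ω, f ω ≤ 1)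
    (hf0 : ∀ ω, T < topCount ω.1 → f ω = 0)
    (hfg : ∀ ω, topCount ω.1 ≤ T → f ω ≤ (T - topCount ω.1 : ℕ) * δ +
      ENNReal.ofReal (stepFactor α ε) ^ (T - topCount ω.1) * g ω ^ (1 - 1 / α)) :
    ∫⁻ ω, f ω ∂(𝒜.law SV post D j) ≤ T * δ +
      ENNReal.ofReal (stepFactor α ε) ^ T *
        (∫⁻ ω, g ω ∂(𝒜.law SV post' D j)) ^ (1 - 1 / α) := by
  have α0 : 0 < α := by linarith
  have hβ1 : 1 - 1 / α < 1 := by have : 0 < 1 / α := by positivity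
                                 linarith
  have hβ0 : 0 < 1 - 1 / α := by have : 1 / α < 1 := (div_lt_one α0).2 hα
                                 linarith
  induction j with
  | zero =>
    have := hSV.init_prob D
    simp only [Adversary.law]
    rw [lintegral_map hf (by fun_prop), lintegral_map hg (by fun_prop)]
    refine lintegral_le_of_le_rpow _ hβ0 hβ1 (hg.comp (by fun_prop)) fun s => ?_
    have := hfg (Fin.elim0, 𝒜.start, s) (by simp [topCount])
    simpa [topCount] using this
  | succ j ih =>
    rw [lintegral_law_succ hSV h𝒜 hp D j hf, lintegral_law_succ hSV h𝒜 hp' D j hg]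
    have h1 := h𝒜.draw_prob j
    have h2 := hSV.isProbabilityMeasure_round D
    have h3 := hp.prob j
    have h3' := hp'.prob j
    have hpf := fun b => measurable_lintegral_post (SV := SV) hp hf b
    have hpg := fun b => measurable_lintegral_post (SV := SV) hp' hg b
    refine ih (measurable_lintegral_step hSV h𝒜 hp D j hf)
      (measurable_lintegral_step hSV h𝒜 hp' D j hg) (fun ω => ?_) (fun ω hω => ?_) fun ω hω => ?_
    · have := isProbabilityMeasure_step hSV h𝒜 hp D j ω
      exact lintegral_le_one hf1
    · rw [lintegral_step hSV h𝒜 hp D j ω hf]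
      have : ∀ z r y, f (Fin.snoc (α := fun _ => Bool ⊕ Unit) ω.1 r, y, z) = 0 := fun z r y =>
        hf0 _ (by rw [topCount_snoc]; omega)
      simp [this]
    · rw [lintegral_step hSV h𝒜 hp D j ω hf, lintegral_step hSV h𝒜 hp' D j ω hg]
      have hmr : Measurable fun z => ∫⁻ r, ∫⁻ y,
          g (Fin.snoc (α := fun _ => Bool ⊕ Unit) ω.1 r.1, y, r.2)
          ∂(post' j (z, r.1)) ∂(SV.round D ω.2.2 (𝒜.query j z)) :=
        measurable_lintegral_param (κ := fun z => SV.round D ω.2.2 (𝒜.query j z))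
          ((hSV.measurable_round D).comp (measurable_const.prodMk (h𝒜.query_meas j)))
          (F := fun z r => ∫⁻ y, g (Fin.snoc (α := fun _ => Bool ⊕ Unit) ω.1 r.1, y, r.2)
            ∂(post' j (z, r.1))) (hpg ω.1)
      refine lintegral_le_of_le_rpow _ hβ0 hβ1 hmr fun z => ?_
      refine lintegral_le_of_le_rpow _ hβ0 hβ1 ((hpg ω.1).comp (measurable_prodMk_left (x := z))) fun r => ?_
      have hgy : Measurable fun y => g (Fin.snoc (α := fun _ => Bool ⊕ Unit) ω.1 r.1, y, r.2) :=
        hg.comp (by fun_prop)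
      by_cases ha : r.1 = Sum.inl true
      · have hN : topCount (Fin.snoc (α := fun _ => Bool ⊕ Unit) ω.1 r.1) = topCount ω.1 + 1 := by
          rw [topCount_snoc, if_pos ha]
        by_cases hT : topCount ω.1 + 1 ≤ T
        -- The only case in which the two oracles differ: one unit of the remaining budget pays for
        -- `δ` and one step factor.
        · rw [ha] at hgy hN ⊢
          refine (lintegral_le_of_indist hε (hle j z) (hge j z) hα (fun y => hf1 _) hgy
            (c := (T - (topCount ω.1 + 1) : ℕ) * δ)
            (k := ENNReal.ofReal (stepFactor α ε) ^ (T - (topCount ω.1 + 1)))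
            fun y => ?_).trans (le_of_eq ?_)
          · have := hfg (Fin.snoc (α := fun _ => Bool ⊕ Unit) ω.1 (Sum.inl true), y, r.2)
              (by rw [hN]; exact hT)
            rwa [hN] at this
          have e : T - topCount ω.1 = (T - (topCount ω.1 + 1)) + 1 := by omega
          rw [e]
          push_cast
          ring
        -- The budget is exhausted, and the test function ignores such histories.
        · have : ∀ y, f (Fin.snoc (α := fun _ => Bool ⊕ Unit) ω.1 r.1, y, r.2) = 0 := fun y =>
            hf0 _ (by rw [hN]; omega)
          simp [this]
      · have hN : topCount (Fin.snoc (α := fun _ => Bool ⊕ Unit) ω.1 r.1) = topCount ω.1 := by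
          rw [topCount_snoc, if_neg ha, add_zero]
        rw [heq j z r.1 ha]
        refine lintegral_le_of_le_rpow _ hβ0 hβ1 hgy fun y => ?_
        have := hfg (Fin.snoc (α := fun _ => Bool ⊕ Unit) ω.1 r.1, y, r.2)
          (by rw [hN]; exact hω)
        rwa [hN] at this

end Game

theorem bind_map' {α β γ : Type*} [MeasurableSpace α] [MeasurableSpace β] [MeasurableSpace γ]
    {μ : Measure α} {f : α → β} {F : β → Measure γ} (hf : Measurable f) (hF : Measurable F) :
    (μ.map f).bind F = μ.bind fun x => F (f x) := by
  rw [Measure.bind, Measure.bind, Measure.map_map hF hf]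
  rfl

theorem map_bind' {α β γ : Type*} [MeasurableSpace α] [MeasurableSpace β] [MeasurableSpace γ]
    {μ : Measure α} {F : α → Measure β} {f : β → γ} (hF : Measurable F) (hf : Measurable f) :
    (μ.bind F).map f = μ.bind fun x => (F x).map f := by
  ext s hs
  rw [Measure.map_apply hf hs, Measure.bind_apply (hf hs) hF.aemeasurable,
    Measure.bind_apply (f := fun x => (F x).map f) hs
      ((Measure.measurable_map f hf).comp hF).aemeasurable]
  exact lintegral_congr fun x => (Measure.map_apply hf hs).symm

/-! ### Directional derivatives of convex losses -/

section Convex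

open Filter Topology

variable {d : ℕ} {Θ : Set (EuclideanSpace ℝ (Fin d))}

/-- The point `θ + (θ' - θ) / (m + 1)` of the segment. -/
def segmentPoint (m : ℕ) (θ θ' : EuclideanSpace ℝ (Fin d)) : EuclideanSpace ℝ (Fin d) :=
  θ + (1 / ((m : ℝ) + 1)) • (θ' - θ)

theorem segmentPoint_mem (hΘ : Convex ℝ Θ) (m : ℕ) {θ θ' : EuclideanSpace ℝ (Fin d)} (h : θ ∈ Θ)
    (h' : θ' ∈ Θ) : segmentPoint m θ θ' ∈ Θ :=
  hΘ.add_smul_sub_mem h h' ⟨by positivity, by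
    rw [div_le_one (by positivity)]; linarith [(Nat.cast_nonneg m : (0 : ℝ) ≤ m)]⟩

/-- If `Θ` has empty interior the gradient within `Θ` need not be unique, but its pairing with a
direction pointing into `Θ` is a limit of difference quotients along the segment. Both the
first-order inequality of convexity and measurability of the update rest on this. -/
theorem tendsto_inner_gradientWithin (hΘ : Convex ℝ Θ) {g : EuclideanSpace ℝ (Fin d) → ℝ}
    (hg : DifferentiableOn ℝ g Θ) {θ θ' : EuclideanSpace ℝ (Fin d)} (h : θ ∈ Θ) (h' : θ' ∈ Θ) :
    Tendsto (fun m : ℕ => ((m : ℝ) + 1) * (g (segmentPoint m θ θ') - g θ)) atTop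
      (𝓝 (inner ℝ (θ' - θ) (gradientWithin g Θ θ))) := by
  have hlim := (hg θ h).hasFDerivWithinAt.lim (α := ℕ) (l := atTop) (c := fun m => (m : ℝ) + 1)
    (d := fun m => (1 / ((m : ℝ) + 1)) • (θ' - θ)) (v := θ' - θ)
    (by simpa using (tendsto_one_div_add_atTop_nhds_zero_nat (𝕜 := ℝ)).smul_const (θ' - θ))
    (.of_forall fun m => segmentPoint_mem hΘ m h h')
    (by
      refine Tendsto.congr (fun m => ?_) tendsto_const_nhds
      rw [smul_smul, mul_one_div_cancel (by positivity), one_smul])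
  have e : fderivWithin ℝ g Θ θ (θ' - θ) = inner ℝ (θ' - θ) (gradientWithin g Θ θ) := by
    rw [real_inner_comm, gradientWithin, InnerProductSpace.toDual_symm_apply]
  rw [← e]
  exact hlim

theorem sub_le_inner_gradientWithin {g : EuclideanSpace ℝ (Fin d) → ℝ}
    (hc : ConvexOn ℝ Θ g) (hg : DifferentiableOn ℝ g Θ) {θ θ' : EuclideanSpace ℝ (Fin d)}
    (h : θ ∈ Θ) (h' : θ' ∈ Θ) : g θ - g θ' ≤ inner ℝ (θ - θ') (gradientWithin g Θ θ) := by
  have key : inner ℝ (θ' - θ) (gradientWithin g Θ θ) ≤ g θ' - g θ := by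
    refine le_of_tendsto (tendsto_inner_gradientWithin hc.1 hg h h') (.of_forall fun m => ?_)
    have hm : (0 : ℝ) < (m : ℝ) + 1 := by positivity
    have hm1 : 1 / ((m : ℝ) + 1) ≤ 1 := by
      rw [div_le_one hm]; linarith [(Nat.cast_nonneg m : (0 : ℝ) ≤ m)]
    have := hc.2 h h' (by linarith : 0 ≤ 1 - 1 / ((m : ℝ) + 1))
      (by positivity : 0 ≤ 1 / ((m : ℝ) + 1)) (by ring)
    have e : (1 - 1 / ((m : ℝ) + 1)) • θ + (1 / ((m : ℝ) + 1)) • θ' = segmentPoint m θ θ' := by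
      rw [segmentPoint]; module
    rw [e, smul_eq_mul, smul_eq_mul] at this
    calc ((m : ℝ) + 1) * (g (segmentPoint m θ θ') - g θ)
        ≤ ((m : ℝ) + 1) * (1 / ((m : ℝ) + 1) * (g θ' - g θ)) := by
          gcongr; linarith
      _ = g θ' - g θ := by field_simp
  have e : inner ℝ (θ - θ') (gradientWithin g Θ θ) =
      - inner ℝ (θ' - θ) (gradientWithin g Θ θ) := by
    rw [← inner_neg_left, neg_sub]
  rw [e]; linarith

end Convex

/-! ### Histograms and the sensitivity of the error -/

section Hist

variable {X : Type u} [Fintype X] {d : ℕ} {ι : Type v} {Θ : Set (EuclideanSpace ℝ (Fin d))}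
  {loss : ι → X → EuclideanSpace ℝ (Fin d) → ℝ} {amin : ι → (X → ℝ) → Θ}

theorem IsArgmin.err_eq (h : IsArgmin Θ loss amin) (i : ι) {p : X → ℝ} (hp : p ∈ stdSimplex ℝ X)
    (θ : EuclideanSpace ℝ (Fin d)) :
    err Θ (loss i) p θ = avgLoss (loss i) p θ - avgLoss (loss i) p (amin i p) := by
  have : Nonempty Θ := ⟨amin i p⟩
  rw [err]
  congr 1
  refine le_antisymm (ciInf_le ⟨avgLoss (loss i) p (amin i p), ?_⟩ (amin i p))
    (le_ciInf fun θ' => h i p hp θ')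
  rintro _ ⟨θ', rfl⟩
  exact h i p hp θ'

variable [DecidableEq X] {n : ℕ}

theorem sum_hist_mul (D : Fin n → X) (r : X → ℝ) :
    ∑ x, hist D x * r x = (∑ i, r (D i)) / n := by
  have h : ∀ x, hist D x * r x = (∑ i, if D i = x then r x else 0) / n := fun x => by
    rw [hist, ← Finset.sum_filter, Finset.sum_const, nsmul_eq_mul]; ring
  simp_rw [h]
  rw [← Finset.sum_div, Finset.sum_comm]
  simp

theorem hist_mem_stdSimplex (hn : 0 < n) (D : Fin n → X) : hist D ∈ stdSimplex ℝ X := by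
  refine ⟨fun x => by unfold hist; positivity, ?_⟩
  have := sum_hist_mul D fun _ => 1
  simp only [mul_one, Finset.sum_const, Finset.card_univ, Fintype.card_fin, nsmul_eq_mul] at this
  rw [this, div_self (by positivity)]

/-- With `θ₁` the minimizer for `D`, the error on `D` is the average of `ℓ(θ; x) - ℓ(θ₁; x)`, and
the error on `D'` is at least its average there. Convexity and the scale condition bound this
difference by `S`, and only one row changes, so the change is in fact at most `2S/n`. -/
theorem isSensitive_err (hn : 0 < n) (hconv : ∀ i x, ConvexOn ℝ Θ (loss i x))
    (hdiff : ∀ i x, DifferentiableOn ℝ (loss i x) Θ) (hamin : IsArgmin Θ loss amin) {S : ℝ}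
    (hS : 0 < S) (hscale : ∀ i x, ∀ θ ∈ Θ, ∀ θ' ∈ Θ,
      |inner ℝ (θ - θ') (gradientWithin (loss i x) Θ θ)| ≤ S) (i : ι) {θ} (hθ : θ ∈ Θ) :
    IsSensitive (3 * S / n) fun D : Fin n → X => err Θ (loss i) (hist D) θ := by
  have hn' : (0 : ℝ) < n := by exact_mod_cast hn
  have one : ∀ D D' : Fin n → X, Adjacent D D' →
      err Θ (loss i) (hist D) θ - err Θ (loss i) (hist D') θ ≤ 3 * S / n := by
    rintro D D' ⟨i₀, hi⟩
    rw [hamin.err_eq i (hist_mem_stdSimplex hn D), hamin.err_eq i (hist_mem_stdSimplex hn D')]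
    set θ₁ := amin i (hist D)
    have h1 := hamin i _ (hist_mem_stdSimplex hn D') θ₁
    set r : X → ℝ := fun x => loss i x θ - loss i x θ₁ with hr
    have hrS : ∀ x, |r x| ≤ S := fun x => by
      have a1 := sub_le_inner_gradientWithin (hconv i x) (hdiff i x) hθ θ₁.2
      have a2 := sub_le_inner_gradientWithin (hconv i x) (hdiff i x) θ₁.2 hθ
      have a3 := (abs_le.1 (hscale i x θ hθ θ₁ θ₁.2)).2
      have a4 := (abs_le.1 (hscale i x θ₁ θ₁.2 θ hθ)).2
      rw [abs_le]; constructor <;> simp only [hr] <;> linarith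
    have hav : ∀ E : Fin n → X, avgLoss (loss i) (hist E) θ - avgLoss (loss i) (hist E) θ₁ =
        (∑ j, r (E j)) / n := fun E => by
      rw [← sum_hist_mul, avgLoss, avgLoss, ← Finset.sum_sub_distrib]
      exact Finset.sum_congr rfl fun x _ => by simp only [hr]; ring
    have hdif : ∑ j, r (D j) - ∑ j, r (D' j) = r (D i₀) - r (D' i₀) := by
      rw [← Finset.sum_sub_distrib, Finset.sum_eq_single i₀]
      · intro j _ hj; rw [hi j hj, sub_self]
      · simp
    calc _ ≤ (avgLoss (loss i) (hist D) θ - avgLoss (loss i) (hist D) θ₁) -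
          (avgLoss (loss i) (hist D') θ - avgLoss (loss i) (hist D') θ₁) := by linarith
      _ = (r (D i₀) - r (D' i₀)) / n := by rw [hav, hav, ← sub_div, hdif]
      _ ≤ 3 * S / n := by
        gcongr
        have b1 := (abs_le.1 (hrS (D i₀))).2
        have b2 := (abs_le.1 (hrS (D' i₀))).1
        linarith
  intro D D' h
  have h' : Adjacent D' D := by
    obtain ⟨i, hi⟩ := h
    exact ⟨i, fun j hj => (hi j hj).symm⟩
  rw [abs_le]
  exact ⟨by linarith [one D' D h'], one D D' h⟩

end Hist

/-! ### Measurability of the algorithm -/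

section Meas

variable {X : Type u} {d : ℕ} {ι : Type v}
  [MeasurableSpace ι] {Θ : Set (EuclideanSpace ℝ (Fin d))}
  {loss : ι → X → EuclideanSpace ℝ (Fin d) → ℝ}

/-- A Carathéodory function: continuous in the point, measurable in the index. -/
theorem measurable_loss (hdiff : ∀ i x, DifferentiableOn ℝ (loss i x) Θ)
    (hmeas : ∀ x, ∀ θ ∈ Θ, Measurable fun i => loss i x θ) (x : X) :
    Measurable fun z : ι × Θ => loss z.1 x z.2 := by
  have h : Measurable (Function.uncurry fun (θ : Θ) (i : ι) => loss i x θ) :=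
    measurable_uncurry_of_continuous_of_measurable
      (fun i => continuousOn_iff_continuous_domRestrict.1 (hdiff i x).continuousOn)
      fun θ => hmeas x θ θ.2
  exact h.comp measurable_swap

/-- A pointwise limit of measurable difference quotients; measurability of the gradient itself is
never needed. -/
theorem measurable_updateDir (hΘ : Convex ℝ Θ) (hdiff : ∀ i x, DifferentiableOn ℝ (loss i x) Θ)
    (hmeas : ∀ x, ∀ θ ∈ Θ, Measurable fun i => loss i x θ) (x : X) :
    Measurable fun z : ι × Θ × Θ => updateDir Θ (loss z.1) z.2.1 z.2.2 x := by
  have hl := measurable_loss hdiff hmeas x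
  refine measurable_of_tendsto_metrizable (f := fun (m : ℕ) (z : ι × Θ × Θ) =>
    ((m : ℝ) + 1) * (loss z.1 x (segmentPoint m z.2.2 z.2.1) - loss z.1 x z.2.2)) (fun m => ?_)
    (tendsto_pi_nhds.2 fun z => tendsto_inner_gradientWithin hΘ (hdiff z.1 x) z.2.2.2 z.2.1.2)
  have h1 : Measurable fun z : ι × Θ × Θ => loss z.1 x (segmentPoint m z.2.2 z.2.1) := by
    have hs : Measurable fun z : ι × Θ × Θ =>
        (⟨segmentPoint m z.2.2 z.2.1, segmentPoint_mem hΘ m z.2.2.2 z.2.1.2⟩ : Θ) := by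
      refine Measurable.subtype_mk ?_
      unfold segmentPoint
      fun_prop
    exact hl.comp (measurable_fst.prodMk hs)
  have h2 : Measurable fun z : ι × Θ × Θ => loss z.1 x z.2.2 :=
    hl.comp (measurable_fst.prodMk (measurable_snd.comp measurable_snd))
  exact (h1.sub h2).const_mul _

theorem measurable_mwUpdate [Fintype X] (η : ℝ) :
    Measurable fun z : (X → ℝ) × (X → ℝ) => mwUpdate η z.1 z.2 := by
  unfold mwUpdate
  fun_prop

variable {amin : ι → (X → ℝ) → Θ}

theorem measurable_err [Fintype X] [DecidableEq X] {n : ℕ} (hn : 0 < n)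
    (hdiff : ∀ i x, DifferentiableOn ℝ (loss i x) Θ)
    (hmeas : ∀ x, ∀ θ ∈ Θ, Measurable fun i => loss i x θ) (hamin : IsArgmin Θ loss amin)
    (hamin_meas : Measurable (Function.uncurry amin)) :
    Measurable fun z : ι × (X → ℝ) => fun D : Fin n → X =>
      err Θ (loss z.1) (hist D) (amin z.1 z.2) := by
  refine measurable_pi_iff.2 fun D => ?_
  simp_rw [hamin.err_eq _ (hist_mem_stdSimplex hn D), avgLoss]
  refine Measurable.sub ?_ ?_
  · refine Finset.measurable_fun_sum _ fun x _ => Measurable.const_mul ?_ _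
    exact (measurable_loss hdiff hmeas x).comp (measurable_fst.prodMk hamin_meas)
  · refine Finset.measurable_fun_sum _ fun x _ => Measurable.const_mul ?_ _
    exact (measurable_loss hdiff hmeas x).comp (measurable_fst.prodMk
      (hamin_meas.comp (measurable_fst.prodMk measurable_const)))

end Meas

/-! ### The online algorithm as an interaction -/

section Interaction

variable {X : Type u} [Fintype X] {d : ℕ} {ι : Type v}
  [MeasurableSpace ι] (Θ : Set (EuclideanSpace ℝ (Fin d)))
  (loss : ι → X → EuclideanSpace ℝ (Fin d) → ℝ) (amin : ι → (X → ℝ) → Θ)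

/-- The next view and histogram when the threshold algorithm answers `⊤` and the oracle `θ`. -/
def pmwTop (η : ℝ) (j : ℕ) (z : ((Fin j → ι × (Θ ⊕ Unit)) × (X → ℝ)) × ι) (θ : Θ) :
    (Fin (j + 1) → ι × (Θ ⊕ Unit)) × (X → ℝ) :=
  (Fin.snoc (α := fun _ => ι × (Θ ⊕ Unit)) z.1.1 (z.2, Sum.inl θ),
    mwUpdate η (updateDir Θ (loss z.2) θ (amin z.2 z.1.2)) z.1.2)

variable {Θ loss amin}

theorem measurable_pmwTop (hΘ : Convex ℝ Θ) (hdiff : ∀ i x, DifferentiableOn ℝ (loss i x) Θ)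
    (hmeas : ∀ x, ∀ θ ∈ Θ, Measurable fun i => loss i x θ)
    (hamin_meas : Measurable (Function.uncurry amin)) (η : ℝ) (j : ℕ) :
    Measurable (Function.uncurry (pmwTop Θ loss amin η j)) := by
  refine Measurable.prodMk ?_ ?_
  · exact (measurable_snoc j).comp (by fun_prop : Measurable
      fun z : (((Fin j → ι × (Θ ⊕ Unit)) × (X → ℝ)) × ι) × Θ =>
        (z.1.1.1, (z.1.2, (Sum.inl z.2 : Θ ⊕ Unit))))
  · have h1 : Measurable fun z : (((Fin j → ι × (Θ ⊕ Unit)) × (X → ℝ)) × ι) × Θ =>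
        amin z.1.2 z.1.1.2 := hamin_meas.comp (by fun_prop : Measurable
          fun z : (((Fin j → ι × (Θ ⊕ Unit)) × (X → ℝ)) × ι) × Θ => (z.1.2, z.1.1.2))
    have h2 : Measurable fun z : (((Fin j → ι × (Θ ⊕ Unit)) × (X → ℝ)) × ι) × Θ =>
        (z.1.2, z.2, amin z.1.2 z.1.1.2) := by fun_prop
    have h3 : Measurable fun z : (((Fin j → ι × (Θ ⊕ Unit)) × (X → ℝ)) × ι) × Θ =>
        updateDir Θ (loss z.1.2) z.2 (amin z.1.2 z.1.1.2) :=
      measurable_pi_iff.2 fun x => by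
        have h5 := (measurable_updateDir (loss := loss) hΘ hdiff hmeas x).comp h2
        exact h5
    have h4 : Measurable fun z : (((Fin j → ι × (Θ ⊕ Unit)) × (X → ℝ)) × ι) × Θ =>
        (updateDir Θ (loss z.1.2) z.2 (amin z.1.2 z.1.1.2), z.1.1.2) := by fun_prop
    exact (measurable_mwUpdate η).comp h4

variable [DecidableEq X] {n : ℕ}

variable (Θ loss amin) (analyst : (j : ℕ) → Kernel (Fin j → ι × (Θ ⊕ Unit)) ι)

/-- The online algorithm together with the analyst, as an adversary of the threshold algorithm. Its
memory consists of the analyst's view and of the current histogram. -/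
abbrev pmwAdversary (n : ℕ) : Adversary.{u, max u v} n X where
  Mem j := (Fin j → ι × (Θ ⊕ Unit)) × (X → ℝ)
  Ext j := ((Fin j → ι × (Θ ⊕ Unit)) × (X → ℝ)) × ι
  mMem _ := inferInstance
  mExt _ := inferInstance
  start := (Fin.elim0, fun _ => 1 / (Fintype.card X : ℝ))
  draw j y := (analyst j y.1).map fun i => (y, i)
  query _ z := fun D' => err Θ (loss z.2) (hist D') (amin z.2 z.1.2)

/-- The update of the view and of the histogram. -/
def pmwPost (oracle : (Fin n → X) → Kernel ι Θ) (η : ℝ) (D : Fin n → X) (j : ℕ)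
    (x : (((Fin j → ι × (Θ ⊕ Unit)) × (X → ℝ)) × ι) × (Bool ⊕ Unit)) :
    Measure ((Fin (j + 1) → ι × (Θ ⊕ Unit)) × (X → ℝ)) :=
  match x.2 with
  | Sum.inr _ => Measure.dirac
      (Fin.snoc (α := fun _ => ι × (Θ ⊕ Unit)) x.1.1.1 (x.1.2, Sum.inr ()), x.1.1.2)
  | Sum.inl false => Measure.dirac
      (Fin.snoc (α := fun _ => ι × (Θ ⊕ Unit)) x.1.1.1 (x.1.2, Sum.inl (amin x.1.2 x.1.1.2)),
        x.1.1.2)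
  | Sum.inl true => (oracle D x.1.2).map (pmwTop Θ loss amin η j x.1)

variable {Θ loss amin analyst}

theorem pmwAdversary_isValid (hn : 0 < n) (hconv : ∀ i x, ConvexOn ℝ Θ (loss i x))
    (hdiff : ∀ i x, DifferentiableOn ℝ (loss i x) Θ)
    (hmeas : ∀ x, ∀ θ ∈ Θ, Measurable fun i => loss i x θ) (hamin : IsArgmin Θ loss amin)
    (hamin_meas : Measurable (Function.uncurry amin)) {S : ℝ}
    (hS : 0 < S) (hscale : ∀ i x, ∀ θ ∈ Θ, ∀ θ' ∈ Θ,
      |inner ℝ (θ - θ') (gradientWithin (loss i x) Θ θ)| ≤ S)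
    (hanalyst : ∀ j, IsMarkovKernel (analyst j)) :
    (pmwAdversary Θ loss amin analyst n).IsValid (3 * S / n) where
  draw_prob j y := Measure.isProbabilityMeasure_map (by fun_prop)
  draw_meas j := measurable_map_param (κ := fun y : (Fin j → ι × (Θ ⊕ Unit)) × (X → ℝ) =>
    analyst j y.1) ((analyst j).measurable.comp measurable_fst) (F := fun y i => (y, i))
    (by fun_prop)
  query_meas j := (measurable_err hn hdiff hmeas hamin hamin_meas).comp
    (by fun_prop : Measurable fun z : ((Fin j → ι × (Θ ⊕ Unit)) × (X → ℝ)) × ι => (z.2, z.1.2))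
  query_sens j z := isSensitive_err hn hconv hdiff hamin hS hscale z.2 (amin z.2 z.1.2).2

theorem pmwPost_isUpdate (hΘ : Convex ℝ Θ) (hdiff : ∀ i x, DifferentiableOn ℝ (loss i x) Θ)
    (hmeas : ∀ x, ∀ θ ∈ Θ, Measurable fun i => loss i x θ)
    (hamin_meas : Measurable (Function.uncurry amin)) (η : ℝ)
    {oracle : (Fin n → X) → Kernel ι Θ} (D : Fin n → X)
    (ho : ∀ i, IsProbabilityMeasure (oracle D i)) :
    (pmwAdversary Θ loss amin analyst n).IsUpdate (pmwPost Θ loss amin oracle η D) where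
  prob j x := by
    unfold pmwPost
    rcases x with ⟨z, (_ | _) | _⟩
    · infer_instance
    · exact Measure.isProbabilityMeasure_map ((measurable_pmwTop hΘ hdiff hmeas hamin_meas η
        j).comp (measurable_prodMk_left (x := z))).aemeasurable
    · infer_instance
  meas j := by
    refine measurable_from_prod_countable_left fun a => ?_
    rcases a with (_ | _) | _
    · refine Measure.measurable_dirac.comp (Measurable.prodMk ?_ (by fun_prop))
      refine (measurable_snoc j).comp (Measurable.prodMk (by fun_prop) (Measurable.prodMk
        (by fun_prop) (measurable_inl.comp (hamin_meas.comp (by fun_prop : Measurable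
          fun z : ((Fin j → ι × (Θ ⊕ Unit)) × (X → ℝ)) × ι => (z.2, z.1.2))))))
    · exact measurable_map_param (κ := fun z : ((Fin j → ι × (Θ ⊕ Unit)) × (X → ℝ)) × ι =>
        oracle D z.2) ((oracle D).measurable.comp measurable_snd)
        (measurable_pmwTop hΘ hdiff hmeas hamin_meas η j)
    · refine Measure.measurable_dirac.comp (Measurable.prodMk ?_ (by fun_prop))
      exact (measurable_snoc j).comp (Measurable.prodMk (by fun_prop) (by fun_prop))

variable {SV : SVAlg.{u, w} n X}

/-- The interaction also records the bits of the threshold algorithm, which the view hides but which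
count the oracle calls. Forgetting them gives back the run. -/
theorem run_eq_map_law (hSV : SV.IsValid) {Δ η : ℝ}
    (h𝒜 : (pmwAdversary Θ loss amin analyst n).IsValid Δ)
    (hΘ : Convex ℝ Θ) (hdiff : ∀ i x, DifferentiableOn ℝ (loss i x) Θ)
    (hmeas : ∀ x, ∀ θ ∈ Θ, Measurable fun i => loss i x θ)
    (hamin_meas : Measurable (Function.uncurry amin))
    {oracle : (Fin n → X) → Kernel ι Θ} (D : Fin n → X)
    (ho : ∀ i, IsProbabilityMeasure (oracle D i))
    (j : ℕ) :
    run Θ loss amin oracle SV η analyst D j =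
      ((pmwAdversary Θ loss amin analyst n).law SV (pmwPost Θ loss amin oracle η D) D j).map
        fun ω => (ω.2.1.1, ω.2.2, ω.2.1.2) := by
  have hp : (pmwAdversary Θ loss amin analyst n).IsUpdate (pmwPost Θ loss amin oracle η D) :=
    pmwPost_isUpdate hΘ hdiff hmeas hamin_meas η D ho
  induction j with
  | zero =>
    simp only [run, Adversary.law]
    rw [Measure.map_map (by fun_prop) (by fun_prop)]
    rfl
  | succ j ih =>
    set R : (Fin j → ι × (Θ ⊕ Unit)) × SV.State × (X → ℝ) →
        Measure ((Fin (j + 1) → ι × (Θ ⊕ Unit)) × SV.State × (X → ℝ)) := fun ω =>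
      (analyst j ω.1).bind fun i =>
        (round Θ loss amin oracle SV η D i ω.2.1 ω.2.2).map fun z =>
          (Fin.snoc (α := fun _ => ι × (Θ ⊕ Unit)) ω.1 (i, z.1), z.2) with hR
    have key : ∀ ω : (Fin j → Bool ⊕ Unit) × ((Fin j → ι × (Θ ⊕ Unit)) × (X → ℝ)) × SV.State,
        R (ω.2.1.1, ω.2.2, ω.2.1.2) = ((pmwAdversary Θ loss amin analyst n).step SV
          (pmwPost Θ loss amin oracle η D) D j ω).map fun ω => (ω.2.1.1, ω.2.2, ω.2.1.2) := by
      rintro ⟨b, ⟨v, p⟩, s⟩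
      have hsb := (Adversary.measurable_step_bind hSV h𝒜 hp D j).comp
        (measurable_prodMk_left (x := (b, (v, p), s)))
      have e1 : (pmwAdversary Θ loss amin analyst n).step SV
          (pmwPost Θ loss amin oracle η D) D j (b, (v, p), s) = _ :=
        bind_map' (μ := analyst j v) (f := fun i => ((v, p), i)) (by fun_prop) hsb
      have hpr : Measurable fun ω : (Fin (j + 1) → Bool ⊕ Unit) ×
          ((Fin (j + 1) → ι × (Θ ⊕ Unit)) × (X → ℝ)) × SV.State =>
          (ω.2.1.1, ω.2.2, ω.2.1.2) := by fun_prop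
      rw [e1]
      refine Eq.trans ?_ (map_bind' (μ := analyst j v) (hsb.comp (by fun_prop :
        Measurable fun i : ι => ((v, p), i))) hpr).symm
      rw [hR]
      dsimp only
      congr 1
      funext i
      have hsm := (Adversary.measurable_step_map (SV := SV) hp j).comp
        (measurable_prodMk_left (x := ((b, (v, p), s), ((v, p), i))))
      refine Eq.trans ?_ (map_bind' (μ := SV.round D s fun D' =>
        err Θ (loss i) (hist D') (amin i p)) hsm (by fun_prop)).symm
      have hg : Measurable fun z : (Θ ⊕ Unit) × SV.State × (X → ℝ) =>
          (Fin.snoc (α := fun _ => ι × (Θ ⊕ Unit)) v (i, z.1), z.2) :=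
        ((measurable_snoc j).comp (by fun_prop : Measurable
          fun z : (Θ ⊕ Unit) × SV.State × (X → ℝ) => (v, (i, z.1)))).prodMk measurable_snd
      have hu : Measurable fun θ : Θ => mwUpdate η (updateDir Θ (loss i) θ (amin i p)) p :=
        measurable_snd.comp ((measurable_pmwTop hΘ hdiff hmeas hamin_meas η j).comp
          (measurable_prodMk_left (x := ((v, p), i))))
      have := ho i
      rw [round, map_bind' _ hg]
      · congr 1
        funext r
        rcases r with ⟨(_ | _) | _, s'⟩
        · dsimp only [Function.comp, Function.uncurry, pmwPost]
          rw [Measure.map_dirac' hg, Measure.map_dirac' (by fun_prop),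
            Measure.map_dirac' (by fun_prop)]
        · have hT : Measurable (pmwTop Θ loss amin η j ((v, p), i)) :=
            (measurable_pmwTop hΘ hdiff hmeas hamin_meas η j).comp measurable_prodMk_left
          dsimp only [Function.comp, Function.uncurry, pmwPost]
          rw [Measure.map_map hg (by fun_prop), Measure.map_map (by fun_prop) hT,
            Measure.map_map (by fun_prop) (by fun_prop)]
          rfl
        · dsimp only [Function.comp, Function.uncurry, pmwPost]
          rw [Measure.map_dirac' hg, Measure.map_dirac' (by fun_prop),
            Measure.map_dirac' (by fun_prop)]
      · refine measurable_from_prod_countable_right fun a => ?_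
        rcases a with (_ | _) | _
        · exact Measure.measurable_dirac.comp (by fun_prop)
        · exact measurable_map_param (κ := fun _ : SV.State => oracle D i) measurable_const
            (F := fun s' θ => (Sum.inl θ, s', mwUpdate η (updateDir Θ (loss i) θ (amin i p)) p))
            ((measurable_inl.comp measurable_snd).prodMk
              (measurable_fst.prodMk (hu.comp measurable_snd)))
        · exact Measure.measurable_dirac.comp (by fun_prop)
    have hstep := (Measure.measurable_map (fun ω : (Fin (j + 1) → Bool ⊕ Unit) ×
      ((Fin (j + 1) → ι × (Θ ⊕ Unit)) × (X → ℝ)) × SV.State => (ω.2.1.1, ω.2.2, ω.2.1.2))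
      (by fun_prop)).comp (Adversary.measurable_step hSV h𝒜 hp D j)
    -- `R` does not see the recorded bits, so dummy bits exhibit it as a composition of measurable
    -- maps.
    have hRm : Measurable R := by
      have : R = fun ω => ((pmwAdversary Θ loss amin analyst n).step SV
          (pmwPost Θ loss amin oracle η D) D j
            (fun _ => Sum.inr (), (ω.1, ω.2.2), ω.2.1)).map
              fun ω => (ω.2.1.1, ω.2.2, ω.2.1.2) := by
        funext ω
        exact key (fun _ => Sum.inr (), (ω.1, ω.2.2), ω.2.1)
      rw [this]
      exact hstep.comp (by fun_prop : Measurable fun ω : (Fin j → ι × (Θ ⊕ Unit)) × SV.State ×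
        (X → ℝ) => ((fun _ => Sum.inr () : Fin j → Bool ⊕ Unit), (ω.1, ω.2.2), ω.2.1))
    have e : run Θ loss amin oracle SV η analyst D (j + 1) =
      (run Θ loss amin oracle SV η analyst D j).bind R := rfl
    rw [e, ih, bind_map' (by fun_prop) hRm]
    simp_rw [key]
    exact (map_bind' (Adversary.measurable_step hSV h𝒜 hp D j) (by fun_prop)).symm

end Interaction

/-! ### Degenerate cases, the choice of the order `α`, and privacy of the online algorithm. -/

theorem Adjacent.symm {X : Type u} {n : ℕ} {D D' : Fin n → X} (h : Adjacent D D') :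
    Adjacent D' D := by
  obtain ⟨i, hi⟩ := h
  exact ⟨i, fun j hj => (hi j hj).symm⟩

theorem isDP_of_one_le {X : Type u} {n : ℕ} {R : Type v} [MeasurableSpace R]
    {M : (Fin n → X) → Measure R} {ε δ : ℝ} (hM : ∀ D, IsProbabilityMeasure (M D)) (hδ : 1 ≤ δ) :
    IsDP M ε δ := by
  refine ⟨hM, fun D D' _ A _ => ?_⟩
  have := hM D
  calc M D A ≤ 1 := prob_le_one
    _ ≤ ENNReal.ofReal δ := by rwa [ENNReal.one_le_ofReal]
    _ ≤ _ := le_add_self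

theorem isDP_of_subsingleton {X : Type u} [Subsingleton X] {n : ℕ} {R : Type v}
    [MeasurableSpace R] {M : (Fin n → X) → Measure R} {ε δ : ℝ}
    (hM : ∀ D, IsProbabilityMeasure (M D)) (hε : 0 ≤ ε) : IsDP M ε δ := by
  refine ⟨hM, fun D D' _ A _ => ?_⟩
  rw [Subsingleton.elim D D']
  have h1 : 1 ≤ ENNReal.ofReal (Real.exp ε) := by
    rw [ENNReal.one_le_ofReal]; exact Real.one_le_exp hε
  calc M D' A = 1 * M D' A := (one_mul _).symm
    _ ≤ ENNReal.ofReal (Real.exp ε) * M D' A := by gcongr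
    _ ≤ _ := le_self_add

theorem numUpdates_pos {X : Type u} [Fintype X] [Nontrivial X] {S α : ℝ} (hS : 0 < S)
    (hα : 0 < α) : 0 < numUpdates X S α := by
  rw [numUpdates, Nat.ceil_pos]
  have : 0 < Real.log (Fintype.card X) :=
    Real.log_pos (by exact_mod_cast Fintype.one_lt_card)
  positivity

theorem exp_quarter_lt : Real.exp (1 / 4) < 1.285 := by
  have h : Real.exp (1 / 4) ^ 4 = Real.exp 1 := by rw [← Real.exp_nat_mul]; norm_num
  by_contra! hc
  have : (1.285 : ℝ) ^ 4 ≤ Real.exp (1 / 4) ^ 4 := by gcongr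
  rw [h] at this
  have := Real.exp_one_lt_d9
  norm_num at *
  linarith

theorem exp_half_lt : Real.exp (1 / 2) < 1.65 := by
  have h : Real.exp (1 / 2) ^ 2 = Real.exp 1 := by rw [← Real.exp_nat_mul]; norm_num
  by_contra! hc
  have : (1.65 : ℝ) ^ 2 ≤ Real.exp (1 / 2) ^ 2 := by gcongr
  rw [h] at this
  have := Real.exp_one_lt_d9
  norm_num at *
  linarith

/-- The failure probability of the oracle calls. -/
theorem oracle_failure_le {T : ℕ} (hT : 0 < T) {ε δ : ℝ} (hε : 0 < ε) (hε1 : ε ≤ 1) (hδ : 0 < δ)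
    (hδ1 : δ < 1) :
    ∃ α : ℝ, 2 ≤ α ∧ Real.exp (ε / 2) * (T * oracleDelta T δ + Real.exp ((α - 1 / 2) ^ 2 *
      (T * oracleEps T ε δ ^ 2) / 2 - (α - 1) * (ε / 2)) / (2 * α)) ≤ δ / 2 := by
  have hT' : (0 : ℝ) < T := by exact_mod_cast hT
  set L := Real.log (4 / δ) with hL
  have h4 : 4 < 4 / δ := by rw [lt_div_iff₀ hδ]; nlinarith
  have hL1 : 1 < L := by
    rw [hL, Real.lt_log_iff_exp_lt (by positivity)]
    have := Real.exp_one_lt_d9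
    norm_num at *
    linarith
  have hLe : 4 * L ≤ 4 * L / ε := by
    rw [le_div_iff₀ hε]; nlinarith
  -- The minimizer of the exponent in `α`: since `T ε₀² = ε² / (8L)`, it solves `(α - 1/2) T ε₀² = ε
  -- / 2`.
  refine ⟨4 * L / ε + 1 / 2, by linarith, ?_⟩
  have e1 : (T : ℝ) * oracleDelta T δ = δ / 4 := by
    rw [oracleDelta]; field_simp
  have e2 : (T : ℝ) * oracleEps T ε δ ^ 2 = ε ^ 2 / (8 * L) := by
    rw [oracleEps, div_pow, Real.sq_sqrt (by positivity), ← hL]; field_simp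
  have e3 : (4 * L / ε + 1 / 2 - 1 / 2) ^ 2 * (T * oracleEps T ε δ ^ 2) / 2 -
      (4 * L / ε + 1 / 2 - 1) * (ε / 2) = -L + ε / 4 := by
    rw [e2]; field_simp; ring
  have e4 : Real.exp (-L + ε / 4) = δ / 4 * Real.exp (ε / 4) := by
    rw [Real.exp_add, Real.exp_neg, hL, Real.exp_log (by positivity), inv_div]
  rw [e1, e3, e4]
  have b1 : Real.exp (ε / 4) ≤ 1.285 :=
    (Real.exp_le_exp.2 (by linarith)).trans exp_quarter_lt.le
  have b2 : Real.exp (ε / 2) ≤ 1.65 :=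
    (Real.exp_le_exp.2 (by linarith)).trans exp_half_lt.le
  have b3 : δ / 4 * Real.exp (ε / 4) / (2 * (4 * L / ε + 1 / 2)) ≤ δ / 4 * 1.285 / 8 := by
    gcongr
    linarith
  -- The tail alone would be about `δ / 4`; the gain `1 / (2 α) ≤ 1 / 8` makes room for the factor
  -- `e^(ε/2)`, the total being about `0.479 δ`.
  calc _ ≤ 1.65 * (δ / 4 + δ / 4 * 1.285 / 8) := by gcongr
    _ ≤ δ / 2 := by linarith

theorem stepFactor_ge_one {α ε : ℝ} (hα : 0 < α) : 1 ≤ ENNReal.ofReal (stepFactor α ε) := by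
  rw [ENNReal.one_le_ofReal, stepFactor]
  exact Real.one_le_exp (by positivity)

section Privacy

variable {X : Type u} [Fintype X] [DecidableEq X] {n d : ℕ} {ι : Type v}
  [MeasurableSpace ι] {Θ : Set (EuclideanSpace ℝ (Fin d))}
  {loss : ι → X → EuclideanSpace ℝ (Fin d) → ℝ} {amin : ι → (X → ℝ) → Θ}
  {analyst : (j : ℕ) → Kernel (Fin j → ι × (Θ ⊕ Unit)) ι} {SV : SVAlg.{u, w} n X}

theorem onlinePMW_apply (hSV : SV.IsValid) {Δ η : ℝ}
    (h𝒜 : (pmwAdversary Θ loss amin analyst n).IsValid Δ)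
    (hΘ : Convex ℝ Θ) (hdiff : ∀ i x, DifferentiableOn ℝ (loss i x) Θ)
    (hmeas : ∀ x, ∀ θ ∈ Θ, Measurable fun i => loss i x θ)
    (hamin_meas : Measurable (Function.uncurry amin))
    {oracle : (Fin n → X) → Kernel ι Θ} (D : Fin n → X)
    (ho : ∀ i, IsProbabilityMeasure (oracle D i)) (k : ℕ) :
    onlinePMW Θ loss amin oracle SV η analyst k D =
      ((pmwAdversary Θ loss amin analyst n).law SV (pmwPost Θ loss amin oracle η D) D k).map
        fun ω => ω.2.1.1 := by
  rw [onlinePMW, run_eq_map_law hSV h𝒜 hΘ hdiff hmeas hamin_meas D ho,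
    Measure.map_map (by fun_prop) (by fun_prop)]
  rfl

/-- Privacy of the online algorithm for every private threshold algorithm with a bounded number
of `⊤` answers. -/
theorem isDP_onlinePMW [Nonempty X] (hn : 0 < n) (hΘ : Convex ℝ Θ)
    (hconv : ∀ i x, ConvexOn ℝ Θ (loss i x))
    (hdiff : ∀ i x, DifferentiableOn ℝ (loss i x) Θ)
    (hmeas : ∀ x, ∀ θ ∈ Θ, Measurable fun i => loss i x θ)
    (hamin : IsArgmin Θ loss amin) (hamin_meas : Measurable (Function.uncurry amin))
    {S α ε δ : ℝ} (hS : 0 < S) (hα : 0 < α) (hε : 0 < ε) (hε1 : ε ≤ 1) (hδ : 0 < δ)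
    (hscale : ∀ i x, ∀ θ ∈ Θ, ∀ θ' ∈ Θ,
      |inner ℝ (θ - θ') (gradientWithin (loss i x) Θ θ)| ≤ S)
    {k T : ℕ} (hT : T = numUpdates X S α) {oracle : (Fin n → X) → Kernel ι Θ}
    (horacle : ∀ i, IsDP (fun D => oracle D i) (oracleEps T ε δ) (oracleDelta T δ))
    (hanalyst : ∀ j, IsMarkovKernel (analyst j)) (η : ℝ) (hSV : SV.IsValid)
    (hpriv : 1 < Fintype.card X → δ < 1 → SV.IsPrivate k (3 * S / n) (ε / 2) (δ / 2))
    (hhalt : SV.HaltsAfter k (3 * S / n) T) :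
    IsDP (onlinePMW Θ loss amin oracle SV η analyst k) ε δ := by
  have h𝒜 : (pmwAdversary Θ loss amin analyst n).IsValid (3 * S / n) :=
    pmwAdversary_isValid hn hconv hdiff hmeas hamin hamin_meas hS hscale hanalyst
  have ho : ∀ D i, IsProbabilityMeasure (oracle D i) := fun D i => (horacle i).1 D
  have hp : ∀ D, (pmwAdversary Θ loss amin analyst n).IsUpdate
      (pmwPost Θ loss amin oracle η D) := fun D =>
    pmwPost_isUpdate hΘ hdiff hmeas hamin_meas η D (ho D)
  have happ := fun D => onlinePMW_apply (k := k) (η := η) hSV h𝒜 hΘ hdiff hmeas hamin_meas D (ho D)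
  have hprob : ∀ D, IsProbabilityMeasure (onlinePMW Θ loss amin oracle SV η analyst k D) :=
    fun D => by
      have := Adversary.isProbabilityMeasure_law hSV h𝒜 (hp D) D k
      rw [happ]
      exact Measure.isProbabilityMeasure_map (by fun_prop)
  -- The two trivial cases are removed first, because there the noise scale or `T` may degenerate to
  -- `0`; hence `hpriv` is required only outside them.
  rcases le_or_gt 1 δ with hδ1 | hδ1
  · exact isDP_of_one_le hprob hδ1
  rcases subsingleton_or_nontrivial X with hX | hX
  · exact isDP_of_subsingleton hprob hε.le
  have hTpos : 0 < T := hT ▸ numUpdates_pos hS hα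
  have hT' : (0 : ℝ) < T := by exact_mod_cast hTpos
  have hΔ : 0 ≤ 3 * S / n := by positivity
  refine ⟨hprob, fun D D' hD A hA => ?_⟩
  rw [happ, happ, Measure.map_apply (by fun_prop) hA, Measure.map_apply (by fun_prop) hA]
  set 𝒜 := pmwAdversary Θ loss amin analyst n
  set post := pmwPost Θ loss amin oracle η
  -- The bound on the number of `⊤` answers is made part of the event, so that it survives the
  -- exchange of datasets in the threshold algorithm.
  set E : Set ((Fin k → Bool ⊕ Unit) × 𝒜.Mem k) := {x | x.2.1 ∈ A ∧ topCount x.1 ≤ T} with hE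
  set F : Set ((Fin k → Bool ⊕ Unit) × 𝒜.Mem k) := {x | T < topCount x.1} with hF
  have hFm : MeasurableSet F :=
    measurable_fst (MeasurableSet.of_discrete (s := {b : Fin k → Bool ⊕ Unit | T < topCount b}))
  have hEm : MeasurableSet E :=
    ((measurable_fst.comp measurable_snd) hA).inter
      (measurable_fst (MeasurableSet.of_discrete (s := {b : Fin k → Bool ⊕ Unit | topCount b ≤ T})))
  have hpm : Measurable fun ω : (Fin k → Bool ⊕ Unit) × 𝒜.Mem k × SV.State => (ω.1, ω.2.1) := by
    fun_prop
  have hF0 : 𝒜.law SV (post D) D k ((fun ω => (ω.1, ω.2.1)) ⁻¹' F) = 0 := by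
    -- With `c = δ = 0` the passage to randomized adversaries transfers null events: too many `⊤`
    -- answers are impossible here too.
    have := Adversary.law_le_of_game_le hSV h𝒜 (hp D) hΔ (k := k) (c := 0) (δ := 0)
      ENNReal.zero_ne_top (G := {b | T < topCount b}) (D := D) (D' := D) (fun B hB A' hA' => by
        have h1 := ae_iff.1 (hhalt B hB D)
        rw [zero_mul, zero_add]
        refine le_of_eq (measure_mono_null (fun b hb => ?_) h1)
        have : T < topCount b := hA' hb
        simpa [topCount] using this) hFm fun x hx => hx
    simpa using this
  have step1 : 𝒜.law SV (post D) D k ((fun ω => ω.2.1.1) ⁻¹' A) ≤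
      𝒜.law SV (post D) D k ((fun ω => (ω.1, ω.2.1)) ⁻¹' E) := by
    calc _ ≤ 𝒜.law SV (post D) D k (((fun ω => (ω.1, ω.2.1)) ⁻¹' E) ∪
          ((fun ω => (ω.1, ω.2.1)) ⁻¹' F)) := by
          refine measure_mono fun ω hω => ?_
          rcases le_or_gt (topCount ω.1) T with h | h
          · exact Or.inl ⟨hω, h⟩
          · exact Or.inr h
      _ ≤ _ := (measure_union_le _ _).trans (by rw [hF0, add_zero])
  -- First exchange: the oracle still reads `D`.
  have step2 : 𝒜.law SV (post D) D k ((fun ω => (ω.1, ω.2.1)) ⁻¹' E) ≤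
      ENNReal.ofReal (Real.exp (ε / 2)) * 𝒜.law SV (post D) D' k ((fun ω => (ω.1, ω.2.1)) ⁻¹' E) +
        ENNReal.ofReal (δ / 2) :=
    Adversary.law_le_of_game_le hSV h𝒜 (hp D) hΔ ENNReal.ofReal_ne_top (G := Set.univ)
      (fun B hB A' _ => (hpriv Fintype.one_lt_card hδ1 B hB).2 D D' hD A' .of_discrete) hEm
      fun x _ => trivial
  obtain ⟨a, ha, hfail⟩ := oracle_failure_le hTpos hε hε1 hδ hδ1
  have hεo : 0 < oracleEps T ε δ := by
    rw [oracleEps]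
    have : 0 < Real.log (4 / δ) := Real.log_pos (by rw [lt_div_iff₀ hδ]; linarith)
    positivity
  have hδo : 0 ≤ oracleDelta T δ := by rw [oracleDelta]; positivity
  have hpost : ∀ D₁ D₂, Adjacent D₁ D₂ → ∀ j z B, MeasurableSet B →
      post D₁ j (z, Sum.inl true) B ≤ ENNReal.ofReal (Real.exp (oracleEps T ε δ)) *
        post D₂ j (z, Sum.inl true) B + ENNReal.ofReal (oracleDelta T δ) := by
    intro D₁ D₂ h12 j z B hB
    have hm : Measurable (pmwTop Θ loss amin η j z) :=
      (measurable_pmwTop hΘ hdiff hmeas hamin_meas η j).comp measurable_prodMk_left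
    simp only [post, pmwPost]
    rw [Measure.map_apply hm hB, Measure.map_apply hm hB]
    exact (horacle z.2).2 D₁ D₂ h12 _ (hm hB)
  set f : (Fin k → Bool ⊕ Unit) × 𝒜.Mem k × SV.State → ℝ≥0∞ :=
    ((fun ω => (ω.1, ω.2.1)) ⁻¹' E).indicator fun _ => 1 with hf
  have hfm : Measurable f := measurable_const.indicator (hpm hEm)
  have hf1 : ∀ ω, f ω ≤ 1 := Set.indicator_le_self' (by simp)
  have ha0 : 0 < a := by linarith
  -- Second exchange: the threshold algorithm reads `D'` on both sides.
  have step3 : 𝒜.law SV (post D) D' k ((fun ω => (ω.1, ω.2.1)) ⁻¹' E) ≤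
      T * ENNReal.ofReal (oracleDelta T δ) + ENNReal.ofReal (stepFactor a (oracleEps T ε δ)) ^ T *
        𝒜.law SV (post D') D' k ((fun ω => (ω.1, ω.2.1)) ⁻¹' E) ^ (1 - 1 / a) := by
    have := Adversary.lintegral_law_le_rpow hSV h𝒜 (hp D) (hp D') D' hεo
      (α := a) (by linarith) (T := T) (fun j z b hb => by
        rcases b with (_ | _) | _
        · rfl
        · exact absurd rfl hb
        · rfl) (hpost D D' hD) (hpost D' D hD.symm) k hfm hfm hf1
      (fun ω hω => Set.indicator_of_notMem (fun h => absurd h.2 (not_le.2 hω)) _)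
      (fun ω hω => by
        by_cases h : ω ∈ (fun ω : (Fin k → Bool ⊕ Unit) × 𝒜.Mem k × SV.State => (ω.1, ω.2.1)) ⁻¹' E
        · rw [hf, Set.indicator_of_mem h, ENNReal.one_rpow, mul_one]
          exact (one_le_pow₀ (stepFactor_ge_one ha0)).trans le_add_self
        · rw [hf, Set.indicator_of_notMem h]; exact zero_le)
    simpa only [hf, lintegral_indicator_const (hpm hEm), one_mul] using this
  have hQ1 := Adversary.isProbabilityMeasure_law hSV h𝒜 (hp D') D' k
  have step4 := stepFactor_pow_mul_rpow_le (T := T) (ε := oracleEps T ε δ) (η := ε / 2) ha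
    (prob_le_one (μ := 𝒜.law SV (post D') D' k) (s := (fun ω => (ω.1, ω.2.1)) ⁻¹' E))
  have step5 : 𝒜.law SV (post D') D' k ((fun ω => (ω.1, ω.2.1)) ⁻¹' E) ≤
      𝒜.law SV (post D') D' k ((fun ω => ω.2.1.1) ⁻¹' A) :=
    measure_mono fun ω hω => hω.1
  set q := 𝒜.law SV (post D') D' k ((fun ω => (ω.1, ω.2.1)) ⁻¹' E)
  set tail := Real.exp ((a - 1 / 2) ^ 2 * (T * oracleEps T ε δ ^ 2) / 2 - (a - 1) * (ε / 2)) /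
    (2 * a)
  have htail : 0 ≤ tail := by positivity
  set e := ENNReal.ofReal (Real.exp (ε / 2)) with he
  have hee : e * e = ENNReal.ofReal (Real.exp ε) := by
    rw [he, ← ENNReal.ofReal_mul (Real.exp_pos _).le, ← Real.exp_add, add_halves]
  have hfail' : e * (T * ENNReal.ofReal (oracleDelta T δ) + ENNReal.ofReal tail) ≤
      ENNReal.ofReal (δ / 2) := by
    rw [he, ← ENNReal.ofReal_natCast, ← ENNReal.ofReal_mul hT'.le,
      ← ENNReal.ofReal_add (by positivity) htail, ← ENNReal.ofReal_mul (Real.exp_pos _).le]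
    exact ENNReal.ofReal_le_ofReal hfail
  calc _ ≤ e * (T * ENNReal.ofReal (oracleDelta T δ) + (e * q + ENNReal.ofReal tail)) +
        ENNReal.ofReal (δ / 2) := by
        refine step1.trans (step2.trans ?_)
        gcongr
        exact step3.trans (by gcongr)
    _ = e * e * q + e * (T * ENNReal.ofReal (oracleDelta T δ) + ENNReal.ofReal tail) +
        ENNReal.ofReal (δ / 2) := by ring
    _ ≤ e * e * q + ENNReal.ofReal (δ / 2) + ENNReal.ofReal (δ / 2) := by gcongr
    _ = ENNReal.ofReal (Real.exp ε) * q + ENNReal.ofReal δ := by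
        rw [hee, add_assoc, ← ENNReal.ofReal_add (by positivity) (by positivity), add_halves]
    _ ≤ _ := by gcongr

end Privacy

/-! ### The Laplace law -/

theorem measurable_laplace_density (b : ℝ) :
    Measurable fun z : ℝ => ENNReal.ofReal (Real.exp (-|z| / b) / (2 * b)) := by
  fun_prop

theorem lintegral_laplace_density {b : ℝ} (hb : 0 < b) :
    ∫⁻ z : ℝ, ENNReal.ofReal (Real.exp (-|z| / b) / (2 * b)) = 1 := by
  have h0 : -b⁻¹ < 0 := by simpa using hb
  have e1 : ∫ z : ℝ in Set.Ioi 0, Real.exp (-b⁻¹ * z) = b := by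
    rw [integral_exp_mul_Ioi h0]; simp
  have e2 : ∫ z : ℝ, Real.exp (-b⁻¹ * |z|) = 2 * b := by
    rw [integral_comp_abs (f := fun z => Real.exp (-b⁻¹ * z)), e1]
  have i2 : Integrable fun z : ℝ => Real.exp (-b⁻¹ * |z|) := by
    by_contra h
    rw [integral_undef h] at e2
    linarith
  have e : ∀ z : ℝ, Real.exp (-|z| / b) / (2 * b) = Real.exp (-b⁻¹ * |z|) / (2 * b) := fun z => by
    congr 2; field_simp
  simp_rw [e]
  rw [← ofReal_integral_eq_lintegral_ofReal (i2.div_const _) (.of_forall fun z => by positivity),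
    integral_div, e2, div_self (by positivity), ENNReal.ofReal_one]

instance (b : ℝ) : IsProbabilityMeasure (laplace b) := by
  unfold laplace
  split_ifs with hb
  · constructor
    rw [withDensity_apply _ MeasurableSet.univ, Measure.restrict_univ, lintegral_laplace_density hb]
  · infer_instance

/-- Shifting the Laplace law by `c` changes probabilities by a factor of at most `e^(|c|/b)`. -/
theorem lintegral_laplace_le {b : ℝ} (hb : 0 < b) (c : ℝ) {h : ℝ → ℝ≥0∞} (hh : Measurable h) :
    ∫⁻ z, h z ∂(laplace b) ≤ ENNReal.ofReal (Real.exp (|c| / b)) * ∫⁻ z, h (z - c) ∂(laplace b) := by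
  have hh' : Measurable fun z => h (z - c) := hh.comp (measurable_id.sub_const c)
  rw [laplace, if_pos hb, lintegral_withDensity_eq_lintegral_mul _ (measurable_laplace_density b) hh,
    lintegral_withDensity_eq_lintegral_mul _ (measurable_laplace_density b) hh',
    ← lintegral_const_mul _ ((measurable_laplace_density b).mul hh'),
    ← lintegral_sub_right_eq_self _ c]
  refine lintegral_mono fun z => ?_
  simp only [Pi.mul_apply]
  rw [← mul_assoc, ← ENNReal.ofReal_mul (Real.exp_pos _).le]
  gcongr
  rw [← mul_div_assoc, ← Real.exp_add]
  gcongr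
  rw [← add_div]
  gcongr
  have := abs_sub_abs_le_abs_sub z (z - c)
  rw [sub_sub_cancel] at this
  linarith

/-! ### The rounds of the sparse vector algorithm -/

/-- The law of a fresh noisy threshold. -/
def freshThreshold (α σ : ℝ) : Measure ℝ := (laplace σ).map fun z => 3 * α / 4 + z

instance (α σ : ℝ) : IsProbabilityMeasure (freshThreshold α σ) :=
  Measure.isProbabilityMeasure_map (by fun_prop)

/-- The probability that a query with value `v` reaches the noisy threshold `τ`. -/
def topProb (σ v τ : ℝ) : ℝ≥0∞ := laplace (2 * σ) {y | τ ≤ v + y}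

/-- The probability that a query with value `v` does not reach the noisy threshold `τ`. -/
def botProb (σ v τ : ℝ) : ℝ≥0∞ := laplace (2 * σ) {y | v + y < τ}

theorem topProb_add_botProb (σ v τ : ℝ) : topProb σ v τ + botProb σ v τ = 1 := by
  have h : {y : ℝ | v + y < τ} = {y : ℝ | τ ≤ v + y}ᶜ := by ext y; simp
  have hm : MeasurableSet {y : ℝ | τ ≤ v + y} := measurableSet_le (by fun_prop) (by fun_prop)
  rw [topProb, botProb, h, measure_add_measure_compl hm, measure_univ]

theorem measurable_topProb (σ v : ℝ) : Measurable (topProb σ v) := by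
  have hs : MeasurableSet {x : ℝ × ℝ | x.1 ≤ v + x.2} :=
    measurableSet_le (by fun_prop) (by fun_prop)
  exact measurable_measure_prodMk_left hs

theorem measurable_botProb (σ v : ℝ) : Measurable (botProb σ v) := by
  have hs : MeasurableSet {x : ℝ × ℝ | v + x.2 < x.1} :=
    measurableSet_lt (by fun_prop) (by fun_prop)
  exact measurable_measure_prodMk_left hs

/-- Raising the threshold by `Δ` absorbs the change of the query value, so `⊥` costs nothing. -/
theorem botProb_le {σ v v' Δ : ℝ} (h : |v - v'| ≤ Δ) (τ : ℝ) :
    botProb σ v (τ - Δ) ≤ botProb σ v' τ := by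
  refine measure_mono fun y (hy : v + y < τ - Δ) => ?_
  have := (abs_le.1 h).1
  change v' + y < τ
  linarith

/-- The query noise must make up for `Δ` in the threshold and `Δ` in the value; a shift by `2Δ` at
scale `2σ` costs `e^(Δ/σ)`. -/
theorem topProb_le {σ v v' Δ : ℝ} (hσ : 0 < σ) (hΔ : 0 ≤ Δ) (h : |v - v'| ≤ Δ) (τ : ℝ) :
    topProb σ v (τ - Δ) ≤ ENNReal.ofReal (Real.exp (Δ / σ)) * topProb σ v' τ := by
  have hm : ∀ v τ : ℝ, MeasurableSet {y : ℝ | τ ≤ v + y} := fun v τ =>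
    measurableSet_le (by fun_prop) (by fun_prop)
  have key := lintegral_laplace_le (b := 2 * σ) (by positivity) (2 * Δ)
    (h := {y : ℝ | τ - Δ ≤ v + y}.indicator fun _ => 1) (measurable_const.indicator (hm _ _))
  rw [lintegral_indicator_const (hm _ _), one_mul, abs_of_nonneg (by positivity),
    mul_div_mul_left _ _ two_ne_zero] at key
  refine key.trans ?_
  gcongr
  rw [topProb, ← lintegral_indicator_one (hm v' τ)]
  refine lintegral_mono fun y => ?_
  by_cases hy : y - 2 * Δ ∈ {y : ℝ | τ - Δ ≤ v + y}
  · rw [Set.indicator_of_mem hy, Set.indicator_of_mem]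
    · simp
    · have hy' : τ - Δ ≤ v + (y - 2 * Δ) := hy
      have := (abs_le.1 h).2
      change τ ≤ v' + y
      linarith
  · rw [Set.indicator_of_notMem hy]; exact zero_le

section Sparse

variable {n : ℕ} {X : Type u} {T : ℕ} {Δ α ε δ : ℝ}

theorem sparseVector_step_measurable (D : Fin n → X) :
    Measurable (Function.uncurry fun (z : (ℕ × ℝ) × ((Fin n → X) → ℝ)) (y : ℝ) =>
      if z.1.2 ≤ z.2 D + y then
        (laplace (noiseScale T Δ ε δ)).map fun t => (true, (z.1.1 + 1, 3 * α / 4 + t))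
      else Measure.dirac (false, z.1)) := by
  refine Measurable.ite (measurableSet_le (by fun_prop) (by fun_prop)) ?_ ?_
  · exact measurable_map_param (κ := fun _ : ((ℕ × ℝ) × ((Fin n → X) → ℝ)) × ℝ =>
      laplace (noiseScale T Δ ε δ)) measurable_const
      (F := fun z t => (true, (z.1.1.1 + 1, 3 * α / 4 + t))) (by fun_prop)
  · exact Measure.measurable_dirac.comp (by fun_prop)

theorem sparseVector_isValid : (sparseVector n X T Δ α ε δ).IsValid where
  init_prob D := Measure.isProbabilityMeasure_map (by fun_prop)
  halted_meas := measurableSet_le measurable_const measurable_fst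
  step_prob D s q := by
    refine isProbabilityMeasure_bind' ((sparseVector_step_measurable D).comp
      (measurable_prodMk_left (x := (s, q)))) fun y => ?_
    dsimp only [Function.comp, Function.uncurry]
    split_ifs
    · exact Measure.isProbabilityMeasure_map (by fun_prop)
    · infer_instance
  step_meas D := measurable_bind_param (κ := fun _ : (ℕ × ℝ) × ((Fin n → X) → ℝ) =>
    laplace (2 * noiseScale T Δ ε δ)) measurable_const (sparseVector_step_measurable D)

theorem lintegral_sparseVector_round_of_lt (D : Fin n → X) {c : ℕ} (hc : c < T) (τ : ℝ)
    (q : (Fin n → X) → ℝ) {F : (Bool ⊕ Unit) × (ℕ × ℝ) → ℝ≥0∞} (hF : Measurable F) :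
    ∫⁻ r, F r ∂((sparseVector n X T Δ α ε δ).round D (c, τ) q) =
      topProb (noiseScale T Δ ε δ) (q D) τ *
        ∫⁻ t, F (Sum.inl true, (c + 1, t)) ∂(freshThreshold α (noiseScale T Δ ε δ)) +
      botProb (noiseScale T Δ ε δ) (q D) τ * F (Sum.inl false, (c, τ)) := by
  set σ := noiseScale T Δ ε δ with hσ
  have hnot : ((c, τ) : ℕ × ℝ) ∉ (sparseVector n X T Δ α ε δ).halted := not_le.2 hc
  have hm : MeasurableSet {y : ℝ | τ ≤ q D + y} := measurableSet_le (by fun_prop) (by fun_prop)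
  have hF' : Measurable fun z : Bool × (ℕ × ℝ) => F (Sum.inl z.1, z.2) :=
    hF.comp (by fun_prop)
  rw [SVAlg.round, if_neg hnot, lintegral_map hF (by fun_prop)]
  refine (lintegral_bind' ((sparseVector_step_measurable D).comp
      (measurable_prodMk_left (x := ((c, τ), q)))) hF').trans ?_
  have e : ∀ y, ∫⁻ z, F (Sum.inl z.1, z.2) ∂((Function.uncurry
      fun (z : (ℕ × ℝ) × ((Fin n → X) → ℝ)) (y : ℝ) => if z.1.2 ≤ z.2 D + y then
        (laplace σ).map fun t => (true, (z.1.1 + 1, 3 * α / 4 + t))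
      else Measure.dirac (false, z.1)) ((((c, τ) : ℕ × ℝ), q), y)) =
      {y : ℝ | τ ≤ q D + y}.indicator
        (fun _ => ∫⁻ t, F (Sum.inl true, (c + 1, t)) ∂(freshThreshold α σ)) y +
      {y : ℝ | q D + y < τ}.indicator (fun _ => F (Sum.inl false, (c, τ))) y := fun y => by
    dsimp only [Function.uncurry]
    by_cases hy : τ ≤ q D + y
    · rw [if_pos hy, Set.indicator_of_mem (by exact hy),
        Set.indicator_of_notMem (by simpa using hy), add_zero, lintegral_map hF' (by fun_prop),
        freshThreshold,
        lintegral_map (f := fun t => F (Sum.inl true, (c + 1, t))) (hF.comp (by fun_prop))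
          (by fun_prop)]
    · rw [if_neg hy, Set.indicator_of_notMem (by exact hy),
        Set.indicator_of_mem (by simpa using hy), zero_add, lintegral_dirac' _ hF']
  refine (lintegral_congr e).trans ?_
  rw [lintegral_add_left (measurable_const.indicator hm), lintegral_indicator_const hm,
    lintegral_indicator_const (measurableSet_lt (by fun_prop) (by fun_prop)), topProb, botProb,
    mul_comm, mul_comm (F _)]

theorem lintegral_sparseVector_round_of_le (D : Fin n → X) {c : ℕ} (hc : T ≤ c) (τ : ℝ)
    (q : (Fin n → X) → ℝ) {F : (Bool ⊕ Unit) × (ℕ × ℝ) → ℝ≥0∞} (hF : Measurable F) :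
    ∫⁻ r, F r ∂((sparseVector n X T Δ α ε δ).round D (c, τ) q) = F (Sum.inr (), (c, τ)) := by
  have hmem : ((c, τ) : ℕ × ℝ) ∈ (sparseVector n X T Δ α ε δ).halted := hc
  rw [SVAlg.round, if_pos hmem, lintegral_dirac' _ hF]

theorem ae_game_sparseVector (B : (j : ℕ) → (Fin j → Bool ⊕ Unit) → (Fin n → X) → ℝ)
    (D : Fin n → X) (j : ℕ) :
    ∀ᵐ ω ∂((sparseVector n X T Δ α ε δ).game B D j), ω.2.1 = topCount ω.1 ∧ ω.2.1 ≤ T := by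
  have hset : ∀ j, MeasurableSet {ω : (Fin j → Bool ⊕ Unit) × (ℕ × ℝ) |
      ω.2.1 = topCount ω.1 ∧ ω.2.1 ≤ T} := fun j => by
    have hc : Measurable fun ω : (Fin j → Bool ⊕ Unit) × (ℕ × ℝ) => topCount ω.1 :=
      (Measurable.of_discrete (f := fun b : Fin j → Bool ⊕ Unit => topCount b)).comp measurable_fst
    exact (measurableSet_eq_fun (measurable_fst.comp measurable_snd) hc).inter
      (measurableSet_le (measurable_fst.comp measurable_snd) measurable_const)
  induction j with
  | zero =>
    simp only [SVAlg.game]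
    have hmap : Measurable fun z : ℝ => ((0, 3 * α / 4 + z) : ℕ × ℝ) := by fun_prop
    have helim : Measurable fun s : ℕ × ℝ => ((Fin.elim0, s) : (Fin 0 → Bool ⊕ Unit) × (ℕ × ℝ)) :=
      by fun_prop
    refine (ae_map_iff helim.aemeasurable (hset 0)).2 ?_
    refine (ae_map_iff hmap.aemeasurable (helim (hset 0))).2 ?_
    exact .of_forall fun z => by simp [topCount]
  | succ j ih =>
    set f : (Fin (j + 1) → Bool ⊕ Unit) × (ℕ × ℝ) → ℝ≥0∞ := {ω | ω.2.1 = topCount ω.1 ∧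
      ω.2.1 ≤ T}ᶜ.indicator 1
    have hf : Measurable f := measurable_one.indicator (hset (j + 1)).compl
    have hgoal : ∫⁻ ω, f ω ∂((sparseVector n X T Δ α ε δ).game B D (j + 1)) = 0 →
        ∀ᵐ ω ∂((sparseVector n X T Δ α ε δ).game B D (j + 1)),
          ω.2.1 = topCount ω.1 ∧ ω.2.1 ≤ T := fun h => by
      rw [lintegral_indicator_one (hset (j + 1)).compl] at h
      exact ae_iff.2 h
    refine hgoal ?_
    rw [sparseVector_isValid.lintegral_game_succ B D j hf]
    refine (lintegral_congr_ae (g := fun _ => 0) ?_).trans lintegral_zero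
    filter_upwards [ih] with ω hω
    obtain ⟨b, c, τ⟩ := ω
    obtain ⟨h1, h2⟩ := hω
    dsimp only at h1 h2 ⊢
    have hF : Measurable fun z : (Bool ⊕ Unit) × (ℕ × ℝ) =>
        f (Fin.snoc (α := fun _ => Bool ⊕ Unit) b z.1, z.2) :=
      hf.comp (((measurable_snoc j).comp (measurable_const.prodMk measurable_fst)).prodMk
        measurable_snd)
    have f0 : ∀ a c' τ', c' = topCount b + (if a = Sum.inl true then 1 else 0) → c' ≤ T →
        f (Fin.snoc (α := fun _ => Bool ⊕ Unit) b a, (c', τ')) = 0 := fun a c' τ' h3 h4 =>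
      Set.indicator_of_notMem (by
        simp only [Set.mem_compl_iff, Set.mem_ofPred_eq, not_not]
        exact ⟨by rw [h3, topCount_snoc], h4⟩) _
    rcases lt_or_ge c T with hc | hc
    · rw [lintegral_sparseVector_round_of_lt D hc τ _ hF]
      simp only
      rw [f0 _ _ _ (by simpa using h1) h2]
      simp_rw [fun t => f0 (Sum.inl true) (c + 1) t (by simpa using h1) hc]
      simp
    · rw [lintegral_sparseVector_round_of_le D hc τ _ hF]
      exact f0 _ _ _ (by simpa using h1) h2

theorem sparseVector_haltsAfter (k : ℕ) (Δ' : ℝ) :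
    (sparseVector n X T Δ α ε δ).HaltsAfter k Δ' T := by
  intro B _ D
  rw [ae_map_iff (by fun_prop) .of_discrete]
  filter_upwards [ae_game_sparseVector (T := T) (Δ := Δ) (α := α) (ε := ε) (δ := δ) B D k]
    with ω hω
  have := hω.1 ▸ hω.2
  simpa [topCount] using this

end Sparse

/-! ### Privacy of one epoch of the sparse vector algorithm -/

/-- `ρ` is bounded by a multiple of `ρ'` shifted by `Δ`. -/
def ShiftBound (σ Δ : ℝ) (ρ ρ' : Measure ℝ) : Prop :=
  ∀ h : ℝ → ℝ≥0∞, Measurable h →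
    ∫⁻ t, h t ∂ρ ≤ ENNReal.ofReal (Real.exp (Δ / σ)) * ∫⁻ t, h (t - Δ) ∂ρ'

/-- Conditioning on `⊥`, without normalizing, leaves the constant unchanged. This is why the length
of an epoch does not matter. -/
theorem ShiftBound.withDensity_botProb {σ Δ v v' : ℝ} {ρ ρ' : Measure ℝ}
    (h : ShiftBound σ Δ ρ ρ') (hv : |v - v'| ≤ Δ) :
    ShiftBound σ Δ (ρ.withDensity (botProb σ v)) (ρ'.withDensity (botProb σ v')) := by
  intro g hg
  have hg' : Measurable fun t => g (t - Δ) := hg.comp (measurable_id.sub_const Δ)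
  rw [lintegral_withDensity_eq_lintegral_mul _ (measurable_botProb σ v) hg,
    lintegral_withDensity_eq_lintegral_mul _ (measurable_botProb σ v') hg']
  refine (h _ ((measurable_botProb σ v).mul hg)).trans ?_
  gcongr with t
  simp only [Pi.mul_apply]
  gcongr
  exact botProb_le hv t

theorem ShiftBound.lintegral_topProb_le {σ Δ v v' : ℝ} {ρ ρ' : Measure ℝ}
    (h : ShiftBound σ Δ ρ ρ') (hσ : 0 < σ) (hΔ : 0 ≤ Δ) (hv : |v - v'| ≤ Δ) :
    ∫⁻ t, topProb σ v t ∂ρ ≤ ENNReal.ofReal (Real.exp (2 * Δ / σ)) * ∫⁻ t, topProb σ v' t ∂ρ' := by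
  have e : ENNReal.ofReal (Real.exp (2 * Δ / σ)) =
      ENNReal.ofReal (Real.exp (Δ / σ)) * ENNReal.ofReal (Real.exp (Δ / σ)) := by
    rw [← ENNReal.ofReal_mul (Real.exp_pos _).le, ← Real.exp_add]; congr 2; ring
  refine (h _ (measurable_topProb σ v)).trans ?_
  rw [e, mul_assoc]
  gcongr
  rw [← lintegral_const_mul _ (measurable_topProb σ v')]
  exact lintegral_mono fun t => topProb_le hσ hΔ hv t

theorem ShiftBound.measure_univ_le {σ Δ : ℝ} {ρ ρ' : Measure ℝ}
    (h : ShiftBound σ Δ ρ ρ') (hσ : 0 < σ) (hΔ : 0 ≤ Δ) :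
    ρ Set.univ ≤ ENNReal.ofReal (Real.exp (2 * Δ / σ)) * ρ' Set.univ := by
  have := h (fun _ => 1) measurable_const
  simp only [lintegral_const, one_mul] at this
  refine this.trans ?_
  gcongr
  linarith

theorem shiftBound_freshThreshold {σ Δ : ℝ} (hσ : 0 < σ) (hΔ : 0 ≤ Δ) (α : ℝ) :
    ShiftBound σ Δ (freshThreshold α σ) (freshThreshold α σ) := by
  intro h hh
  rw [freshThreshold, lintegral_map hh (by fun_prop),
    lintegral_map (f := fun t => h (t - Δ)) (hh.comp (measurable_id.sub_const Δ)) (by fun_prop)]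
  have := lintegral_laplace_le hσ Δ (h := fun z => h (3 * α / 4 + z)) (hh.comp (by fun_prop))
  rw [abs_of_nonneg hΔ] at this
  refine this.trans (le_of_eq ?_)
  simp only [add_sub_assoc]

/-- The one-step bound for finitely many weights. -/
theorem sum_mul_rpow_le {N : ℕ} {e e' x : Fin N → ℝ≥0∞} {ε : ℝ} (hε : 0 < ε) {α : ℝ} (hα : 1 < α)
    (h1 : ∀ r, e r ≤ ENNReal.ofReal (Real.exp ε) * e' r)
    (h2 : ∀ r, e' r ≤ ENNReal.ofReal (Real.exp ε) * e r) (s1 : ∑ r, e r = 1) (s2 : ∑ r, e' r = 1)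
    (hx : ∀ r, x r ≤ 1) :
    ∑ r, e r * x r ^ (1 - 1 / α) ≤
      ENNReal.ofReal (stepFactor α ε) * (∑ r, e' r * x r) ^ (1 - 1 / α) := by
  set P : (Fin N → ℝ≥0∞) → Measure (Fin N) := fun e => ∑ r, e r • Measure.dirac r with hP
  have hint : ∀ e f : Fin N → ℝ≥0∞, ∫⁻ r, f r ∂(P e) = ∑ r, e r * f r := fun e f => by
    rw [hP, lintegral_finsetSum_measure]
    simp
  have hap : ∀ (e : Fin N → ℝ≥0∞) (A : Set (Fin N)),
      P e A = ∑ r, e r * A.indicator (fun _ => 1) r := fun e A => by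
    rw [← hint e, lintegral_indicator_const .of_discrete, one_mul]
  have hpr : ∀ e : Fin N → ℝ≥0∞, ∑ r, e r = 1 → IsProbabilityMeasure (P e) := fun e he =>
    ⟨by rw [hap]; simpa using he⟩
  have hle : ∀ e e' : Fin N → ℝ≥0∞, (∀ r, e r ≤ ENNReal.ofReal (Real.exp ε) * e' r) →
      ∀ A, MeasurableSet A → P e A ≤ ENNReal.ofReal (Real.exp ε) * P e' A + 0 := by
    intro e e' h A _
    rw [hap, hap, add_zero, Finset.mul_sum]
    refine Finset.sum_le_sum fun r _ => ?_
    rw [← mul_assoc]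
    gcongr
    exact h r
  have := hpr e s1
  have := hpr e' s2
  have hβ0 : 0 ≤ 1 - 1 / α := by
    have : 1 / α < 1 := (div_lt_one (by linarith)).2 hα
    linarith
  have key := lintegral_le_of_indist hε (hle e e' h1) (hle e' e h2) hα
    (f := fun r => x r ^ (1 - 1 / α)) (g := x) (fun r => ENNReal.rpow_le_one (hx r) hβ0)
    .of_discrete (c := 0) (k := 1) fun r => by simp
  rw [hint, hint] at key
  simpa using key

/-- The integrals of `F` and `F'` against the threshold laws `ρ` and `ρ'` are averages, with
weights that differ by a factor of at most `e^ε`, of values `(C x^β, x)`. -/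
def EpochBound (ε β : ℝ) (C : ℝ≥0∞) (ρ ρ' : Measure ℝ) (F F' : ℝ → ℝ≥0∞) : Prop :=
  ∃ (N : ℕ) (e e' x : Fin N → ℝ≥0∞), (∀ r, e r ≤ ENNReal.ofReal (Real.exp ε) * e' r) ∧
    (∀ r, e' r ≤ ENNReal.ofReal (Real.exp ε) * e r) ∧ ∑ r, e r = ρ Set.univ ∧
    ∑ r, e' r = ρ' Set.univ ∧ (∀ r, x r ≤ 1) ∧
    ∫⁻ t, F t ∂ρ ≤ C * ∑ r, e r * x r ^ β ∧ ∑ r, e' r * x r ≤ ∫⁻ t, F' t ∂ρ'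

/-- The step factor is paid once per epoch, when the weights have total mass one. Inside an epoch
the weights are only collected. -/
theorem EpochBound.lintegral_le {ε α : ℝ} (hε : 0 < ε) (hα : 1 < α) {C : ℝ≥0∞} {ρ ρ' : Measure ℝ}
    [IsProbabilityMeasure ρ] [IsProbabilityMeasure ρ'] {F F' : ℝ → ℝ≥0∞}
    (h : EpochBound ε (1 - 1 / α) C ρ ρ' F F') :
    ∫⁻ t, F t ∂ρ ≤ C * (ENNReal.ofReal (stepFactor α ε) * (∫⁻ t, F' t ∂ρ') ^ (1 - 1 / α)) := by
  obtain ⟨N, e, e', x, h1, h2, s1, s2, hx, hF, hF'⟩ := h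
  rw [measure_univ] at s1 s2
  have hβ0 : 0 ≤ 1 - 1 / α := by
    have : 1 / α < 1 := (div_lt_one (by linarith)).2 hα
    linarith
  refine hF.trans ?_
  gcongr
  exact (sum_mul_rpow_le hε hα h1 h2 s1 s2 hx).trans (by gcongr)

/-! ### Composition of the epochs of the sparse vector algorithm. -/

section Sparse

variable {n : ℕ} {X : Type u} {T : ℕ} {Δ α₀ ε δ : ℝ}

/-- Backward induction over the rounds. At count `c` the constant `K ^ (T - c - 1)` pays for the
epochs after the current one, which is kept open as a list of weights: one for each round in which
it may end with `⊤`, and one for reaching the end of the game unfinished. -/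
theorem lintegral_game_sparseVector_le {B : (j : ℕ) → (Fin j → Bool ⊕ Unit) → (Fin n → X) → ℝ}
    (hB : ∀ j h, IsSensitive Δ (B j h)) {D D' : Fin n → X} (hD : Adjacent D D') (hT : 0 < T)
    {σ : ℝ} (hσ : noiseScale T Δ ε δ = σ) (hσ0 : 0 < σ) (hΔ : 0 < Δ) {α : ℝ} (hα : 1 < α) (j : ℕ)
    {f f' : (Fin j → Bool ⊕ Unit) × (ℕ × ℝ) → ℝ≥0∞} (hf : Measurable f) (hf' : Measurable f')
    (hf'1 : ∀ ω, f' ω ≤ 1)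
    (hhalt : ∀ b τ, f (b, (T, τ)) ≤ f' (b, (T, τ)) ^ (1 - 1 / α))
    (hepoch : ∀ b c, c < T → ∀ ρ ρ' : Measure ℝ, ShiftBound σ Δ ρ ρ' → ShiftBound σ Δ ρ' ρ →
      EpochBound (2 * Δ / σ) (1 - 1 / α)
        (ENNReal.ofReal (stepFactor α (2 * Δ / σ)) ^ (T - c - 1)) ρ ρ'
        (fun τ => f (b, (c, τ))) (fun τ => f' (b, (c, τ)))) :
    ∫⁻ ω, f ω ∂((sparseVector n X T Δ α₀ ε δ).game B D j) ≤
      ENNReal.ofReal (stepFactor α (2 * Δ / σ)) ^ T *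
        (∫⁻ ω, f' ω ∂((sparseVector n X T Δ α₀ ε δ).game B D' j)) ^ (1 - 1 / α) := by
  have hε : 0 < 2 * Δ / σ := by positivity
  have hfresh := shiftBound_freshThreshold hσ0 hΔ.le α₀
  have hβ1 : 1 - 1 / α < 1 := by
    have : 0 < 1 / α := by positivity
    linarith
  have hβ0 : 0 < 1 - 1 / α := by
    have : 1 / α < 1 := (div_lt_one (by linarith)).2 hα
    linarith
  set K := ENNReal.ofReal (stepFactor α (2 * Δ / σ)) with hK
  induction j with
  | zero =>
    have e : ∀ (E : Fin n → X) {g : (Fin 0 → Bool ⊕ Unit) × (ℕ × ℝ) → ℝ≥0∞}, Measurable g →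
        ∫⁻ ω, g ω ∂((sparseVector n X T Δ α₀ ε δ).game B E 0) =
          ∫⁻ τ, g (Fin.elim0, (0, τ)) ∂(freshThreshold α₀ σ) := fun E g hg => by
      simp only [SVAlg.game]
      rw [hσ, freshThreshold, lintegral_map hg (by fun_prop),
        lintegral_map (f := fun s => g (Fin.elim0, s)) (hg.comp (by fun_prop)) (by fun_prop),
        lintegral_map (f := fun τ => g (Fin.elim0, (0, τ))) (hg.comp (by fun_prop)) (by fun_prop)]
    rw [e D hf, e D' hf']
    have := (hepoch Fin.elim0 0 hT _ _ hfresh hfresh).lintegral_le hε hα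
    refine this.trans (le_of_eq ?_)
    rw [← hK, ← mul_assoc, ← pow_succ, show T - 0 - 1 + 1 = T by omega]
  | succ j ih =>
    have hFm : ∀ {g : (Fin (j + 1) → Bool ⊕ Unit) × (ℕ × ℝ) → ℝ≥0∞}, Measurable g →
        ∀ b, Measurable fun z : (Bool ⊕ Unit) × (ℕ × ℝ) =>
          g (Fin.snoc (α := fun _ => Bool ⊕ Unit) b z.1, z.2) := fun hg b =>
      hg.comp (((measurable_snoc j).comp (measurable_const.prodMk measurable_fst)).prodMk
        measurable_snd)
    have hSV : (sparseVector n X T Δ α₀ ε δ).IsValid := sparseVector_isValid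
    have hround := hSV.isProbabilityMeasure_round
    have hstep : ∀ (E : Fin n → X) {g : (Fin (j + 1) → Bool ⊕ Unit) × (ℕ × ℝ) → ℝ≥0∞},
        Measurable g → Measurable fun ω : (Fin j → Bool ⊕ Unit) × (ℕ × ℝ) => ∫⁻ z,
          g (Fin.snoc (α := fun _ => Bool ⊕ Unit) ω.1 z.1, z.2)
            ∂((sparseVector n X T Δ α₀ ε δ).round E ω.2 (B j ω.1)) := fun E g hg => by
      refine measurable_lintegral_param (κ := fun ω : (Fin j → Bool ⊕ Unit) × (ℕ × ℝ) =>
        (sparseVector n X T Δ α₀ ε δ).round E ω.2 (B j ω.1))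
        ((hSV.measurable_round E).comp (measurable_snd.prodMk
          (Measurable.of_discrete.comp measurable_fst)))
        (F := fun ω z => g (Fin.snoc (α := fun _ => Bool ⊕ Unit) ω.1 z.1, z.2)) ?_
      exact hg.comp (((measurable_snoc j).comp (by fun_prop : Measurable
        fun x : ((Fin j → Bool ⊕ Unit) × (ℕ × ℝ)) × ((Bool ⊕ Unit) × (ℕ × ℝ)) =>
          (x.1.1, x.2.1))).prodMk (by fun_prop))
    rw [hSV.lintegral_game_succ B D j hf, hSV.lintegral_game_succ B D' j hf']
    refine ih (hstep D hf) (hstep D' hf') (fun ω => lintegral_le_one fun _ => hf'1 _)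
      (fun b τ => ?_) fun b c hc ρ ρ' hρ hρ' => ?_
    · dsimp only
      rw [lintegral_sparseVector_round_of_le D le_rfl τ _ (hFm hf b),
        lintegral_sparseVector_round_of_le D' le_rfl τ _ (hFm hf' b)]
      exact hhalt _ τ
    · have hs : |B j b D - B j b D'| ≤ Δ := hB j b D D' hD
      have hs' : |B j b D' - B j b D| ≤ Δ := hB j b D' D hD.symm
      dsimp only
      simp_rw [lintegral_sparseVector_round_of_lt D hc _ _ (hFm hf b),
        lintegral_sparseVector_round_of_lt D' hc _ _ (hFm hf' b), hσ]
      set bt : Fin (j + 1) → Bool ⊕ Unit :=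
        Fin.snoc (α := fun _ => Bool ⊕ Unit) b (Sum.inl true)
      set bf : Fin (j + 1) → Bool ⊕ Unit :=
        Fin.snoc (α := fun _ => Bool ⊕ Unit) b (Sum.inl false)
      set x₀ := ∫⁻ t, f' (bt, (c + 1, t)) ∂(freshThreshold α₀ σ) with hx₀
      have htop : ∫⁻ t, f (bt, (c + 1, t)) ∂(freshThreshold α₀ σ) ≤
          K ^ (T - c - 1) * x₀ ^ (1 - 1 / α) := by
        rcases Nat.lt_or_ge (c + 1) T with hcT | hcT
        · refine ((hepoch bt (c + 1) hcT _ _ hfresh hfresh).lintegral_le hε hα).trans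
            (le_of_eq ?_)
          rw [← hK, ← mul_assoc, ← pow_succ, show T - (c + 1) - 1 + 1 = T - c - 1 by omega]
        -- This `⊤` halts the algorithm: no epoch follows, and Jensen suffices.
        · obtain rfl : T = c + 1 := by omega
          have : c + 1 - c - 1 = 0 := by omega
          rw [this, pow_zero, one_mul]
          refine (lintegral_mono fun t => hhalt bt t).trans ?_
          exact lintegral_rpow_le_rpow _ (hf'.comp (by fun_prop)) hβ0 hβ1
      -- After `⊥` the epoch goes on, with threshold laws reweighted by the probability of `⊥`.
      obtain ⟨N, e, e', x, h1, h2, s1, s2, hx, hF, hF'⟩ := hepoch bf c hc _ _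
        (hρ.withDensity_botProb hs) (hρ'.withDensity_botProb hs')
      have mt := fun v => measurable_topProb σ v
      have mb := fun v => measurable_botProb σ v
      have mf : Measurable fun τ : ℝ => f (bf, (c, τ)) := hf.comp (by fun_prop)
      have mf' : Measurable fun τ : ℝ => f' (bf, (c, τ)) := hf'.comp (by fun_prop)
      have hmass : ∀ (v : ℝ) (ρ : Measure ℝ), ∫⁻ t, topProb σ v t ∂ρ +
          ρ.withDensity (botProb σ v) Set.univ = ρ Set.univ := fun v ρ => by
        rw [withDensity_apply _ MeasurableSet.univ, Measure.restrict_univ,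
          ← lintegral_add_left (mt v)]
        simp [topProb_add_botProb]
      rw [lintegral_withDensity_eq_lintegral_mul _ (mb _) mf] at hF
      rw [lintegral_withDensity_eq_lintegral_mul _ (mb _) mf'] at hF'
      -- The new weight is the probability that the epoch ends in this round; its value is `x₀`,
      -- since a fresh threshold forgets the old one.
      refine ⟨N + 1, Fin.cons (∫⁻ t, topProb σ (B j b D) t ∂ρ) e,
        Fin.cons (∫⁻ t, topProb σ (B j b D') t ∂ρ') e', Fin.cons x₀ x,
        Fin.cases (by simpa using hρ.lintegral_topProb_le hσ0 hΔ.le hs) (by simpa using h1),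
        Fin.cases (by simpa using hρ'.lintegral_topProb_le hσ0 hΔ.le hs') (by simpa using h2),
        ?_, ?_, Fin.cases (by simpa using lintegral_le_one fun _ => hf'1 _) (by simpa using hx),
        ?_, ?_⟩
      · rw [Fin.sum_univ_succ]
        simp only [Fin.cons_zero, Fin.cons_succ]
        rw [s1, hmass]
      · rw [Fin.sum_univ_succ]
        simp only [Fin.cons_zero, Fin.cons_succ]
        rw [s2, hmass]
      · rw [Fin.sum_univ_succ]
        simp only [Fin.cons_zero, Fin.cons_succ]
        rw [lintegral_add_left ((mt _).mul_const _), lintegral_mul_const _ (mt _), mul_add]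
        refine add_le_add ?_ hF
        rw [mul_left_comm]
        gcongr
      · rw [Fin.sum_univ_succ]
        simp only [Fin.cons_zero, Fin.cons_succ]
        rw [lintegral_add_left ((mt _).mul_const _), lintegral_mul_const _ (mt _)]
        exact add_le_add le_rfl hF'

theorem sparseVector_failure_le {T : ℕ} (hT : 0 < T) {Δ ε δ : ℝ} (hΔ : 0 < Δ) (hε : 0 < ε)
    (hε1 : ε ≤ 1 / 2) (hδ : 0 < δ) (hδ1 : δ < 1 / 2) :
    ∃ α : ℝ, 2 ≤ α ∧ Real.exp ((α - 1 / 2) ^ 2 *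
      (T * (2 * Δ / noiseScale T Δ ε δ) ^ 2) / 2 - (α - 1) * ε) / (2 * α) ≤ δ := by
  have hT' : (0 : ℝ) < T := by exact_mod_cast hT
  set L := Real.log (1 / δ) with hL
  have hL1 : 1 / 2 < L := by
    rw [hL, Real.lt_log_iff_exp_lt (by positivity)]
    have h2 : 2 < 1 / δ := by rw [lt_div_iff₀ hδ]; linarith
    linarith [exp_half_lt]
  have hLe : 8 * L ≤ 4 * L / ε := by
    rw [le_div_iff₀ hε]; nlinarith
  -- Not the minimizer of the exponent, which is `8 L / ε + 1 / 2`, but enough: the exponent `-3 L +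
  -- ε / 2` is already below `-L`.
  refine ⟨4 * L / ε + 1 / 2, by linarith, ?_⟩
  have e2 : (T : ℝ) * (2 * Δ / noiseScale T Δ ε δ) ^ 2 = ε ^ 2 / (8 * L) := by
    have : noiseScale T Δ ε δ ^ 2 = Δ ^ 2 * (32 * T * L) / ε ^ 2 := by
      rw [noiseScale, div_pow, mul_pow, Real.sq_sqrt (by positivity)]
    rw [div_pow, this]; field_simp; norm_num
  have e3 : (4 * L / ε + 1 / 2 - 1 / 2) ^ 2 * (T * (2 * Δ / noiseScale T Δ ε δ) ^ 2) / 2 -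
      (4 * L / ε + 1 / 2 - 1) * ε = -3 * L + ε / 2 := by
    rw [e2]; field_simp; ring
  have e4 : Real.exp (-L) = δ := by
    rw [Real.exp_neg, hL, Real.exp_log (by positivity), inv_div, div_one]
  rw [e3]
  calc _ ≤ Real.exp (-3 * L + ε / 2) := div_le_self (Real.exp_pos _).le (by linarith)
    _ ≤ Real.exp (-L) := Real.exp_le_exp.2 (by linarith)
    _ = δ := e4

theorem sparseVector_isPrivate (hT : 0 < T) (hΔ : 0 < Δ) (hε : 0 < ε)
    (hε1 : ε ≤ 1 / 2) (hδ : 0 < δ) (hδ1 : δ < 1 / 2) (k : ℕ) :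
    (sparseVector n X T Δ α₀ ε δ).IsPrivate k Δ ε δ := by
  intro B hB
  have hSV : (sparseVector n X T Δ α₀ ε δ).IsValid := sparseVector_isValid
  have hg := fun D => hSV.isProbabilityMeasure_game B D k
  refine ⟨fun D => Measure.isProbabilityMeasure_map (by fun_prop), fun D D' hD A hA => ?_⟩
  rw [Measure.map_apply measurable_fst hA, Measure.map_apply measurable_fst hA]
  obtain ⟨a, ha, hfail⟩ := sparseVector_failure_le hT hΔ hε hε1 hδ hδ1
  have hσ : 0 < noiseScale T Δ ε δ := by
    rw [noiseScale]
    have : 0 < Real.log (1 / δ) := Real.log_pos (by rw [lt_div_iff₀ hδ]; linarith)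
    positivity
  have hβ0 : 0 < 1 - 1 / a := by
    have : 1 / a < 1 := (div_lt_one (by linarith)).2 (by linarith)
    linarith
  have hAm : MeasurableSet (Prod.fst ⁻¹' A : Set ((Fin k → Bool ⊕ Unit) × (ℕ × ℝ))) :=
    measurable_fst hA
  set f : (Fin k → Bool ⊕ Unit) × (ℕ × ℝ) → ℝ≥0∞ := (Prod.fst ⁻¹' A).indicator fun _ => 1
    with hf
  have hfm : Measurable f := measurable_const.indicator hAm
  have hf1 : ∀ ω, f ω ≤ 1 := Set.indicator_le_self' (by simp)
  have hfv : ∀ b s s', f (b, s) = f (b, s') := fun b s s' => by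
    by_cases hb : b ∈ A
    · rw [hf, Set.indicator_of_mem (by exact hb), Set.indicator_of_mem (by exact hb)]
    · rw [hf, Set.indicator_of_notMem (by exact hb), Set.indicator_of_notMem (by exact hb)]
  have hfp : ∀ ω, f ω ^ (1 - 1 / a) = f ω := fun ω => by
    by_cases hb : ω ∈ (Prod.fst ⁻¹' A : Set ((Fin k → Bool ⊕ Unit) × (ℕ × ℝ)))
    · rw [hf, Set.indicator_of_mem hb, ENNReal.one_rpow]
    · rw [hf, Set.indicator_of_notMem hb, ENNReal.zero_rpow_of_pos hβ0]
  have key := lintegral_game_sparseVector_le (α₀ := α₀) hB hD hT rfl hσ hΔ (α := a) (by linarith) k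
    hfm hfm hf1 (fun b τ => (hfp _).ge) fun b c hc ρ ρ' hρ hρ' => by
      -- At the end of the game the test function no longer depends on the threshold, so the
      -- unfinished epoch is a single weight.
      refine ⟨1, fun _ => ρ Set.univ, fun _ => ρ' Set.univ, fun _ => f (b, (c, 0)),
        fun _ => hρ.measure_univ_le hσ hΔ.le, fun _ => hρ'.measure_univ_le hσ hΔ.le, by simp,
        by simp, fun _ => hf1 _, ?_, ?_⟩
      · simp_rw [fun τ => hfv b (c, τ) (c, 0)]
        rw [lintegral_const, Fin.sum_univ_one, hfp, mul_comm (ρ _)]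
        exact le_mul_of_one_le_left' (one_le_pow₀ (stepFactor_ge_one (by linarith)))
      · simp_rw [fun τ => hfv b (c, τ) (c, 0)]
        rw [lintegral_const, Fin.sum_univ_one, mul_comm]
  have hD' := hg D'
  rw [hf, lintegral_indicator_const hAm, lintegral_indicator_const hAm, one_mul, one_mul] at key
  refine key.trans ((stepFactor_pow_mul_rpow_le (η := ε) ha prob_le_one).trans ?_)
  gcongr

end Sparse

end PMW

end

theorem theorem3p7 {X : Type u} [Fintype X] [DecidableEq X] [Nonempty X] {n d : ℕ} (hn : 0 < n)
    {ι : Type v} [MeasurableSpace ι]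
    (Θ : Set (EuclideanSpace ℝ (Fin d))) (hΘ : Convex ℝ Θ)
    (loss : ι → X → EuclideanSpace ℝ (Fin d) → ℝ)
    (hconv : ∀ i x, ConvexOn ℝ Θ (loss i x))
    (hdiff : ∀ i x, DifferentiableOn ℝ (loss i x) Θ)
    (hmeas : ∀ x, ∀ θ ∈ Θ, Measurable fun i => loss i x θ)
    (amin : ι → (X → ℝ) → Θ) (hamin : PMW.IsArgmin Θ loss amin)
    (hamin_meas : Measurable (Function.uncurry amin))
    (S α ε δ : ℝ) (hS : 0 < S) (hα : 0 < α) (hε : 0 < ε) (hε1 : ε ≤ 1) (hδ : 0 < δ)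
    (hscale : ∀ i x, ∀ θ ∈ Θ, ∀ θ' ∈ Θ,
      |inner ℝ (θ - θ') (gradientWithin (loss i x) Θ θ)| ≤ S)
    (k T : ℕ) (hT : T = PMW.numUpdates X S α)
    (oracle : (Fin n → X) → Kernel ι Θ)
    (horacle : ∀ i, PMW.IsDP (fun D => oracle D i) (PMW.oracleEps T ε δ) (PMW.oracleDelta T δ))
    (analyst : (j : ℕ) → Kernel (Fin j → ι × (Θ ⊕ Unit)) ι)
    (hanalyst : ∀ j, IsMarkovKernel (analyst j)) :
    (∀ SV : PMW.SVAlg.{u, w} n X, SV.IsValid →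
        SV.IsPrivate k (3 * S / n) (ε / 2) (δ / 2) → SV.HaltsAfter k (3 * S / n) T →
        PMW.IsDP
          (PMW.onlinePMW Θ loss amin oracle SV (PMW.learningRate X T) analyst k) ε δ) ∧
      PMW.IsDP
        (PMW.onlinePMW Θ loss amin oracle
          (PMW.sparseVector n X T (3 * S / n) α (ε / 2) (δ / 2))
          (PMW.learningRate X T) analyst k) ε δ := by
  have hΔ : 0 < 3 * S / n := by positivity
  refine ⟨fun SV hSV hp hh => PMW.isDP_onlinePMW hn hΘ hconv hdiff hmeas hamin hamin_meas hS hα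
      hε hε1 hδ hscale hT horacle hanalyst _ hSV (fun _ _ => hp) hh,
    PMW.isDP_onlinePMW hn hΘ hconv hdiff hmeas hamin hamin_meas hS hα
      hε hε1 hδ hscale hT horacle hanalyst _ PMW.sparseVector_isValid (fun hX hδ1 => ?_)
      (PMW.sparseVector_haltsAfter k _)⟩
  have : Nontrivial X := Fintype.one_lt_card_iff_nontrivial.1 hX
  exact PMW.sparseVector_isPrivate (hT ▸ PMW.numUpdates_pos hS hα) hΔ (by positivity)
    (by linarith) (by positivity) (by linarith) k
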